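/- All manifolds are $C^\infty$, Hausdorff, second countable and without boundary; submanifolds are embedded, of class $C^\infty$, without boundary, not necessarily closed or compact. Let $Q$ be a Riemannian manifold of dimension $n\ge 1$ with metric $g$ and a fixed spin structure. For a submanifold $K\subset Q$ let $$L_K=\{(q,p)\in T^*Q\mid q\in K,\ p|_{T_qK}=0\},\qquad \Lambda_K=\{(q,p)\in L_K\mid |p|_g=1\}$$ be its conormal bundle and unit conormal bundle; $\Lambda_K$ is a Legendrian submanifold of $UT^*Q=\{(q,p)\in T^*Q\mid |p|_g=1\}$ with the contact structure $\ker (p\,dq)$. (A spin structure on a $k$-dimensional manifold is an orientation together with a two-sheeted covering of the bundle of positive tangent frames that, for $k\ge 2$, is nontrivial over each fibre.) Then to every submanifold $K$ of $Q$ one can assign a spin structure $\sigma_K$ on $\Lambda_K$ such that the following hold. 1. For every $K$, $\sigma_K$ is induced by the spin structure of $Q$ in the following sense: there is a spin structure $\tau$ on $L_K$ whose restriction to the zero section corresponds to the spin structure of $TQ|_K$ under the isomorphism $T_{(q,0)}L_K\cong T_qK\oplus (T_qK)^{\perp}=T_qQ$ for $q\in K$, and whose restriction to $\Lambda_K$ is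 the spin structure induced by $\sigma_K$ under $TL_K|_{\Lambda_K}=\mathbb{R}\,\partial_r\oplus T\Lambda_K$, where $\partial_r$ is the radial vector field of the fibres of $L_K$. 2. If $K$ and $K'$ are isotopic, that is, if there is a $C^\infty$ family of embeddings $f_t\colon K\to Q$, $t\in[0,1]$, such that $f_0$ is the inclusion and $f_1(K)=K'$, then $(\Lambda_K,\sigma_K)$ and $(\Lambda_{K'},\sigma_{K'})$ are isotopic as Legendrian submanifolds with spin structures: there is a $C^\infty$ family of embeddings $F_t\colon \Lambda_K\to UT^*Q$, $t\in[0,1]$, such that every $F_t(\Lambda_K)$ is Legendrian, $F_0$ is the inclusion, $F_1(\Lambda_K)=\Lambda_{K'}$, and the diffeomorphism $F_1\colon\Lambda_K\to\Lambda_{K'}$ takes $\sigma_K$ to $\sigma_{K'}$ up to isomorphism. -/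

import Mathlib

open Set Topology
open scoped Manifold Bundle ContDiff

universe u

noncomputable section

/-! ### Embedded submanifolds of a manifold, as subsets -/

section Submanifolds

variable {E : Type} [NormedAddCommGroup E] [NormedSpace ℝ E]
  {H : Type} [TopologicalSpace H] (I : ModelWithCorners ℝ E H)
  {M : Type u} [TopologicalSpace M] [ChartedSpace H M]

/-- `S` is an embedded `C^∞` submanifold of dimension `k`: near each of its points it is a regular
level set of a smooth map with values in a space of dimension `dim M - k`. It need not be closed
or compact. -/
def IsSubmanifold (k : ℕ) (S : Set M) : Prop :=
  ∀ x ∈ S, ∃ (c : ℕ) (U : Set M) (h : M → EuclideanSpace ℝ (Fin c)),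
    c + k = Module.finrank ℝ E ∧ IsOpen U ∧ x ∈ U ∧
    ContMDiffOn I 𝓘(ℝ, EuclideanSpace ℝ (Fin c)) ∞ h U ∧
    Function.Surjective (mfderiv I 𝓘(ℝ, EuclideanSpace ℝ (Fin c)) h x) ∧
    S ∩ U = {y ∈ U | h y = 0}

/-- The tangent space of `S` at `x`, spanned by the velocities at `x` of the curves in `S`.
(If `S` is an embedded submanifold, these velocities form a linear subspace already.) -/
def tangentSpaceOf (S : Set M) (x : M) : Submodule ℝ (TangentSpace I x) :=
  Submodule.span ℝ {v | ∃ γ : ℝ → M, γ 0 = x ∧ (∀ᶠ t in 𝓝 0, γ t ∈ S) ∧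
    MDifferentiableAt 𝓘(ℝ, ℝ) I γ 0 ∧ mfderiv 𝓘(ℝ, ℝ) I γ 0 (1 : ℝ) = v}

/-- An embedded submanifold of `M`, of any dimension. -/
structure EmbeddedSubmanifold (M : Type u) [TopologicalSpace M] [ChartedSpace H M] where
  carrier : Set M
  dim : ℕ
  isSubmanifold : IsSubmanifold I dim carrier

/-- `F` is a `C^∞` isotopy `(F t : S → M)`, `t ∈ [0,1]`, of embeddings from the submanifold `S` to
the submanifold `S'` (the values `F t x` for `t ∉ [0,1]` or `x ∉ S` are irrelevant).

A derivative of `F t` within `S` is determined on the tangent space of `S`, so `mfderivWithin`,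
restricted to this space, is the differential of `F t : S → M`. -/
structure IsSmoothIsotopy (S S' : Set M) (F : ℝ → M → M) : Prop where
  contMDiffOn : ContMDiffOn (𝓘(ℝ, ℝ).prod I) I ∞ (fun p : ℝ × M => F p.1 p.2) (Icc 0 1 ×ˢ S)
  isEmbedding : ∀ t ∈ Icc (0 : ℝ) 1, IsEmbedding (S.domRestrict (F t))
  immersion : ∀ t ∈ Icc (0 : ℝ) 1, ∀ x ∈ S,
    InjOn (mfderivWithin I I (F t) S x) (tangentSpaceOf I S x)
  map_zero : ∀ x ∈ S, F 0 x = x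
  image_one : F 1 '' S = S'

/-- The submanifolds `S` and `S'` of `M` are isotopic. -/
def AreIsotopic (S S' : Set M) : Prop := ∃ F : ℝ → M → M, IsSmoothIsotopy I S S' F

/-! ### Frames and spin structures -/

/-- A point of the frame bundle of `S`, for `S` of dimension `k`: `k` linearly independent tangent
vectors of `S` at a point of `S`. -/
structure TangentFrame (S : Set M) (k : ℕ) where
  pt : M
  mem : pt ∈ S
  vec : Fin k → TangentSpace I pt
  tangent : ∀ i, vec i ∈ tangentSpaceOf I S pt
  indep : LinearIndependent ℝ vec

/-- The vectors of a frame as points of the tangent bundle of `M`. -/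
def TangentFrame.toBundle {I : ModelWithCorners ℝ E H} {S : Set M} {k : ℕ}
    (f : TangentFrame I S k) (i : Fin k) : TangentBundle I M := ⟨f.pt, f.vec i⟩

/-- The topology of the frame bundle, as a subspace of `M × TM × ⋯ × TM`. -/
instance TangentFrame.instTopologicalSpace [IsManifold I ∞ M] (S : Set M) (k : ℕ) :
    TopologicalSpace (TangentFrame I S k) :=
  TopologicalSpace.induced (fun f => (f.pt, f.toBundle))
    (inferInstanceAs (TopologicalSpace (M × (Fin k → TangentBundle I M))))

/-- A spin structure on the submanifold `S` of dimension `k`: an orientation of `S`, given by the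
set of the positive frames, and a two-sheeted covering of the bundle of the positive frames of `S`
(whose fibres are copies of `GL⁺(k, ℝ)`) that is nontrivial over each fibre when `k ≥ 2`.

An orientation of a manifold of dimension `0` is a sign at each point; there, `positive` contains
the empty frame at `x` if the sign of `x` is `+`, and the covering is a covering of `S` itself. -/
structure SpinStructure [IsManifold I ∞ M] (S : Set M) (k : ℕ) where
  positive : Set (TangentFrame I S k)
  isClopen_positive : IsClopen positive
  positive_iff : ∀ (f f' : TangentFrame I S k) (A : Matrix (Fin k) (Fin k) ℝ), f'.pt = f.pt →
    (∀ i, f'.toBundle i = ⟨f.pt, ∑ j, A i j • f.vec j⟩) →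
    (f' ∈ positive ↔ (f ∈ positive ↔ 0 < A.det))
  cover : Type u
  [topologicalSpace : TopologicalSpace cover]
  proj : cover → TangentFrame I S k
  isCoveringMap : IsCoveringMap proj
  range_proj : range proj = {f | k = 0 ∨ f ∈ positive}
  ncard_fiber : ∀ f ∈ range proj, (proj ⁻¹' {f}).ncard = 2
  nontrivial : 2 ≤ k → ∀ x ∈ S, IsConnected {p | (proj p).pt = x}

attribute [instance] SpinStructure.topologicalSpace

end Submanifolds

section Lifts

variable {E E' H H' : Type} [NormedAddCommGroup E] [NormedSpace ℝ E]
  [NormedAddCommGroup E'] [NormedSpace ℝ E'] [TopologicalSpace H] [TopologicalSpace H']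
  {I : ModelWithCorners ℝ E H} {I' : ModelWithCorners ℝ E' H'}
  {M M' : Type u} [TopologicalSpace M] [ChartedSpace H M] [IsManifold I ∞ M]
  [TopologicalSpace M'] [ChartedSpace H' M'] [IsManifold I' ∞ M']

/-- Let `R` be the graph of a map `Φ` from the frames of `S` at the points of `A` to the
frames of `S'`. Then `R` lifts to the spin structures `σ` and `τ` if there is a continuous map over
`Φ` from the covering of `σ` (over `A`) to that of `τ` which is injective, hence bijective, on the
fibres, that is, if `σ` is isomorphic over `A` to the pullback of `τ` by `Φ`. -/
def LiftsToSpin {S : Set M} {S' : Set M'} {k k' : ℕ}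
    (σ : SpinStructure I S k) (τ : SpinStructure I' S' k') (A : Set M)
    (R : TangentFrame I S k → TangentFrame I' S' k' → Prop) : Prop :=
  ∃ Ψ : {p : σ.cover // (σ.proj p).pt ∈ A} → τ.cover, Continuous Ψ ∧
    (∀ p, R (σ.proj p.1) (τ.proj (Ψ p))) ∧
    ∀ p p', σ.proj p.1 = σ.proj p'.1 → Ψ p = Ψ p' → p = p'

/-- The map `φ`, which restricts to a diffeomorphism from `S` to `S'`, takes the spin structure `σ`
of `S` to the spin structure `τ` of `S'`: it preserves the orientations, and its differential lifts
to the coverings. -/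
def PreservesSpin {S S' : Set M} {k : ℕ} (φ : M → M)
    (σ : SpinStructure I S k) (τ : SpinStructure I S' k) : Prop :=
  (∀ (f : TangentFrame I S k) (f' : TangentFrame I S' k), f'.pt = φ f.pt →
    (∀ i, f'.toBundle i = tangentMapWithin I I φ S (f.toBundle i)) →
    (f' ∈ τ.positive ↔ f ∈ σ.positive)) ∧
  LiftsToSpin σ τ S fun f f' => f'.pt = φ f.pt ∧
    ∀ i, f'.toBundle i = tangentMapWithin I I φ S (f.toBundle i)

end Lifts

/-! ### Cotangent bundle, unit conormal bundle, Legendrian submanifolds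

The manifold `Q` has dimension `n = m + 1`. -/

section Conormal

/-- The model of the cotangent bundle of a manifold of dimension `n`. -/
abbrev cotangentModel (n : ℕ) :=
  (𝓡 n).prod 𝓘(ℝ, EuclideanSpace ℝ (Fin n) →L[ℝ] ℝ)

/-- The cotangent bundle `T^*Q`. -/
abbrev Cotangent (n : ℕ) (Q : Type u) [TopologicalSpace Q]
    [ChartedSpace (EuclideanSpace ℝ (Fin n)) Q] : Type u :=
  Bundle.TotalSpace (EuclideanSpace ℝ (Fin n) →L[ℝ] ℝ)
    (fun x : Q => TangentSpace (𝓡 n) x →L[ℝ] Bundle.Trivial Q ℝ x)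

/-- `C^∞` Riemannian metrics on `Q`. -/
abbrev RiemMetric (n : ℕ) (Q : Type u) [TopologicalSpace Q]
    [ChartedSpace (EuclideanSpace ℝ (Fin n)) Q] [IsManifold (𝓡 n) ∞ Q] :=
  Bundle.ContMDiffRiemannianMetric (𝓡 n) ∞ (EuclideanSpace ℝ (Fin n))
    (fun x : Q => TangentSpace (𝓡 n) x)

variable {n : ℕ} {Q : Type u} [TopologicalSpace Q]
  [ChartedSpace (EuclideanSpace ℝ (Fin n)) Q] [IsManifold (𝓡 n) ∞ Q]

/-- The unit cotangent bundle `UT^*Q`: the covectors `⟨v, ·⟩` for unit vectors `v`. -/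
def unitCotangent (g : RiemMetric n Q) : Set (Cotangent n Q) :=
  {ξ | ∃ v : TangentSpace (𝓡 n) ξ.proj, g.inner ξ.proj v v = 1 ∧ g.inner ξ.proj v = ξ.2}

/-- The conormal bundle `L_K`. -/
def conormalBundle (K : Set Q) : Set (Cotangent n Q) :=
  {ξ | ξ.proj ∈ K ∧ ∀ v ∈ tangentSpaceOf (𝓡 n) K ξ.proj, ξ.2 v = 0}

/-- The unit conormal bundle `Λ_K`. -/
def unitConormalBundle (g : RiemMetric n Q) (K : Set Q) : Set (Cotangent n Q) :=
  conormalBundle K ∩ unitCotangent g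

/-- The canonical 1-form `p dq` on `T^*Q`; its restriction to `UT^*Q` is the contact form. -/
def liouvilleForm (ξ : Cotangent n Q) (v : TangentSpace (cotangentModel n) ξ) : ℝ :=
  ξ.2 (mfderiv (cotangentModel n) (𝓡 n) (fun η : Cotangent n Q => η.proj) ξ v)

/-- The vertical tangent vector of `T^*Q` at `ξ` given by a covector `η` in the fibre of `ξ`:
the velocity of `ξ + t η` at `t = 0`. -/
def verticalLift (ξ : Cotangent n Q) (η : TangentSpace (𝓡 n) ξ.proj →L[ℝ] ℝ) :
    TangentSpace (cotangentModel n) ξ :=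
  mfderiv 𝓘(ℝ, ℝ) (cotangentModel n)
    (fun t : ℝ => (⟨ξ.proj, ξ.2 + t • η⟩ : Cotangent n Q)) 0 (1 : ℝ)

/-- The radial vector at `ξ = (q, p)`: the velocity of `(q, r p)` at `r = 1`. -/
def radialVector (ξ : Cotangent n Q) : TangentSpace (cotangentModel n) ξ :=
  verticalLift ξ ξ.2

/-- The zero covector at `q`. -/
def zeroCovector (q : Q) : Cotangent n Q := ⟨q, 0⟩

/-- The tangent vector of `T^*Q` at the zero covector of `q` whose horizontal part, tangent to the
zero section, is `a`, and whose vertical part is the covector `⟨w, ·⟩`. -/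
def zeroSectionVector (g : RiemMetric n Q) (q : Q) (a w : TangentSpace (𝓡 n) q) :
    TangentSpace (cotangentModel n) (zeroCovector q : Cotangent n Q) :=
  mfderiv (𝓡 n) (cotangentModel n) (zeroCovector : Q → Cotangent n Q) q a +
    verticalLift (zeroCovector q) (g.inner q w)

end Conormal

section Main

variable {m : ℕ} {Q : Type u} [TopologicalSpace Q]
  [ChartedSpace (EuclideanSpace ℝ (Fin (m + 1))) Q] [IsManifold (𝓡 (m + 1)) ∞ Q]

/-- Legendrian submanifolds of the contact manifold `UT^*Q`, of dimension `2 m + 1`. -/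
structure IsLegendrian (g : RiemMetric (m + 1) Q) (Λ : Set (Cotangent (m + 1) Q)) : Prop where
  subset : Λ ⊆ unitCotangent g
  isSubmanifold : IsSubmanifold (cotangentModel (m + 1)) m Λ
  liouville : ∀ ξ ∈ Λ, ∀ v ∈ tangentSpaceOf (cotangentModel (m + 1)) Λ ξ, liouvilleForm ξ v = 0

/-- `Λ` and `Λ'` with the spin structures `σ` and `σ'` are isotopic as Legendrian submanifolds of
`UT^*Q` with spin structures. -/
def AreLegendrianSpinIsotopic (g : RiemMetric (m + 1) Q) {Λ Λ' : Set (Cotangent (m + 1) Q)}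
    (σ : SpinStructure (cotangentModel (m + 1)) Λ m)
    (σ' : SpinStructure (cotangentModel (m + 1)) Λ' m) : Prop :=
  ∃ F : ℝ → Cotangent (m + 1) Q → Cotangent (m + 1) Q,
    IsSmoothIsotopy (cotangentModel (m + 1)) Λ Λ' F ∧
    (∀ t ∈ Icc (0 : ℝ) 1, IsLegendrian g (F t '' Λ)) ∧
    PreservesSpin (F 1) σ σ'

/-- The graph of the map that takes a frame of `TQ` at `q ∈ K` to a frame of `L_K` at the zero
covector of `q`, by `T_qQ = T_qK ⊕ (T_qK)^⊥ ≅ T_{(q,0)} L_K`. -/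
def ZeroSectionFrames (g : RiemMetric (m + 1) Q) (K : Set Q)
    (f : TangentFrame (𝓡 (m + 1)) (univ : Set Q) (m + 1))
    (f' : TangentFrame (cotangentModel (m + 1))
      (conormalBundle K : Set (Cotangent (m + 1) Q)) (m + 1)) : Prop :=
  ∀ i, ∃ a ∈ tangentSpaceOf (𝓡 (m + 1)) K f.pt, ∃ w : TangentSpace (𝓡 (m + 1)) f.pt,
    (∀ b ∈ tangentSpaceOf (𝓡 (m + 1)) K f.pt, g.inner f.pt w b = 0) ∧
    f.vec i = a + w ∧ f'.toBundle i = ⟨zeroCovector f.pt, zeroSectionVector g f.pt a w⟩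

/-- The spin structure `σ` of `Λ_K` is the one induced by the spin structure `σQ` of `Q`: there is
a spin structure `τ` of `L_K` such that
* over the zero section, `τ` corresponds to `σQ` by `T_qQ = T_qK ⊕ (T_qK)^⊥ ≅ T_{(q,0)} L_K`;
* along `Λ_K`, `τ` is induced by `σ`, by `T L_K = ℝ ∂_r ⊕ T Λ_K`: the frame `(v₁, …, v_m)` of `Λ_K`
  corresponds to the frame `(∂_r, v₁, …, v_m)` of `L_K`.

(The sign of `∂_r` matters for `m = 0` only, where the orientation of a point of `Λ_K` is that of
`∂_r`; for `m > 0`, the covering consists of positive frames.) -/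
def IsInducedSpin (g : RiemMetric (m + 1) Q) (K : Set Q)
    (σQ : SpinStructure (𝓡 (m + 1)) (univ : Set Q) (m + 1))
    (σ : SpinStructure (cotangentModel (m + 1)) (unitConormalBundle g K) m) : Prop :=
  ∃ τ : SpinStructure (cotangentModel (m + 1)) (conormalBundle K : Set (Cotangent (m + 1) Q))
      (m + 1),
    LiftsToSpin σQ τ K (ZeroSectionFrames g K) ∧
    LiftsToSpin σ τ univ fun f f' =>
      (f ∈ σ.positive → f'.toBundle 0 = ⟨f.pt, radialVector f.pt⟩) ∧
      (f ∉ σ.positive → f'.toBundle 0 = ⟨f.pt, -radialVector f.pt⟩) ∧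
      ∀ i, f'.toBundle i.succ = f.toBundle i

end Main

end

/-! Write `π` for the projection of `L_K` to `Q`. The bundle `TL_K` is isomorphic to the pullback
`π^*TQ` over all of `L_K`, not only over the zero section. A tangent vector at `ξ` is sent to the
sum of its projection, which lies in `T_qK`, and of the normal part of its vertical component,
raised to a vector by the metric (`conormalMap`). If this sum is zero, so are both summands; then
the vector is vertical, given by a conormal covector, and hence zero (`conormalMap_injOn`). Over the
zero section the map is the isomorphism of the statement.

The covering of the frames of `Q` therefore pulls back to a spin structure of `L_K` (`conormalSpin`)
and, along `f ↦ (∂_r, f)`, to one of `Λ_K` (`unitConormalSpin`). Both conditions of an induced spin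
structure then hold by construction. What has to be proved is that the pullback to `Λ_K` is
nontrivial over each fibre when `m ≥ 2`: the covering stays connected over the frames with a
prescribed first vector and the others in a prescribed complementary hyperplane
(`SpinStructure.isConnected_adapted`). Frames are moved by shears that turn the first vector, and
the motions lift to the covering; any locally constant function on the smaller covering extends to
the whole fibre of the covering, because the complement of a line in a space of dimension at least
three is connected. For `m = 0` the covering has to lie over all frames, and the sign of `∂_r` is
chosen to make each of them positive (`radialSign`).

For an isotopy `f` of `K`, an extension to an ambient isotopy is not available, since `K` need be
neither closed nor compact. A linear extension is enough: a smooth family of invertible maps from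
`T_xQ` to the tangent space at `f t x` that extends the differential of `f t` on `T_xK`
(`TangentEmbedding.exists_transport`). It is a product of steps between nearby times, each close to
the identity, with a step size that depends smoothly on `x`. The dual of the inverse, followed by
normalization, carries `Λ_K` onto the unit conormal bundle of `f t '' K`
(`exists_unitConormal_isotopy`), which is Legendrian at every time. The frames of `Q` obtained from
the images of frames of `Λ_K` under this motion form a homotopy, and its lift to the covering of `Q`
ends in the required isomorphism of spin structures (`preservesSpin_of_isotopy`).

All of this takes place in a fixed space: `TQ` is embedded in a trivial bundle with fibre `V` and a
smooth left inverse (`nonempty_tangentEmbedding`), so that bundle maps become operators on `V`. -/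

noncomputable section

set_option linter.unusedSectionVars false

/-! ### The inverse function theorem on manifolds -/

section LocalInverse

/-- The target carries the model of the single vector space `F × G` and not a product of models,
since level functions with several components are treated below as maps to one space. -/
theorem HasMFDerivAt.prodMk_vectorSpace {E : Type*} [NormedAddCommGroup E] [NormedSpace ℝ E]
    {H : Type*} [TopologicalSpace H] {I : ModelWithCorners ℝ E H} {M : Type*} [TopologicalSpace M]
    [ChartedSpace H M] {F G : Type*} [NormedAddCommGroup F] [NormedSpace ℝ F]
    [NormedAddCommGroup G] [NormedSpace ℝ G] {x : M} {f : M → F} {g : M → G}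
    {f' : E →L[ℝ] F} {g' : E →L[ℝ] G}
    (hf : HasMFDerivAt I 𝓘(ℝ, F) f x f') (hg : HasMFDerivAt I 𝓘(ℝ, G) g x g') :
    HasMFDerivAt I 𝓘(ℝ, F × G) (fun y => (f y, g y)) x (f'.prod g') :=
  ⟨hf.1.prodMk hg.1, hf.2.prodMk hg.2⟩

variable {E : Type*} [NormedAddCommGroup E] [NormedSpace ℝ E] [FiniteDimensional ℝ E]
  {H : Type*} [TopologicalSpace H] {I : ModelWithCorners ℝ E H} [I.Boundaryless]
  {M : Type*} [TopologicalSpace M] [ChartedSpace H M] [IsManifold I ∞ M]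
  {G : Type*} [NormedAddCommGroup G] [NormedSpace ℝ G]

/-- The inverse function theorem for smooth maps from a manifold to a vector space. -/
theorem ContMDiffOn.exists_local_inverse {U : Set M} (hU : IsOpen U) {x : M} (hx : x ∈ U)
    {Φ : M → G} (hΦ : ContMDiffOn I 𝓘(ℝ, G) ∞ Φ U)
    (hb : Function.Bijective (mfderiv I 𝓘(ℝ, G) Φ x)) :
    ∃ (Ψ : G → M) (O : Set M) (B : Set G), IsOpen O ∧ IsOpen B ∧ x ∈ O ∧ O ⊆ U ∧
      MapsTo Φ O B ∧ MapsTo Ψ B O ∧ (∀ y ∈ O, Ψ (Φ y) = y) ∧ (∀ b ∈ B, Φ (Ψ b) = b) ∧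
      ContMDiffOn 𝓘(ℝ, G) I ∞ Ψ B := by
  have : CompleteSpace E := FiniteDimensional.complete ℝ E
  set φ := extChartAt I x with hφ
  set f : E → G := Φ ∘ φ.symm with hf
  set T : Set E := φ.target ∩ φ.symm ⁻¹' U with hT
  have hTo : IsOpen T :=
    (continuousOn_extChartAt_symm x).isOpen_inter_preimage (isOpen_extChartAt_target x) hU
  have hxT : φ x ∈ T := ⟨mem_extChartAt_target x, by simpa [hφ] using hx⟩
  have hfT : ContDiffOn ℝ ∞ f T := by
    rw [← contMDiffOn_iff_contDiffOn]
    exact hΦ.comp ((contMDiffOn_extChartAt_symm x).mono inter_subset_left) fun y hy => hy.2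
  have hfx : ContDiffAt ℝ ∞ f (φ x) := hfT.contDiffAt (hTo.mem_nhds hxT)
  have hΦx : MDifferentiableAt I 𝓘(ℝ, G) Φ x :=
    ((hΦ x hx).contMDiffAt (hU.mem_nhds hx)).mdifferentiableAt (by simp)
  have hder : mfderiv I 𝓘(ℝ, G) Φ x = fderiv ℝ f (φ x) := by
    simp only [mfderiv, hΦx, writtenInExtChartAt, extChartAt_model_space_eq_id]
    rw [I.range_eq_univ, fderivWithin_univ]
    rfl
  let f' : E ≃L[ℝ] G := (LinearEquiv.ofBijective (fderiv ℝ f (φ x)).toLinearMap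
    (by rw [hder] at hb; exact hb)).toContinuousLinearEquiv
  have hf' : HasFDerivAt f (f' : E →L[ℝ] G) (φ x) := by
    have : (f' : E →L[ℝ] G) = fderiv ℝ f (φ x) := by ext; rfl
    rw [this]
    exact (hfx.differentiableAt (by simp)).hasFDerivAt
  let e := hfx.toOpenPartialHomeomorph f hf' (by simp)
  have hef : (e : E → G) = f := rfl
  -- The derivative may fail to be invertible away from the base point. Cutting down to the open set
  -- where it is invertible makes the inverse smooth on its whole domain.
  set T' : Set E := {y ∈ T | fderiv ℝ f y ∈ range ((↑) : (E ≃L[ℝ] G) → E →L[ℝ] G)} with hT'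
  have hT'o : IsOpen T' := by
    have hc : ContinuousOn (fderiv ℝ f) T := hfT.continuousOn_fderiv_of_isOpen hTo (by simp)
    exact hc.isOpen_inter_preimage hTo ContinuousLinearEquiv.isOpen
  have hxT' : φ x ∈ T' := ⟨hxT, f', by ext; rfl⟩
  have hxe : φ x ∈ e.source := hfx.mem_toOpenPartialHomeomorph_source hf' (by simp)
  let e' := e.restrOpen T' hT'o
  have he's : e'.source = e.source ∩ T' := rfl
  have he'c : ∀ y, e' y = f y := fun y => rfl
  have hsymm : ContDiffOn ℝ ∞ e'.symm e'.target := by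
    intro b hb'
    have hs : e'.symm b ∈ e.source ∩ T' := e'.map_target hb'
    obtain ⟨a, ha⟩ := hs.2.2
    refine (e'.contDiffAt_symm (f₀' := a) hb' ?_ ?_).contDiffWithinAt
    · rw [ha]
      exact ((hfT.contDiffAt (hTo.mem_nhds hs.2.1)).differentiableAt (by simp)).hasFDerivAt
    · exact hfT.contDiffAt (hTo.mem_nhds hs.2.1)
  refine ⟨φ.symm ∘ e'.symm, φ.source ∩ φ ⁻¹' e'.source, e'.target, ?_, e'.open_target, ?_, ?_, ?_,
    ?_, ?_, ?_, ?_⟩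
  · exact (continuousOn_extChartAt x).isOpen_inter_preimage (isOpen_extChartAt_source x)
      e'.open_source
  · exact ⟨mem_extChartAt_source x, hxe, hxT'⟩
  · rintro y ⟨hy, hy'⟩
    have := hy'.2.1.2
    simpa [φ.left_inv hy] using this
  · rintro y ⟨hy, hy'⟩
    have := e'.map_source hy'
    rw [he'c] at this
    simpa [hf, φ.left_inv hy] using this
  · intro b hb'
    have hs : e'.symm b ∈ e.source ∩ T' := e'.map_target hb'
    refine ⟨φ.map_target hs.2.1.1, ?_⟩
    simp only [mem_preimage, Function.comp, φ.right_inv hs.2.1.1]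
    exact hs
  · rintro y ⟨hy, hy'⟩
    have : e'.symm (f (φ y)) = φ y := e'.left_inv hy'
    have h2 : f (φ y) = Φ y := by simp [hf, φ.left_inv hy]
    rw [h2] at this
    simp [this, φ.left_inv hy]
  · intro b hb'
    exact e'.right_inv hb'
  · refine (contMDiffOn_extChartAt_symm x).comp hsymm.contMDiffOn fun b hb' => ?_
    exact (e'.map_target hb').2.1.1

end LocalInverse

/-! ### Local parametrizations of regular level sets -/

section Params

variable {E : Type} [NormedAddCommGroup E] [NormedSpace ℝ E]
  {H : Type} [TopologicalSpace H] (I : ModelWithCorners ℝ E H)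
  {M : Type u} [TopologicalSpace M] [ChartedSpace H M]

/-- A local parametrization of the subset `S` of `M` by an open subset of a Euclidean space, which
extends to a smooth retraction of a neighbourhood. -/
structure LocalParam (S : Set M) (k : ℕ) where
  U : Set M
  B : Set (EuclideanSpace ℝ (Fin k))
  coord : M → EuclideanSpace ℝ (Fin k)
  param : EuclideanSpace ℝ (Fin k) → M
  isOpen_U : IsOpen U
  isOpen_B : IsOpen B
  smooth_coord : ContMDiffOn I 𝓘(ℝ, EuclideanSpace ℝ (Fin k)) ∞ coord U
  smooth_param : ContMDiffOn 𝓘(ℝ, EuclideanSpace ℝ (Fin k)) I ∞ param B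
  coord_mem : ∀ y ∈ U, coord y ∈ B
  param_mem : ∀ b ∈ B, param b ∈ S
  param_mem_U : ∀ b ∈ B, param b ∈ U
  coord_param : ∀ b ∈ B, coord (param b) = b
  param_coord : ∀ y ∈ S, y ∈ U → param (coord y) = y

variable {I}

/-- `L` is a projection onto the kernel of `A` along a complement. The pair is then injective, and
the dimensions agree. -/
theorem exists_clm_prod_bijective {V W : Type*} [NormedAddCommGroup V] [NormedSpace ℝ V]
    [FiniteDimensional ℝ V] [NormedAddCommGroup W] [NormedSpace ℝ W] [FiniteDimensional ℝ W]
    (A : V →L[ℝ] W) (hA : Function.Surjective A) {k : ℕ}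
    (hk : Module.finrank ℝ W + k = Module.finrank ℝ V) :
    ∃ L : V →L[ℝ] EuclideanSpace ℝ (Fin k), Function.Bijective (A.prod L) := by
  have hker : Module.finrank ℝ (LinearMap.ker A.toLinearMap) =
      Module.finrank ℝ (EuclideanSpace ℝ (Fin k)) := by
    have h1 := LinearMap.finrank_range_add_finrank_ker A.toLinearMap
    rw [LinearMap.range_eq_top.2 (show Function.Surjective A.toLinearMap from hA),
      finrank_top] at h1
    simp only [finrank_euclideanSpace, Fintype.card_fin]
    omega
  let e := LinearEquiv.ofFinrankEq _ _ hker
  obtain ⟨p, hp⟩ := (LinearMap.ker A.toLinearMap).exists_isCompl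
  let L : V →ₗ[ℝ] EuclideanSpace ℝ (Fin k) :=
    e.toLinearMap ∘ₗ Submodule.projectionOnto _ p hp
  refine ⟨L.toContinuousLinearMap, ?_⟩
  have hinj : Function.Injective (A.prod L.toContinuousLinearMap) := by
    rw [injective_iff_map_eq_zero]
    intro v hv
    simp only [ContinuousLinearMap.prod_apply, Prod.mk_eq_zero] at hv
    have h1 : v ∈ LinearMap.ker A.toLinearMap := hv.1
    have h2 : e (Submodule.projectionOnto _ p hp v) = 0 := hv.2
    rw [e.map_eq_zero_iff, Submodule.projectionOnto_apply_eq_zero_iff] at h2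
    exact (Submodule.disjoint_def.1 hp.disjoint) v h1 h2
  refine ⟨hinj, ?_⟩
  have := LinearMap.injective_iff_surjective_of_finrank_eq_finrank
    (f := (A.prod L.toContinuousLinearMap).toLinearMap) (by simp; omega)
  exact this.1 hinj

variable [FiniteDimensional ℝ E] [I.Boundaryless] [IsManifold I ∞ M]

/-- Regular level sets have local parametrizations. -/
theorem exists_localParam_of_levelSet {S : Set M} {k : ℕ} {x : M} {W : Type*}
    [NormedAddCommGroup W] [NormedSpace ℝ W] [FiniteDimensional ℝ W] {U : Set M} {h : M → W}
    (hk : Module.finrank ℝ W + k = Module.finrank ℝ E) (hU : IsOpen U) (hxU : x ∈ U)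
    (hh : ContMDiffOn I 𝓘(ℝ, W) ∞ h U) (hsurj : Function.Surjective (mfderiv I 𝓘(ℝ, W) h x))
    (hS : S ∩ U = {y ∈ U | h y = 0}) (hx : x ∈ S) :
    ∃ p : LocalParam I S k, x ∈ p.U ∧ p.U ⊆ U := by
  have hLam := isInvertible_mfderiv_extChartAt (I := I) (mem_extChartAt_source (I := I) x)
  obtain ⟨Lam, hLam⟩ := hLam
  obtain ⟨L, hL⟩ := exists_clm_prod_bijective (V := E) (W := W)
    (mfderiv I 𝓘(ℝ, W) h x) hsurj (k := k) hk
  let Lam' : E ≃L[ℝ] E := Lam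
  -- Composing with the inverse of the differential of the chart gives `u` the differential `L`
  -- itself at `x`.
  let q : E →L[ℝ] EuclideanSpace ℝ (Fin k) := L ∘L (Lam'.symm : E →L[ℝ] E)
  let u : M → EuclideanSpace ℝ (Fin k) := fun y => q (extChartAt I x y)
  let U' := U ∩ (extChartAt I x).source
  have hU'o : IsOpen U' := hU.inter (isOpen_extChartAt_source x)
  have hxU' : x ∈ U' := ⟨hxU, mem_extChartAt_source x⟩
  have hu : ContMDiffOn I 𝓘(ℝ, EuclideanSpace ℝ (Fin k)) ∞ u U' := by
    refine q.contMDiff.comp_contMDiffOn ?_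
    refine (contMDiffOn_extChartAt (I := I) (x := x)).mono ?_
    rw [← extChartAt_source I]
    exact inter_subset_right
  let Φ : M → W × EuclideanSpace ℝ (Fin k) := fun y => (h y, u y)
  have hΦ : ContMDiffOn I 𝓘(ℝ, W × EuclideanSpace ℝ (Fin k)) ∞ Φ U' :=
    (hh.mono inter_subset_left).prodMk_space hu
  have hdh : HasMFDerivAt I 𝓘(ℝ, W) h x (mfderiv I 𝓘(ℝ, W) h x) :=
    (((hh x hxU).contMDiffAt (hU.mem_nhds hxU)).mdifferentiableAt (by simp)).hasMFDerivAt
  have hdu : HasMFDerivAt I 𝓘(ℝ, EuclideanSpace ℝ (Fin k)) u x L := by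
    have h1 : HasMFDerivAt I 𝓘(ℝ, E) (extChartAt I x) x (mfderiv I 𝓘(ℝ, E) (extChartAt I x) x) :=
      (mdifferentiableAt_extChartAt (mem_chart_source H x)).hasMFDerivAt
    have h2 := q.hasMFDerivAt (x := extChartAt I x x)
    have h3 := h2.comp x h1
    have h4 : q ∘L (mfderiv I 𝓘(ℝ, E) (extChartAt I x) x : E →L[ℝ] E) = L := by
      rw [← hLam]
      ext1 v
      exact congrArg L (Lam'.symm_apply_apply v)
    exact h4 ▸ h3
  have hbij : Function.Bijective (mfderiv I 𝓘(ℝ, W × EuclideanSpace ℝ (Fin k)) Φ x) := by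
    have := HasMFDerivAt.prodMk_vectorSpace hdh hdu
    rw [this.mfderiv]
    exact hL
  -- In the coordinates `Φ = (h, u)` the set `S` is the slice `h = 0`. So `b ↦ Ψ (0, b)`
  -- parametrizes it, and `u` is the coordinate.
  obtain ⟨Ψ, O, B, hO, hB, hxO, hOU, hΦO, hΨB, hl, hr, hΨ⟩ :=
    hΦ.exists_local_inverse hU'o hxU' hbij
  have huO : ContinuousOn u O := (hu.mono hOU).continuousOn
  have hB0 : IsOpen {b : EuclideanSpace ℝ (Fin k) | ((0 : W), b) ∈ B} :=
    hB.preimage (by fun_prop)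
  have h0 : ∀ y ∈ O, y ∈ S → h y = 0 := fun y hy hyS => by
    have : y ∈ S ∩ U := ⟨hyS, (hOU hy).1⟩
    rw [hS] at this
    exact this.2
  refine ⟨⟨O ∩ u ⁻¹' {b | ((0 : W), b) ∈ B}, {b | ((0 : W), b) ∈ B}, u, fun b => Ψ (0, b),
    huO.isOpen_inter_preimage hO hB0, hB0, hu.mono fun y hy => hOU hy.1, ?_, fun y hy => hy.2,
    ?_, ?_, ?_, ?_⟩, ⟨hxO, ?_⟩, fun y hy => (hOU hy.1).1⟩
  · refine hΨ.comp (t := B) (f := fun b : EuclideanSpace ℝ (Fin k) => ((0 : W), b)) ?_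
      fun b hb => hb
    exact (contDiff_const.prodMk contDiff_id).contMDiff.contMDiffOn
  · intro b hb
    have h1 := hΨB hb
    have h2 : h (Ψ (0, b)) = 0 := congrArg Prod.fst (hr _ hb)
    have : Ψ (0, b) ∈ S ∩ U := by
      rw [hS]
      exact ⟨(hOU h1).1, h2⟩
    exact this.1
  · intro b hb
    refine ⟨hΨB hb, ?_⟩
    have h2 : u (Ψ (0, b)) = b := congrArg Prod.snd (hr _ hb)
    simpa [h2] using hb
  · intro b hb
    exact congrArg Prod.snd (hr _ hb)
  · rintro y hyS ⟨hyO, hy⟩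
    have := hl y hyO
    have h1 := h0 y hyO hyS
    simpa [Φ, h1] using this
  · have h1 := hΦO hxO
    have h2 := h0 x hxO hx
    simpa [Φ, h2] using h1

theorem IsSubmanifold.exists_localParam {S : Set M} {k : ℕ} (hS : IsSubmanifold I k S) {x : M}
    (hx : x ∈ S) : ∃ p : LocalParam I S k, x ∈ p.U := by
  obtain ⟨c, U, h, hc, hU, hxU, hh, hs, he⟩ := hS x hx
  obtain ⟨p, hp, -⟩ := exists_localParam_of_levelSet (k := k) (by simpa using hc) hU hxU hh hs he hx
  exact ⟨p, hp⟩

end Params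

/-! ### Tangent spaces of subsets and differentials within them -/

section Tangent

variable {E E' : Type} [NormedAddCommGroup E] [NormedSpace ℝ E]
  [NormedAddCommGroup E'] [NormedSpace ℝ E']
  {H H' : Type} [TopologicalSpace H] [TopologicalSpace H']
  {I : ModelWithCorners ℝ E H} {I' : ModelWithCorners ℝ E' H'}
  {M M' : Type u} [TopologicalSpace M] [ChartedSpace H M]
  [TopologicalSpace M'] [ChartedSpace H' M']

theorem HasMFDerivWithinAt.hasMFDerivAt_comp_curve {N : Type*} [TopologicalSpace N]
    {F : Type*} [NormedAddCommGroup F] [NormedSpace ℝ F] {K : Type*} [TopologicalSpace K]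
    {J : ModelWithCorners ℝ F K} [ChartedSpace K N] {S : Set M} {x : M} {f : M → N}
    {A : E →L[ℝ] F} (hA : HasMFDerivWithinAt I J f S x A) {γ : ℝ → M} (h0 : γ 0 = x)
    (hγ : ∀ᶠ t in 𝓝 0, γ t ∈ S) (hd : MDifferentiableAt 𝓘(ℝ, ℝ) I γ 0) :
    HasMFDerivAt 𝓘(ℝ, ℝ) J (f ∘ γ) 0 (A ∘L (mfderiv 𝓘(ℝ, ℝ) I γ 0 : ℝ →L[ℝ] E)) := by
  subst h0
  have h1 := HasMFDerivWithinAt.comp (0 : ℝ) hA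
    (hd.hasMFDerivAt.hasMFDerivWithinAt (s := γ ⁻¹' S)) subset_rfl
  exact h1.hasMFDerivAt hγ

/-- The derivative within `S` is determined on the tangent vectors of `S`. -/
theorem HasMFDerivWithinAt.eq_on_tangentSpaceOf {N : Type*} [TopologicalSpace N]
    {F : Type*} [NormedAddCommGroup F] [NormedSpace ℝ F] {K : Type*} [TopologicalSpace K]
    {J : ModelWithCorners ℝ F K} [ChartedSpace K N] {S : Set M} {x : M} {f : M → N}
    {A A' : E →L[ℝ] F} (hA : HasMFDerivWithinAt I J f S x A)
    (hA' : HasMFDerivWithinAt I J f S x A') {v : TangentSpace I x}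
    (hv : v ∈ tangentSpaceOf I S x) : A v = A' v := by
  induction hv using Submodule.span_induction with
  | mem v hv =>
    obtain ⟨γ, h0, hγ, hd, rfl⟩ := hv
    have h1 := hA.hasMFDerivAt_comp_curve h0 hγ hd
    have h2 := hA'.hasMFDerivAt_comp_curve h0 hγ hd
    have := hasMFDerivAt_unique h1 h2
    exact DFunLike.congr_fun this (1 : ℝ)
  | zero => exact (A.map_zero).trans A'.map_zero.symm
  | add v w _ _ hv hw =>
    exact (A.map_add v w).trans ((congrArg₂ (· + ·) hv hw).trans (A'.map_add v w).symm)
  | smul c v _ hv =>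
    exact (A.map_smul c v).trans ((congrArg (c • ·) hv).trans (A'.map_smul c v).symm)

theorem HasMFDerivWithinAt.mem_tangentSpaceOf {S : Set M} {S' : Set M'} {x : M} {f : M → M'}
    {A : E →L[ℝ] E'} (hA : HasMFDerivWithinAt I I' f S x A)
    (hf : ∀ᶠ y in 𝓝 x, y ∈ S → f y ∈ S') {v : TangentSpace I x}
    (hv : v ∈ tangentSpaceOf I S x) :
    (A v : TangentSpace I' (f x)) ∈ tangentSpaceOf I' S' (f x) := by
  induction hv using Submodule.span_induction with
  | mem v hv =>
    obtain ⟨γ, h0, hγ, hd, rfl⟩ := hv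
    have h1 := hA.hasMFDerivAt_comp_curve h0 hγ hd
    refine Submodule.subset_span ⟨f ∘ γ, congrArg f h0, ?_, h1.mdifferentiableAt, ?_⟩
    · have h2 : ∀ᶠ t in 𝓝 0, γ t ∈ S → f (γ t) ∈ S' :=
        (show Filter.Tendsto γ (𝓝 0) (𝓝 x) from h0 ▸ hd.continuousAt).eventually hf
      filter_upwards [hγ, h2] with t ht ht'
      exact ht' ht
    · rw [h1.mfderiv]
      rfl
  | zero => 
    have : A (0 : E) = 0 := A.map_zero
    exact this ▸ Submodule.zero_mem (tangentSpaceOf I' S' (f x))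
  | add v w _ _ hv hw =>
    have h := Submodule.add_mem _ hv hw
    have h' : A (v + w : E) = (A v + A w : E') := A.map_add v w
    exact h' ▸ h
  | smul c v _ hv =>
    have h := Submodule.smul_mem _ c hv
    have h' : A (c • v : E) = (c • A v : E') := A.map_smul c v
    exact h' ▸ h

theorem tangentSpaceOf_mono {S S' : Set M} (h : S ⊆ S') (x : M) :
    tangentSpaceOf I S x ≤ tangentSpaceOf I S' x := by
  refine Submodule.span_mono ?_
  rintro v ⟨γ, h0, hγ, hd, hv⟩
  exact ⟨γ, h0, hγ.mono fun t ht => h ht, hd, hv⟩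

/-- Near `x` the map agrees on `S` with a constant, so zero is another derivative within `S`, and
two such derivatives agree on the tangent space. -/
theorem HasMFDerivAt.eq_zero_of_mem_tangentSpaceOf {N : Type*} [TopologicalSpace N]
    {F : Type*} [NormedAddCommGroup F] [NormedSpace ℝ F] {K : Type*} [TopologicalSpace K]
    {J : ModelWithCorners ℝ F K} [ChartedSpace K N] {S : Set M} {x : M} {f : M → N}
    {A : E →L[ℝ] F} (hA : HasMFDerivAt I J f x A)
    (hf : ∀ᶠ y in 𝓝 x, y ∈ S → f y = f x) {v : TangentSpace I x}
    (hv : v ∈ tangentSpaceOf I S x) : A v = 0 := by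
  have h0 : HasMFDerivWithinAt I J f S x (0 : E →L[ℝ] F) := by
    refine HasMFDerivWithinAt.congr_of_eventuallyEq (hasMFDerivWithinAt_const (f x) S x) ?_ rfl
    exact eventually_nhdsWithin_iff.2 hf
  exact (hA.hasMFDerivWithinAt (s := S)).eq_on_tangentSpaceOf h0 hv

end Tangent

/-! ### Tangent spaces in a local parametrization -/

namespace LocalParam

variable {E : Type} [NormedAddCommGroup E] [NormedSpace ℝ E]
  {H : Type} [TopologicalSpace H] {I : ModelWithCorners ℝ E H}
  {M : Type u} [TopologicalSpace M] [ChartedSpace H M] {S : Set M} {k : ℕ}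
  (p : LocalParam I S k)

theorem exists_eq_param {y : M} (hy : y ∈ S) (hyU : y ∈ p.U) : ∃ b ∈ p.B, p.param b = y :=
  ⟨p.coord y, p.coord_mem y hyU, p.param_coord y hy hyU⟩

theorem hasMFDerivAt_param {b : EuclideanSpace ℝ (Fin k)} (hb : b ∈ p.B) :
    HasMFDerivAt 𝓘(ℝ, EuclideanSpace ℝ (Fin k)) I p.param b
      (mfderiv 𝓘(ℝ, EuclideanSpace ℝ (Fin k)) I p.param b) :=
  (((p.smooth_param b hb).contMDiffAt (p.isOpen_B.mem_nhds hb)).mdifferentiableAt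
    (by simp)).hasMFDerivAt

theorem hasMFDerivAt_coord {y : M} (hy : y ∈ p.U) :
    HasMFDerivAt I 𝓘(ℝ, EuclideanSpace ℝ (Fin k)) p.coord y
      (mfderiv I 𝓘(ℝ, EuclideanSpace ℝ (Fin k)) p.coord y) :=
  (((p.smooth_coord y hy).contMDiffAt (p.isOpen_U.mem_nhds hy)).mdifferentiableAt
    (by simp)).hasMFDerivAt

theorem mfderiv_coord_mfderiv_param {b : EuclideanSpace ℝ (Fin k)} (hb : b ∈ p.B)
    (w : EuclideanSpace ℝ (Fin k)) :
    mfderiv I 𝓘(ℝ, EuclideanSpace ℝ (Fin k)) p.coord (p.param b)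
      (mfderiv 𝓘(ℝ, EuclideanSpace ℝ (Fin k)) I p.param b w) = w := by
  have h1 := (p.hasMFDerivAt_coord (p.param_mem_U b hb)).comp b (p.hasMFDerivAt_param hb)
  have h2 : HasMFDerivAt 𝓘(ℝ, EuclideanSpace ℝ (Fin k)) 𝓘(ℝ, EuclideanSpace ℝ (Fin k))
      (p.coord ∘ p.param) b (ContinuousLinearMap.id ℝ (EuclideanSpace ℝ (Fin k))) := by
    refine (hasMFDerivAt_id b).congr_of_eventuallyEq ?_
    filter_upwards [p.isOpen_B.mem_nhds hb] with c hc
    exact p.coord_param c hc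
  exact DFunLike.congr_fun (hasMFDerivAt_unique h1 h2) w

theorem mfderiv_param_mem {b : EuclideanSpace ℝ (Fin k)} (hb : b ∈ p.B)
    (w : EuclideanSpace ℝ (Fin k)) :
    mfderiv 𝓘(ℝ, EuclideanSpace ℝ (Fin k)) I p.param b w ∈ tangentSpaceOf I S (p.param b) := by
  let γ : ℝ → EuclideanSpace ℝ (Fin k) := fun t => b + t • w
  have hγ0 : γ 0 = b := by simp [γ]
  have hγ : HasMFDerivAt 𝓘(ℝ, ℝ) 𝓘(ℝ, EuclideanSpace ℝ (Fin k)) γ 0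
      (ContinuousLinearMap.toSpanSingleton ℝ w) := by
    have : HasDerivAt γ w 0 := by
      have h := ((hasDerivAt_id (0 : ℝ)).smul_const w).const_add b
      rw [one_smul] at h
      exact h
    exact this.hasFDerivAt.hasMFDerivAt
  have hp : HasMFDerivAt 𝓘(ℝ, EuclideanSpace ℝ (Fin k)) I p.param (γ 0)
      (mfderiv 𝓘(ℝ, EuclideanSpace ℝ (Fin k)) I p.param b) := by
    rw [hγ0]
    exact p.hasMFDerivAt_param hb
  have h1 := hp.comp (0 : ℝ) hγ
  refine Submodule.subset_span ⟨p.param ∘ γ, by simp [hγ0], ?_, h1.mdifferentiableAt, ?_⟩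
  · have : ∀ᶠ t in 𝓝 (0 : ℝ), γ t ∈ p.B :=
      hγ.continuousAt.eventually (by rw [hγ0]; exact p.isOpen_B.mem_nhds hb)
    filter_upwards [this] with t ht
    exact p.param_mem _ ht
  · rw [h1.mfderiv]
    change mfderiv 𝓘(ℝ, EuclideanSpace ℝ (Fin k)) I p.param b ((1 : ℝ) • w) = _
    rw [one_smul]

/-- `param ∘ coord` is the identity on `S` only, so its differential is known on the tangent space
of `S` only; this is why `v` has to be tangent. -/
theorem mfderiv_param_mfderiv_coord {b : EuclideanSpace ℝ (Fin k)} (hb : b ∈ p.B)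
    {v : TangentSpace I (p.param b)} (hv : v ∈ tangentSpaceOf I S (p.param b)) :
    mfderiv 𝓘(ℝ, EuclideanSpace ℝ (Fin k)) I p.param b
      (mfderiv I 𝓘(ℝ, EuclideanSpace ℝ (Fin k)) p.coord (p.param b) v) = v := by
  have hU := p.param_mem_U b hb
  have hp : HasMFDerivAt 𝓘(ℝ, EuclideanSpace ℝ (Fin k)) I p.param (p.coord (p.param b))
      (mfderiv 𝓘(ℝ, EuclideanSpace ℝ (Fin k)) I p.param b) := by
    rw [p.coord_param b hb]
    exact p.hasMFDerivAt_param hb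
  have h1 := (hp.comp (p.param b) (p.hasMFDerivAt_coord hU)).hasMFDerivWithinAt (s := S)
  have h2 : HasMFDerivWithinAt I I (p.param ∘ p.coord) S (p.param b)
      (ContinuousLinearMap.id ℝ E) := by
    refine ((hasMFDerivAt_id (p.param b)).hasMFDerivWithinAt (s := S)).congr_of_eventuallyEq ?_ ?_
    · rw [Filter.EventuallyEq, eventually_nhdsWithin_iff]
      filter_upwards [p.isOpen_U.mem_nhds hU] with y hy hyS
      exact p.param_coord y hyS hy
    · exact p.param_coord _ (p.param_mem b hb) hU
  exact h1.eq_on_tangentSpaceOf h2 hv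

/-- The tangent space of `S`, parametrized by the differential of the parametrization. -/
def tangentEquiv {b : EuclideanSpace ℝ (Fin k)} (hb : b ∈ p.B) :
    EuclideanSpace ℝ (Fin k) ≃ₗ[ℝ] tangentSpaceOf I S (p.param b) where
  toFun w := ⟨mfderiv 𝓘(ℝ, EuclideanSpace ℝ (Fin k)) I p.param b w, p.mfderiv_param_mem hb w⟩
  map_add' v w := Subtype.ext (map_add _ v w)
  map_smul' c w := Subtype.ext (map_smul _ c w)
  invFun v := mfderiv I 𝓘(ℝ, EuclideanSpace ℝ (Fin k)) p.coord (p.param b) v.1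
  left_inv w := p.mfderiv_coord_mfderiv_param hb w
  right_inv v := Subtype.ext (p.mfderiv_param_mfderiv_coord hb v.2)

theorem finrank_tangentSpaceOf {y : M} (hy : y ∈ S) (hyU : y ∈ p.U) :
    Module.finrank ℝ (tangentSpaceOf I S y) = k := by
  obtain ⟨b, hb, rfl⟩ := p.exists_eq_param hy hyU
  rw [← (p.tangentEquiv hb).finrank_eq]
  simp

variable {E' : Type*} [NormedAddCommGroup E'] [NormedSpace ℝ E']
  {H' : Type*} [TopologicalSpace H'] {I' : ModelWithCorners ℝ E' H'}
  {M' : Type*} [TopologicalSpace M'] [ChartedSpace H' M']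

theorem hasMFDerivAt_comp_param {f : M → M'} {b : EuclideanSpace ℝ (Fin k)} (hb : b ∈ p.B)
    {A : E →L[ℝ] E'} (hf : HasMFDerivWithinAt I I' f S (p.param b) A) :
    HasMFDerivAt 𝓘(ℝ, EuclideanSpace ℝ (Fin k)) I' (f ∘ p.param) b
      (A ∘L (mfderiv 𝓘(ℝ, EuclideanSpace ℝ (Fin k)) I p.param b :
        EuclideanSpace ℝ (Fin k) →L[ℝ] E)) := by
  have h1 := HasMFDerivWithinAt.comp b hf
    ((p.hasMFDerivAt_param hb).hasMFDerivWithinAt (s := p.B)) p.param_mem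
  exact h1.hasMFDerivAt (p.isOpen_B.mem_nhds hb)

theorem mfderivWithin_mfderiv_param {f : M → M'} {b : EuclideanSpace ℝ (Fin k)} (hb : b ∈ p.B)
    (hf : MDifferentiableWithinAt I I' f S (p.param b)) (w : EuclideanSpace ℝ (Fin k)) :
    mfderivWithin I I' f S (p.param b) (mfderiv 𝓘(ℝ, EuclideanSpace ℝ (Fin k)) I p.param b w) =
      mfderiv 𝓘(ℝ, EuclideanSpace ℝ (Fin k)) I' (f ∘ p.param) b w := by
  rw [(p.hasMFDerivAt_comp_param hb hf.hasMFDerivWithinAt).mfderiv]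
  rfl

/-- A smooth family of functions on `S`, in the parametrization. -/
theorem contMDiffOn_family {T : Set ℝ} {F : ℝ → M → M'}
    (hF : ContMDiffOn (𝓘(ℝ, ℝ).prod I) I' ∞ (fun q : ℝ × M => F q.1 q.2) (T ×ˢ S)) :
    ContMDiffOn (𝓘(ℝ, ℝ).prod 𝓘(ℝ, EuclideanSpace ℝ (Fin k))) I' ∞
      (fun q : ℝ × EuclideanSpace ℝ (Fin k) => F q.1 (p.param q.2)) (T ×ˢ p.B) := by
  refine hF.comp (f := fun q : ℝ × EuclideanSpace ℝ (Fin k) => (q.1, p.param q.2)) ?_ ?_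
  · exact contMDiffOn_fst.prodMk (p.smooth_param.comp contMDiffOn_snd fun q hq => hq.2)
  · exact fun q hq => ⟨hq.1, p.param_mem _ hq.2⟩

end LocalParam

/-! ### Tangent spaces of level sets as kernels -/

section SubmanifoldLemmas

variable {E : Type} [NormedAddCommGroup E] [NormedSpace ℝ E] [FiniteDimensional ℝ E]
  {H : Type} [TopologicalSpace H] {I : ModelWithCorners ℝ E H} [I.Boundaryless]
  {M : Type u} [TopologicalSpace M] [ChartedSpace H M] [IsManifold I ∞ M]

theorem IsSubmanifold.finrank_tangentSpaceOf {S : Set M} {k : ℕ} (hS : IsSubmanifold I k S) {x : M}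
    (hx : x ∈ S) : Module.finrank ℝ (tangentSpaceOf I S x) = k := by
  obtain ⟨p, hp⟩ := hS.exists_localParam hx
  exact p.finrank_tangentSpaceOf hx hp

-- The level functions of conormal bundles take values in products and dual spaces; a linear
-- isomorphism to a Euclidean space brings them to the form that `IsSubmanifold` asks for.
set_option linter.unusedSectionVars false in
theorem isSubmanifold_of_levelSet {S : Set M} {k : ℕ} {x : M} {W : Type*}
    [NormedAddCommGroup W] [NormedSpace ℝ W] [FiniteDimensional ℝ W] {U : Set M} {h : M → W}
    (hk : Module.finrank ℝ W + k = Module.finrank ℝ E) (hU : IsOpen U) (hxU : x ∈ U)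
    (hh : ContMDiffOn I 𝓘(ℝ, W) ∞ h U) (hsurj : Function.Surjective (mfderiv I 𝓘(ℝ, W) h x))
    (hS : S ∩ U = {y ∈ U | h y = 0}) :
    ∃ (c : ℕ) (U : Set M) (h : M → EuclideanSpace ℝ (Fin c)),
      c + k = Module.finrank ℝ E ∧ IsOpen U ∧ x ∈ U ∧
      ContMDiffOn I 𝓘(ℝ, EuclideanSpace ℝ (Fin c)) ∞ h U ∧
      Function.Surjective (mfderiv I 𝓘(ℝ, EuclideanSpace ℝ (Fin c)) h x) ∧
      S ∩ U = {y ∈ U | h y = 0} := by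
  let e : W ≃L[ℝ] EuclideanSpace ℝ (Fin (Module.finrank ℝ W)) :=
    ContinuousLinearEquiv.ofFinrankEq (by simp)
  refine ⟨_, U, e ∘ h, hk, hU, hxU, e.contDiff.contMDiff.comp_contMDiffOn hh, ?_, ?_⟩
  · have hdh : HasMFDerivAt I 𝓘(ℝ, W) h x (mfderiv I 𝓘(ℝ, W) h x) :=
      (((hh x hxU).contMDiffAt (hU.mem_nhds hxU)).mdifferentiableAt (by simp)).hasMFDerivAt
    have := (e.toContinuousLinearMap.hasMFDerivAt (x := h x)).comp x hdh
    rw [show mfderiv I _ (e ∘ h) x = _ from this.mfderiv]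
    exact e.surjective.comp hsurj
  · rw [hS]
    ext y
    simp

/-- The level function is constant on `S`, which gives one inclusion. Both spaces have dimension
`k`, one by the parametrization and the other by rank and nullity. -/
theorem tangentSpaceOf_eq_ker {S : Set M} {k : ℕ} {x : M} {W : Type*}
    [NormedAddCommGroup W] [NormedSpace ℝ W] [FiniteDimensional ℝ W] {U : Set M} {h : M → W}
    (hk : Module.finrank ℝ W + k = Module.finrank ℝ E) (hU : IsOpen U) (hxU : x ∈ U)
    (hh : ContMDiffOn I 𝓘(ℝ, W) ∞ h U) (hsurj : Function.Surjective (mfderiv I 𝓘(ℝ, W) h x))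
    (hS : S ∩ U = {y ∈ U | h y = 0}) (hx : x ∈ S) (v : TangentSpace I x) :
    v ∈ tangentSpaceOf I S x ↔ mfderiv I 𝓘(ℝ, W) h x v = 0 := by
  obtain ⟨p, hp, -⟩ := exists_localParam_of_levelSet hk hU hxU hh hsurj hS hx
  let D : E →L[ℝ] W := mfderiv I 𝓘(ℝ, W) h x
  have h0 : ∀ y ∈ S, y ∈ U → h y = 0 := fun y hy hyU => by
    have : y ∈ S ∩ U := ⟨hy, hyU⟩
    rw [hS] at this
    exact this.2
  have hdh : HasMFDerivAt I 𝓘(ℝ, W) h x D :=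
    (((hh x hxU).contMDiffAt (hU.mem_nhds hxU)).mdifferentiableAt (by simp)).hasMFDerivAt
  let TS : Submodule ℝ E := tangentSpaceOf I S x
  have hle : TS ≤ LinearMap.ker D.toLinearMap := by
    intro v hv
    refine hdh.eq_zero_of_mem_tangentSpaceOf ?_ hv
    filter_upwards [hU.mem_nhds hxU] with y hy hyS
    rw [h0 y hyS hy, h0 x hx hxU]
  have hfr : Module.finrank ℝ TS = k := p.finrank_tangentSpaceOf hx hp
  have hfk : Module.finrank ℝ (LinearMap.ker D.toLinearMap) = k := by
    have h1 := LinearMap.finrank_range_add_finrank_ker D.toLinearMap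
    rw [LinearMap.range_eq_top.2 (show Function.Surjective D.toLinearMap from hsurj),
      finrank_top] at h1
    omega
  have := Submodule.eq_of_le_of_finrank_eq hle (hfr.trans hfk.symm)
  change v ∈ TS ↔ v ∈ LinearMap.ker D.toLinearMap
  rw [this]

/-- The whole manifold is the zero set of the map to the space of dimension zero. -/
theorem tangentSpaceOf_univ (x : M) : tangentSpaceOf I (univ : Set M) x = ⊤ := by
  rw [eq_top_iff]
  intro v _
  have hs : Function.Surjective
      (mfderiv I 𝓘(ℝ, EuclideanSpace ℝ (Fin 0)) (fun _ : M => (0 : EuclideanSpace ℝ (Fin 0))) x) :=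
    fun w => ⟨0, Subsingleton.elim (α := EuclideanSpace ℝ (Fin 0)) _ _⟩
  rw [tangentSpaceOf_eq_ker (k := Module.finrank ℝ E) (by simp) isOpen_univ (mem_univ x)
    contMDiffOn_const hs (by simp) (mem_univ x)]
  exact Subsingleton.elim (α := EuclideanSpace ℝ (Fin 0)) _ _

end SubmanifoldLemmas

/-! ### Differentials of smooth families of maps -/

section Families

variable {E E' F : Type*} [NormedAddCommGroup E] [NormedSpace ℝ E]
  [NormedAddCommGroup E'] [NormedSpace ℝ E']
  {H H' : Type*} [TopologicalSpace H] [TopologicalSpace H']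
  {I : ModelWithCorners ℝ E H} {I' : ModelWithCorners ℝ E' H'}
  {M M' : Type*} [TopologicalSpace M] [ChartedSpace H M] [IsManifold I ∞ M]
  [TopologicalSpace M'] [ChartedSpace H' M'] [IsManifold I' ∞ M']

theorem mfderivWithin_family {T : Set ℝ} {B : Set M} (hB : IsOpen B)
    {G : ℝ → M → M'}
    (hG : ContMDiffOn (𝓘(ℝ, ℝ).prod I) I' ∞ (fun q : ℝ × M => G q.1 q.2) (T ×ˢ B))
    {t : ℝ} (ht : t ∈ T) {y : M} (hy : y ∈ B) (v : TangentSpace I y) :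
    mfderivWithin (𝓘(ℝ, ℝ).prod I) I' (fun q : ℝ × M => G q.1 q.2) (T ×ˢ B) (t, y)
      ((0, v) : ℝ × E) = mfderiv I I' (G t) y v := by
  have h1 : HasMFDerivWithinAt (𝓘(ℝ, ℝ).prod I) I' (fun q : ℝ × M => G q.1 q.2) (T ×ˢ B) (t, y)
      (mfderivWithin (𝓘(ℝ, ℝ).prod I) I' (fun q : ℝ × M => G q.1 q.2) (T ×ˢ B) (t, y)) :=
    ((hG (t, y) ⟨ht, hy⟩).mdifferentiableWithinAt (by simp)).hasMFDerivWithinAt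
  have h2 : HasMFDerivAt I (𝓘(ℝ, ℝ).prod I) (fun y : M => (t, y)) y
      (ContinuousLinearMap.inr ℝ ℝ E) := by
    have := (hasMFDerivAt_const (I := I) (I' := 𝓘(ℝ, ℝ)) t y).prodMk (hasMFDerivAt_id (I := I) y)
    exact this
  have h3 := HasMFDerivWithinAt.comp y h1 (h2.hasMFDerivWithinAt (s := B))
    (fun z hz => ⟨ht, hz⟩)
  have h4 := h3.hasMFDerivAt (hB.mem_nhds hy)
  have h5 : mfderiv I I' (G t) y = _ := h4.mfderiv
  rw [h5]
  rfl

/-- The differential of each `G t` is the restriction of the total differential, which is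
continuous, to vectors `(0, v)`. Unique differentiability of `T` allows for the closed interval of
times. -/
theorem continuousOn_mfderiv_family {T : Set ℝ} (hT : UniqueDiffOn ℝ T) {B : Set M}
    (hB : IsOpen B) {G : ℝ → M → M'}
    (hG : ContMDiffOn (𝓘(ℝ, ℝ).prod I) I' ∞ (fun q : ℝ × M => G q.1 q.2) (T ×ˢ B)) :
    ContinuousOn (fun q : ℝ × TangentBundle I M =>
      (⟨G q.1 q.2.proj, mfderiv I I' (G q.1) q.2.proj q.2.2⟩ : TangentBundle I' M'))
      (T ×ˢ (Bundle.TotalSpace.proj ⁻¹' B)) := by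
  have hu : UniqueMDiffOn (𝓘(ℝ, ℝ).prod I) (T ×ˢ B) :=
    (uniqueMDiffOn_iff_uniqueDiffOn.2 hT).prod hB.uniqueMDiffOn
  have h1 := hG.continuousOn_tangentMapWithin (by simp) hu
  have h2 : Continuous (fun q : ℝ × TangentBundle I M =>
      (⟨(q.1, q.2.proj), ((0, q.2.2) : ℝ × E)⟩ : TangentBundle (𝓘(ℝ, ℝ).prod I) (ℝ × M))) := by
    have h3 : Continuous (fun q : ℝ × TangentBundle I M =>
        ((⟨q.1, (0 : ℝ)⟩ : TangentBundle 𝓘(ℝ, ℝ) ℝ), q.2)) := by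
      refine Continuous.prodMk ?_ continuous_snd
      exact (Bundle.contMDiff_zeroSection (n := 0) (IB := 𝓘(ℝ, ℝ)) ℝ
        (TangentSpace 𝓘(ℝ, ℝ) : ℝ → Type)).continuous.comp continuous_fst
    exact (contMDiff_equivTangentBundleProd_symm (I := 𝓘(ℝ, ℝ)) (M := ℝ) (I' := I) (M' := M)
      (n := 0)).continuous.comp h3
  refine (h1.comp h2.continuousOn fun q hq => hq).congr ?_
  rintro ⟨t, y, v⟩ ⟨ht, hy⟩
  change (⟨_, _⟩ : TangentBundle I' M') = ⟨_, _⟩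
  congr 1
  exact (mfderivWithin_family hB hG ht hy v).symm

end Families

section TangentFamilies

variable {E E' : Type} [NormedAddCommGroup E] [NormedSpace ℝ E]
  [NormedAddCommGroup E'] [NormedSpace ℝ E'] [FiniteDimensional ℝ E]
  {H H' : Type} [TopologicalSpace H] [TopologicalSpace H']
  {I : ModelWithCorners ℝ E H} {I' : ModelWithCorners ℝ E' H'} [I.Boundaryless]
  {M M' : Type u} [TopologicalSpace M] [ChartedSpace H M] [IsManifold I ∞ M]
  [TopologicalSpace M'] [ChartedSpace H' M'] [IsManifold I' ∞ M']

theorem ContMDiffOn.mdifferentiableWithinAt_family {S : Set M} {T : Set ℝ} {F : ℝ → M → M'}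
    (hF : ContMDiffOn (𝓘(ℝ, ℝ).prod I) I' ∞ (fun q : ℝ × M => F q.1 q.2) (T ×ˢ S))
    {t : ℝ} (ht : t ∈ T) {x : M} (hx : x ∈ S) : MDifferentiableWithinAt I I' (F t) S x := by
  have h : ContMDiffOn I I' ∞ (F t) S :=
    hF.comp (f := fun y : M => (t, y)) (contMDiffOn_const.prodMk contMDiffOn_id)
      fun y hy => ⟨ht, hy⟩
  exact (h x hx).mdifferentiableWithinAt (by simp)

/-- The differentials of a smooth family of maps on a submanifold depend continuously on the
parameter and on the tangent vector. -/
theorem IsSubmanifold.continuousOn_tangentMapWithin_family {S : Set M} {k : ℕ}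
    (hS : IsSubmanifold I k S) {T : Set ℝ} (hT : UniqueDiffOn ℝ T) {F : ℝ → M → M'}
    (hF : ContMDiffOn (𝓘(ℝ, ℝ).prod I) I' ∞ (fun q : ℝ × M => F q.1 q.2) (T ×ˢ S)) :
    ContinuousOn (fun q : ℝ × TangentBundle I M => tangentMapWithin I I' (F q.1) S q.2)
      (T ×ˢ {v | v.proj ∈ S ∧ v.2 ∈ tangentSpaceOf I S v.proj}) := by
  rintro ⟨t₀, v₀⟩ ⟨ht₀, hv₀, hv₀'⟩
  obtain ⟨p, hp⟩ := hS.exists_localParam hv₀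
  -- On vectors tangent to `S`, the differential of `F t` is that of `F t ∘ param` after that of
  -- `coord`. Both are differentials on open sets, where continuity is known.
  have h1 := continuousOn_mfderiv_family hT p.isOpen_B (G := fun t b => F t (p.param b))
    (p.contMDiffOn_family hF)
  have h2 : ContinuousOn (fun q : ℝ × TangentBundle I M =>
      (q.1, (⟨p.coord q.2.proj, mfderiv I 𝓘(ℝ, EuclideanSpace ℝ (Fin k)) p.coord q.2.proj q.2.2⟩ :
        TangentBundle 𝓘(ℝ, EuclideanSpace ℝ (Fin k)) (EuclideanSpace ℝ (Fin k)))))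
      (univ ×ˢ (Bundle.TotalSpace.proj ⁻¹' p.U)) := by
    refine continuousOn_fst.prodMk ?_
    have h3 := p.smooth_coord.continuousOn_tangentMapWithin (by simp) p.isOpen_U.uniqueMDiffOn
    refine (h3.comp continuousOn_snd fun q hq => hq.2).congr ?_
    rintro ⟨t, v⟩ ⟨-, hv⟩
    change (⟨_, _⟩ : TangentBundle 𝓘(ℝ, EuclideanSpace ℝ (Fin k)) _) = ⟨_, _⟩
    congr 1
    rw [mfderivWithin_of_isOpen p.isOpen_U hv]
  have h4 : ContinuousOn _ ((T ×ˢ {v : TangentBundle I M | v.proj ∈ S ∧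
      v.2 ∈ tangentSpaceOf I S v.proj}) ∩ (univ ×ˢ (Bundle.TotalSpace.proj ⁻¹' p.U))) :=
    h1.comp (h2.mono inter_subset_right) fun q hq => ⟨hq.1.1, p.coord_mem _ hq.2.2⟩
  have hn : (univ ×ˢ (Bundle.TotalSpace.proj ⁻¹' p.U) : Set (ℝ × TangentBundle I M)) ∈
      𝓝 (t₀, v₀) := by
    refine (isOpen_univ.prod (p.isOpen_U.preimage ?_)).mem_nhds ⟨mem_univ _, hp⟩
    exact FiberBundle.continuous_proj E (TangentSpace I)
  have h5 := (h4 (t₀, v₀) ⟨⟨ht₀, hv₀, hv₀'⟩, mem_univ _, hp⟩)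
  rw [continuousWithinAt_inter hn] at h5
  refine h5.congr_of_eventuallyEq_of_mem ?_ ⟨ht₀, hv₀, hv₀'⟩
  rw [Filter.EventuallyEq, eventually_nhdsWithin_iff]
  filter_upwards [hn]
  rintro ⟨t, y, v⟩ ⟨-, hy⟩ ⟨ht, hyS, hv⟩
  obtain ⟨b, hb, rfl⟩ := p.exists_eq_param hyS hy
  have h6 := p.mfderivWithin_mfderiv_param hb (hF.mdifferentiableWithinAt_family ht hyS)
    (mfderiv I 𝓘(ℝ, EuclideanSpace ℝ (Fin k)) p.coord (p.param b) v)
  rw [p.mfderiv_param_mfderiv_coord hb hv] at h6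
  have h7 := p.coord_param b hb
  simp only [Function.comp]
  rw [h7]
  change (⟨_, _⟩ : TangentBundle I' M') = ⟨_, _⟩
  congr 1

end TangentFamilies

/-! ### Images of submanifolds under embeddings -/

section ImageOfEmbedding

variable {E E' : Type} [NormedAddCommGroup E] [NormedSpace ℝ E]
  [NormedAddCommGroup E'] [NormedSpace ℝ E'] [FiniteDimensional ℝ E] [FiniteDimensional ℝ E']
  {H H' : Type} [TopologicalSpace H] [TopologicalSpace H']
  {I : ModelWithCorners ℝ E H} {I' : ModelWithCorners ℝ E' H'} [I.Boundaryless] [I'.Boundaryless]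
  {M M' : Type u} [TopologicalSpace M] [ChartedSpace H M] [IsManifold I ∞ M]
  [TopologicalSpace M'] [ChartedSpace H' M'] [IsManifold I' ∞ M']

/-- `L` parametrizes a complement of the range of `A`. It supplies the directions in which an
immersion is thickened to a local diffeomorphism. -/
theorem exists_clm_coprod_bijective {V W : Type*} [NormedAddCommGroup V] [NormedSpace ℝ V]
    [FiniteDimensional ℝ V] [NormedAddCommGroup W] [NormedSpace ℝ W] [FiniteDimensional ℝ W]
    (A : V →L[ℝ] W) (hA : Function.Injective A) :
    ∃ (c : ℕ) (L : EuclideanSpace ℝ (Fin c) →L[ℝ] W),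
      c + Module.finrank ℝ V = Module.finrank ℝ W ∧ Function.Bijective (A.coprod L) := by
  obtain ⟨q, hq⟩ := (LinearMap.range A.toLinearMap).exists_isCompl
  have hr : Module.finrank ℝ (LinearMap.range A.toLinearMap) = Module.finrank ℝ V :=
    LinearMap.finrank_range_of_inj hA
  have hadd := Submodule.finrank_add_eq_of_isCompl hq
  let e : EuclideanSpace ℝ (Fin (Module.finrank ℝ q)) ≃ₗ[ℝ] q :=
    LinearEquiv.ofFinrankEq _ _ (by simp)
  let L : EuclideanSpace ℝ (Fin (Module.finrank ℝ q)) →ₗ[ℝ] W := q.subtype ∘ₗ e.toLinearMap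
  refine ⟨_, L.toContinuousLinearMap, by omega, ?_⟩
  have hinj : Function.Injective (A.coprod L.toContinuousLinearMap) := by
    rw [injective_iff_map_eq_zero]
    rintro ⟨v, w⟩ hv
    have hv' : A v + (e w : W) = 0 := hv
    have h1 : A v ∈ q := by
      rw [eq_neg_of_add_eq_zero_left hv']
      exact q.neg_mem (e w).2
    have h2 : A v = 0 := Submodule.disjoint_def.1 hq.disjoint _ ⟨v, rfl⟩ h1
    rw [h2, zero_add] at hv'
    have h3 : v = 0 := hA (h2.trans A.map_zero.symm)
    have h4 : w = 0 := by simpa using hv'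
    rw [h3, h4]
    rfl
  refine ⟨hinj, ?_⟩
  have := LinearMap.injective_iff_surjective_of_finrank_eq_finrank
    (f := (A.coprod L.toContinuousLinearMap).toLinearMap) (by simp; omega)
  exact this.1 hinj

/-- Near a point of the image of an embedded submanifold by an embedding, the image is a regular
level set, and the embedding has a smooth left inverse. -/
theorem IsSubmanifold.exists_levelSet_image {S : Set M} {k : ℕ} (hS : IsSubmanifold I k S)
    {f : M → M'} (hf : ContMDiffOn I I' ∞ f S) (he : IsEmbedding (S.domRestrict f)) {x : M}
    (hx : x ∈ S) (hi : InjOn (mfderivWithin I I' f S x) (tangentSpaceOf I S x)) :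
    ∃ (c : ℕ) (O : Set M') (h : M' → EuclideanSpace ℝ (Fin c)) (l : M' → M),
      c + k = Module.finrank ℝ E' ∧ IsOpen O ∧ f x ∈ O ∧
      ContMDiffOn I' 𝓘(ℝ, EuclideanSpace ℝ (Fin c)) ∞ h O ∧
      Function.Surjective (mfderiv I' 𝓘(ℝ, EuclideanSpace ℝ (Fin c)) h (f x)) ∧
      f '' S ∩ O = {y ∈ O | h y = 0} ∧ ContMDiffOn I' I ∞ l O ∧ (∀ y ∈ O, l y ∈ S) ∧
      ∀ y ∈ S, f y ∈ O → l (f y) = y := by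
  obtain ⟨p, hp⟩ := hS.exists_localParam hx
  obtain ⟨b₀, hb₀, rfl⟩ := p.exists_eq_param hx hp
  set x := p.param b₀ with hxdef
  set φ := extChartAt I' (f x) with hφ
  have hfp : ContMDiffOn 𝓘(ℝ, EuclideanSpace ℝ (Fin k)) I' ∞ (f ∘ p.param) p.B :=
    hf.comp p.smooth_param p.param_mem
  let B₁ : Set (EuclideanSpace ℝ (Fin k)) := p.B ∩ (f ∘ p.param) ⁻¹' φ.source
  have hB₁ : IsOpen B₁ :=
    hfp.continuousOn.isOpen_inter_preimage p.isOpen_B (isOpen_extChartAt_source _)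
  have hb₀₁ : b₀ ∈ B₁ := ⟨hb₀, mem_extChartAt_source (I := I') (f x)⟩
  let g : EuclideanSpace ℝ (Fin k) → E' := φ ∘ f ∘ p.param
  have hg : ContMDiffOn 𝓘(ℝ, EuclideanSpace ℝ (Fin k)) 𝓘(ℝ, E') ∞ g B₁ := by
    refine (contMDiffOn_extChartAt (I := I') (x := f x)).comp (hfp.mono inter_subset_left) ?_
    intro b hb
    rw [← extChartAt_source I']
    exact hb.2
  let D : EuclideanSpace ℝ (Fin k) →L[ℝ] E' := fderiv ℝ g b₀
  have hgd : ContDiffOn ℝ ∞ g B₁ := contMDiffOn_iff_contDiffOn.1 hg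
  have hgD : HasFDerivAt g D b₀ :=
    ((hgd.contDiffAt (hB₁.mem_nhds hb₀₁)).differentiableAt (by simp)).hasFDerivAt
  have hfd : MDifferentiableWithinAt I I' f S x := (hf x hx).mdifferentiableWithinAt (by simp)
  have hDinj : Function.Injective D := by
    have h1 := p.hasMFDerivAt_comp_param hb₀ hfd.hasMFDerivWithinAt
    have h2 : HasMFDerivAt I' 𝓘(ℝ, E') φ (f x) (mfderiv I' 𝓘(ℝ, E') φ (f x)) :=
      (mdifferentiableAt_extChartAt (mem_chart_source H' (f x))).hasMFDerivAt
    have h3 := h2.comp b₀ h1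
    have h4 : D = _ := hgD.hasMFDerivAt.mfderiv.symm.trans h3.mfderiv
    obtain ⟨Lam, hLam⟩ :=
      isInvertible_mfderiv_extChartAt (I := I') (mem_extChartAt_source (I := I') (f x))
    intro w w' hw
    rw [h4, ← hLam] at hw
    have h5 := Lam.injective hw
    have h6 := hi (p.mfderiv_param_mem hb₀ w) (p.mfderiv_param_mem hb₀ w') h5
    have h7 := p.mfderiv_coord_mfderiv_param hb₀ w
    rw [h6, p.mfderiv_coord_mfderiv_param hb₀ w'] at h7
    exact h7.symm
  obtain ⟨c, j, hc, hbij⟩ := exists_clm_coprod_bijective D hDinj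
  -- `X` thickens the embedded piece in transverse directions. The second component of its local
  -- inverse will be the level function.
  let X : EuclideanSpace ℝ (Fin k) × EuclideanSpace ℝ (Fin c) → E' := fun q => g q.1 + j q.2
  have hX : ContDiffOn ℝ ∞ X (B₁ ×ˢ univ) :=
    (hgd.comp contDiffOn_fst fun q hq => hq.1).add (j.contDiff.comp contDiff_snd).contDiffOn
  have hXd : HasFDerivAt X (D.coprod j) (b₀, (0 : EuclideanSpace ℝ (Fin c))) := by
    have h1 := (show HasFDerivAt g D (b₀, (0 : EuclideanSpace ℝ (Fin c))).1 from hgD).comp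
      (b₀, (0 : EuclideanSpace ℝ (Fin c))) hasFDerivAt_fst
    have h2 := (show HasFDerivAt j j (b₀, (0 : EuclideanSpace ℝ (Fin c))).2 from
      j.hasFDerivAt).comp
      (b₀, (0 : EuclideanSpace ℝ (Fin c))) hasFDerivAt_snd
    have h3 : D.coprod j = D ∘L ContinuousLinearMap.fst ℝ _ _ + j ∘L ContinuousLinearMap.snd ℝ _ _ :=
      ContinuousLinearMap.ext fun q => rfl
    rw [h3]
    exact h1.add h2
  obtain ⟨Ψ, O₁, B₂, hO₁, hB₂, hxO₁, hO₁B, hXO, hΨB, hl, hr, hΨ⟩ :=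
    (contMDiffOn_iff_contDiffOn.2 hX).exists_local_inverse (hB₁.prod isOpen_univ)
      (x := (b₀, (0 : EuclideanSpace ℝ (Fin c)))) ⟨hb₀₁, mem_univ _⟩
      (by rw [hXd.hasMFDerivAt.mfderiv]; exact hbij)
  -- Here the topological embedding matters: it yields an open `O₂` in the target that meets the
  -- image of `S` only in the parametrized piece, so that no other sheet of the image enters.
  have hN : IsOpen {y : S | y.1 ∈ p.U ∧ (p.coord y.1, (0 : EuclideanSpace ℝ (Fin c))) ∈ O₁} := by
    have h1 : ContinuousOn (fun y : M => (p.coord y, (0 : EuclideanSpace ℝ (Fin c)))) p.U :=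
      p.smooth_coord.continuousOn.prodMk continuousOn_const
    exact (h1.isOpen_inter_preimage p.isOpen_U hO₁).preimage continuous_subtype_val
  obtain ⟨O₂, hO₂, hO₂N⟩ := he.isInducing.isOpen_iff.1 hN
  have hO₂' : ∀ y ∈ S, f y ∈ O₂ →
      y ∈ p.U ∧ (p.coord y, (0 : EuclideanSpace ℝ (Fin c))) ∈ O₁ := by
    intro y hy hyO
    have : (⟨y, hy⟩ : S) ∈ S.domRestrict f ⁻¹' O₂ := hyO
    rw [hO₂N] at this
    exact this
  let O : Set M' := (φ.source ∩ φ ⁻¹' B₂) ∩ O₂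
  have hO : IsOpen O :=
    ((continuousOn_extChartAt (f x)).isOpen_inter_preimage (isOpen_extChartAt_source _) hB₂).inter
      hO₂
  have hfxO : f x ∈ O := by
    refine ⟨⟨mem_extChartAt_source _, ?_⟩, ?_⟩
    · have := hXO hxO₁
      simpa [X, g] using this
    · have : (⟨x, hx⟩ : S) ∈ S.domRestrict f ⁻¹' O₂ := by
        rw [hO₂N]
        refine ⟨hp, ?_⟩
        simpa [x, p.coord_param b₀ hb₀] using hxO₁
      exact this
  have hΨφ : ContMDiffOn I' 𝓘(ℝ, EuclideanSpace ℝ (Fin k) × EuclideanSpace ℝ (Fin c)) ∞ (Ψ ∘ φ)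
      O := by
    refine hΨ.comp ((contMDiffOn_extChartAt (I := I') (x := f x)).mono ?_) fun y hy => hy.1.2
    intro y hy
    rw [← extChartAt_source I']
    exact hy.1.1
  have hval : ∀ y ∈ S, f y ∈ O → Ψ (φ (f y)) = (p.coord y, 0) ∧ p.param (p.coord y) = y := by
    intro y hy hyO
    obtain ⟨h1, h2⟩ := hO₂' y hy hyO.2
    have h3 := p.param_coord y hy h1
    refine ⟨?_, h3⟩
    have h4 := hl _ h2
    simpa [X, g, h3] using h4
  have hh : ContMDiffOn I' 𝓘(ℝ, EuclideanSpace ℝ (Fin c)) ∞ (fun y => (Ψ (φ y)).2) O :=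
    contDiff_snd.contMDiff.comp_contMDiffOn hΨφ
  refine ⟨c, O, fun y => (Ψ (φ y)).2, fun y => p.param (Ψ (φ y)).1, by simpa using hc, hO, hfxO,
    hh, ?_, ?_, ?_, ?_, ?_⟩
  -- Composed with `φ.symm ∘ X`, the level function is the second projection, so its differential is
  -- onto.
  · have hy0 : φ.symm (X (b₀, 0)) = f x := by
      simp only [X, g, Function.comp, map_zero, add_zero]
      exact φ.left_inv (mem_extChartAt_source _)
    have hXt : X (b₀, 0) ∈ φ.target := by
      simp only [X, g, Function.comp, map_zero, add_zero]
      exact mem_extChartAt_target _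
    have h1 : MDifferentiableAt I' 𝓘(ℝ, EuclideanSpace ℝ (Fin c)) (fun y => (Ψ (φ y)).2)
        (φ.symm (X (b₀, 0))) := by
      rw [hy0]
      exact ((hh _ hfxO).contMDiffAt (hO.mem_nhds hfxO)).mdifferentiableAt (by simp)
    have h2 : MDifferentiableAt 𝓘(ℝ, E') I' φ.symm (X (b₀, 0)) :=
      ((contMDiffOn_extChartAt_symm (n := ∞) (f x) _ hXt).contMDiffAt
        ((isOpen_extChartAt_target _).mem_nhds hXt)).mdifferentiableAt (by simp)
    have h3 := (h1.hasMFDerivAt.comp (X (b₀, 0)) h2.hasMFDerivAt).comp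
      (b₀, (0 : EuclideanSpace ℝ (Fin c))) hXd.hasMFDerivAt
    let P : EuclideanSpace ℝ (Fin k) × EuclideanSpace ℝ (Fin c) →L[ℝ] EuclideanSpace ℝ (Fin c) :=
      ContinuousLinearMap.snd ℝ _ _
    have h4 : HasMFDerivAt 𝓘(ℝ, EuclideanSpace ℝ (Fin k) × EuclideanSpace ℝ (Fin c))
        𝓘(ℝ, EuclideanSpace ℝ (Fin c))
        (((fun y => (Ψ (φ y)).2) ∘ φ.symm) ∘ X) (b₀, (0 : EuclideanSpace ℝ (Fin c)))
        P := by
      refine P.hasMFDerivAt.congr_of_eventuallyEq ?_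
      have h5 : ∀ᶠ q in 𝓝 (b₀, (0 : EuclideanSpace ℝ (Fin c))), X q ∈ φ.target :=
        hXd.continuousAt.eventually ((isOpen_extChartAt_target _).mem_nhds hXt)
      filter_upwards [h5, hO₁.mem_nhds hxO₁] with q hq hq'
      simp only [Function.comp, φ.right_inv hq, hl q hq']
      rfl
    have h6 := hasMFDerivAt_unique h3 h4
    rw [hy0] at h6
    intro w
    exact ⟨_, DFunLike.congr_fun h6 ((0, w) : EuclideanSpace ℝ (Fin k) × EuclideanSpace ℝ (Fin c))⟩
  · ext y
    constructor
    · rintro ⟨⟨z, hz, rfl⟩, hzO⟩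
      exact ⟨hzO, congrArg Prod.snd (hval z hz hzO).1⟩
    · rintro ⟨hyO, hy0⟩
      refine ⟨⟨p.param (Ψ (φ y)).1, ?_, ?_⟩, hyO⟩
      · exact p.param_mem _ (hO₁B (hΨB hyO.1.2)).1.1
      · have h1 := hr _ hyO.1.2
        have h2 : (Ψ (φ y)).2 = 0 := hy0
        simp only [X, h2, map_zero, add_zero, g, Function.comp] at h1
        exact φ.injOn (hO₁B (hΨB hyO.1.2)).1.2 hyO.1.1 h1
  · refine p.smooth_param.comp (contDiff_fst.contMDiff.comp_contMDiffOn hΨφ) ?_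
    exact fun y hy => (hO₁B (hΨB hy.1.2)).1.1
  · exact fun y hy => p.param_mem _ (hO₁B (hΨB hy.1.2)).1.1
  · intro y hy hyO
    obtain ⟨h1, h2⟩ := hval y hy hyO
    simp only [h1, h2]

theorem IsSubmanifold.image {S : Set M} {k : ℕ} (hS : IsSubmanifold I k S)
    {f : M → M'} (hf : ContMDiffOn I I' ∞ f S) (he : IsEmbedding (S.domRestrict f))
    (hi : ∀ x ∈ S, InjOn (mfderivWithin I I' f S x) (tangentSpaceOf I S x)) :
    IsSubmanifold I' k (f '' S) := by
  rintro _ ⟨x, hx, rfl⟩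
  obtain ⟨c, O, h, l, h1, h2, h3, h4, h5, h6, -⟩ := hS.exists_levelSet_image hf he hx (hi x hx)
  exact ⟨c, O, h, h1, h2, h3, h4, h5, h6⟩

/-- Let `l` be the local smooth left inverse of `f`. Since `f ∘ l` is the identity on the image, a
tangent vector `v` of the image is the differential of `f` applied to that of `l` at `v`. -/
theorem IsSubmanifold.mem_tangentSpaceOf_image_iff {S : Set M} {k : ℕ} (hS : IsSubmanifold I k S)
    {f : M → M'} (hf : ContMDiffOn I I' ∞ f S) (he : IsEmbedding (S.domRestrict f))
    {x : M} (hx : x ∈ S) (hi : InjOn (mfderivWithin I I' f S x) (tangentSpaceOf I S x))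
    (v : TangentSpace I' (f x)) :
    v ∈ tangentSpaceOf I' (f '' S) (f x) ↔
      ∃ w ∈ tangentSpaceOf I S x, mfderivWithin I I' f S x w = v := by
  have hfd : HasMFDerivWithinAt I I' f S x (mfderivWithin I I' f S x) :=
    ((hf x hx).mdifferentiableWithinAt (by simp)).hasMFDerivWithinAt
  constructor
  · intro hv
    obtain ⟨c, O, h, l, h1, hO, hfO, h4, h5, h6, hl, hlS, hlf⟩ :=
      hS.exists_levelSet_image hf he hx hi
    have hlx := hlf x hx hfO
    let A : E' →L[ℝ] E := mfderiv I' I l (f x)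
    have hld : HasMFDerivAt I' I l (f x) A :=
      (((hl _ hfO).contMDiffAt (hO.mem_nhds hfO)).mdifferentiableAt (by simp)).hasMFDerivAt
    have hAv := (hld.hasMFDerivWithinAt (s := f '' S)).mem_tangentSpaceOf (S' := S) (by
      filter_upwards [hO.mem_nhds hfO] with y hy _
      exact hlS y hy) hv
    rw [hlx] at hAv
    refine ⟨A v, hAv, ?_⟩
    have hfd' : HasMFDerivWithinAt I I' f S (l (f x))
        (mfderivWithin I I' f S x : E →L[ℝ] E') := by
      rw [hlx]
      exact hfd
    have hc := HasMFDerivWithinAt.comp (f x) hfd' (hld.hasMFDerivWithinAt (s := O)) hlS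
    have hc' := (hc.hasMFDerivAt (hO.mem_nhds hfO)).hasMFDerivWithinAt (s := f '' S)
    have hid : HasMFDerivWithinAt I' I' (f ∘ l) (f '' S) (f x) (ContinuousLinearMap.id ℝ E') := by
      refine ((hasMFDerivAt_id (f x)).hasMFDerivWithinAt (s := f '' S)).congr_of_eventuallyEq ?_ ?_
      · rw [Filter.EventuallyEq, eventually_nhdsWithin_iff]
        filter_upwards [hO.mem_nhds hfO]
        rintro _ hz ⟨z, hzS, rfl⟩
        exact congrArg f (hlf z hzS hz)
      · exact congrArg f hlx
    exact hc'.eq_on_tangentSpaceOf hid hv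
  · rintro ⟨w, hw, rfl⟩
    exact hfd.mem_tangentSpaceOf (S' := f '' S) (Filter.Eventually.of_forall fun y hy => ⟨y, hy, rfl⟩) hw

end ImageOfEmbedding

/-- The model space of manifolds of dimension `n`. -/
abbrev Euc (n : ℕ) := EuclideanSpace ℝ (Fin n)

/-! ### An embedding of the tangent bundle in a trivial bundle -/

section TangentCoordinates

variable {n : ℕ} {Q : Type u} [TopologicalSpace Q] [ChartedSpace (Euc n) Q]
  [IsManifold (𝓡 n) ∞ Q]

/-- The coordinates of tangent vectors at `q` in the preferred trivialization at `q₀`. -/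
def tcoord (n : ℕ) {Q : Type u} [TopologicalSpace Q] [ChartedSpace (Euc n) Q]
    [IsManifold (𝓡 n) ∞ Q] (q₀ q : Q) : Euc n →L[ℝ] Euc n :=
  (trivializationAt (Euc n) (TangentSpace (𝓡 n)) q₀).continuousLinearMapAt ℝ q

/-- The tangent vectors at `q` with given coordinates in the preferred trivialization at `q₀`. -/
def tsymm (n : ℕ) {Q : Type u} [TopologicalSpace Q] [ChartedSpace (Euc n) Q]
    [IsManifold (𝓡 n) ∞ Q] (q₀ q : Q) : Euc n →L[ℝ] Euc n :=
  (trivializationAt (Euc n) (TangentSpace (𝓡 n)) q₀).symmL ℝ q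

theorem tcoord_tsymm {q₀ q : Q} (h : q ∈ (chartAt (Euc n) q₀).source) (v : Euc n) :
    tcoord n q₀ q (tsymm n q₀ q v) = v :=
  (trivializationAt (Euc n) (TangentSpace (𝓡 n)) q₀).continuousLinearMapAt_symmL h v

theorem tsymm_tcoord {q₀ q : Q} (h : q ∈ (chartAt (Euc n) q₀).source) (v : Euc n) :
    tsymm n q₀ q (tcoord n q₀ q v) = v :=
  (trivializationAt (Euc n) (TangentSpace (𝓡 n)) q₀).symmL_continuousLinearMapAt h v

theorem tcoord_apply {q₀ q : Q} (h : q ∈ (chartAt (Euc n) q₀).source) (v : Euc n) :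
    tcoord n q₀ q v = (trivializationAt (Euc n) (TangentSpace (𝓡 n)) q₀ ⟨q, v⟩).2 :=
  (trivializationAt (Euc n) (TangentSpace (𝓡 n)) q₀).continuousLinearMapAt_apply_of_mem ℝ h v

theorem contMDiffAt_tcoord_comp_tsymm {q₀ q₁ q : Q} (h₀ : q ∈ (chartAt (Euc n) q₀).source)
    (h₁ : q ∈ (chartAt (Euc n) q₁).source) :
    ContMDiffAt (𝓡 n) 𝓘(ℝ, Euc n →L[ℝ] Euc n) ∞ (fun q => tcoord n q₁ q ∘L tsymm n q₀ q) q := by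
  have h := contMDiffOn_coordChangeL (IB := 𝓡 n) (n := ∞) (F := Euc n)
    (E := (TangentSpace (𝓡 n) : Q → Type))
    (trivializationAt (Euc n) (TangentSpace (𝓡 n)) q₀)
    (trivializationAt (Euc n) (TangentSpace (𝓡 n)) q₁)
  have hn : (chartAt (Euc n) q₀).source ∩ (chartAt (Euc n) q₁).source ∈ 𝓝 q :=
    ((chartAt (Euc n) q₀).open_source.inter (chartAt (Euc n) q₁).open_source).mem_nhds ⟨h₀, h₁⟩
  refine ((h q ⟨h₀, h₁⟩).contMDiffAt hn).congr_of_eventuallyEq ?_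
  filter_upwards [hn] with z hz
  ext1 v
  have h1 := (trivializationAt (Euc n) (TangentSpace (𝓡 n)) q₀).coordChangeL_apply (R := ℝ)
    (trivializationAt (Euc n) (TangentSpace (𝓡 n)) q₁) hz v
  refine Eq.trans ?_ h1.symm
  have h2 : tsymm n q₀ z v = (trivializationAt (Euc n) (TangentSpace (𝓡 n)) q₀).symm z v :=
    (trivializationAt (Euc n) (TangentSpace (𝓡 n)) q₀).symmL_apply (R := ℝ) hz.1 v
  rw [ContinuousLinearMap.comp_apply, h2]
  exact tcoord_apply hz.2 _

end TangentCoordinates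

/-- An embedding of the tangent bundle of `Q` into a trivial bundle with fibre `V`, with a
left inverse; both depend smoothly on the point. -/
structure TangentEmbedding (n : ℕ) (Q : Type u) [TopologicalSpace Q] [ChartedSpace (Euc n) Q]
    [IsManifold (𝓡 n) ∞ Q] (V : Type*) [NormedAddCommGroup V] [NormedSpace ℝ V] where
  incl : Q → Euc n →L[ℝ] V
  retr : Q → V →L[ℝ] Euc n
  retr_incl : ∀ q v, retr q (incl q v) = v
  smooth_incl : ∀ q₀, ContMDiffAt (𝓡 n) 𝓘(ℝ, Euc n →L[ℝ] V) ∞ (fun q => incl q ∘L tsymm n q₀ q) q₀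
  smooth_retr : ∀ q₀, ContMDiffAt (𝓡 n) 𝓘(ℝ, V →L[ℝ] Euc n) ∞ (fun q => tcoord n q₀ q ∘L retr q) q₀

section Existence

variable {n : ℕ} {Q : Type u} [TopologicalSpace Q] [ChartedSpace (Euc n) Q]
  [IsManifold (𝓡 n) ∞ Q]

/-- The fibre of the trivial bundle into which the tangent bundle is embedded. -/
abbrev AmbientFibre (n : ℕ) (Q : Type u) := lp (fun _ : Q => Euc n) 2

/-- With a partition of unity `χ` subordinate to the charts, a vector is sent to the family of its
chart coordinates weighted by `χ i`, one slot for each `i`; no finite atlas is needed. Reading the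
slots back with the weights `χ i` multiplies by `s = ∑ χ i ^ 2`, which is positive and is divided
out. -/
theorem nonempty_tangentEmbedding [T2Space Q] [SecondCountableTopology Q] :
    Nonempty (TangentEmbedding n Q (AmbientFibre n Q)) := by
  classical
  have : LocallyCompactSpace Q := Manifold.locallyCompact_of_finiteDimensional (𝓡 n)
  have : SigmaCompactSpace Q := inferInstance
  obtain ⟨χ, hχ⟩ := SmoothPartitionOfUnity.exists_isSubordinate_chartAt_source (𝓡 n) Q
  let sg : ∀ _ : Q, Euc n →L[ℝ] AmbientFibre n Q := fun i =>
    lp.singleContinuousLinearMap ℝ (fun _ : Q => Euc n) 2 i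
  let ev : ∀ _ : Q, AmbientFibre n Q →L[ℝ] Euc n := fun i => lp.evalCLM ℝ (fun _ : Q => Euc n) 2 i
  have hev : ∀ i v, ev i (sg i v) = v := fun i v => by
    change (lp.single 2 i v : AmbientFibre n Q) i = v
    exact lp.single_apply_self (E := fun _ : Q => Euc n) 2 i v
  have hev' : ∀ i j v, i ≠ j → ev i (sg j v) = 0 := fun i j v hij => by
    change (lp.single 2 j v : AmbientFibre n Q) i = 0
    exact lp.single_apply_ne (E := fun _ : Q => Euc n) 2 j v hij
  have hsrc : ∀ i q, q ∈ tsupport (χ i) → q ∈ (chartAt (Euc n) i).source := fun i q hq => hχ i hq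
  have hsrc' : ∀ i q, i ∈ χ.finsupport q → q ∈ (chartAt (Euc n) i).source := fun i q hq =>
    hχ i (subset_closure (by simpa using hq))
  let incl : Q → Euc n →L[ℝ] AmbientFibre n Q := fun q =>
    ∑ᶠ i, χ i q • (sg i ∘L tcoord n i q)
  let s : Q → ℝ := fun q => ∑ᶠ i, χ i q • χ i q
  let r : Q → AmbientFibre n Q →L[ℝ] Euc n := fun q =>
    ∑ᶠ i, χ i q • (tsymm n i q ∘L ev i)
  have hincl : ∀ q, incl q = ∑ i ∈ χ.finsupport q, χ i q • (sg i ∘L tcoord n i q) := fun q =>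
    (χ.sum_finsupport_smul_eq_finsum q fun i q => sg i ∘L tcoord n i q).symm
  have hr : ∀ q, r q = ∑ i ∈ χ.finsupport q, χ i q • (tsymm n i q ∘L ev i) := fun q =>
    (χ.sum_finsupport_smul_eq_finsum q fun i q => tsymm n i q ∘L ev i).symm
  have hs : ∀ q, s q = ∑ i ∈ χ.finsupport q, χ i q • χ i q := fun q =>
    (χ.sum_finsupport_smul_eq_finsum q fun i q => χ i q).symm
  have hspos : ∀ q, 0 < s q := fun q => by
    rw [hs]
    obtain ⟨i, hi⟩ := χ.exists_pos_of_mem (mem_univ q)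
    refine Finset.sum_pos' (fun j _ => mul_self_nonneg _) ⟨i, ?_, mul_pos hi hi⟩
    rw [χ.mem_finsupport]
    exact hi.ne'
  have hssmooth : ContMDiff (𝓡 n) 𝓘(ℝ, ℝ) ∞ s :=
    χ.contMDiff_finsum_smul fun i x _ => (χ i).contMDiff.contMDiffAt
  refine ⟨⟨incl, fun q => (s q)⁻¹ • r q, ?_, ?_, ?_⟩⟩
  · intro q v
    have h1 : r q (incl q v) = s q • v := by
      rw [hr, hs, Finset.sum_smul, sum_apply]
      refine Finset.sum_congr rfl fun i hi => ?_
      have h2 : ev i (incl q v) = χ i q • tcoord n i q v := by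
        rw [hincl, sum_apply, map_sum, Finset.sum_eq_single i]
        · simp only [smul_apply, ContinuousLinearMap.comp_apply, map_smul, hev]
        · intro j _ hj
          simp only [smul_apply, ContinuousLinearMap.comp_apply, map_smul,
            hev' i j _ (Ne.symm hj), smul_zero]
        · exact fun h => absurd hi h
      simp only [smul_apply, ContinuousLinearMap.comp_apply, h2, map_smul,
        tsymm_tcoord (hsrc' i q hi), smul_smul, smul_eq_mul]
    rw [smul_apply, h1, smul_smul, inv_mul_cancel₀ (hspos q).ne', one_smul]
  · intro q₀
    have h1 : ContMDiffAt (𝓡 n) 𝓘(ℝ, Euc n →L[ℝ] AmbientFibre n Q) ∞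
        (fun q => ∑ᶠ i, χ i q • (sg i ∘L (tcoord n i q ∘L tsymm n q₀ q))) q₀ := by
      refine χ.contMDiffAt_finsum fun i hi => ?_
      exact contMDiffAt_const.clm_comp
        (contMDiffAt_tcoord_comp_tsymm (mem_chart_source _ q₀) (hsrc i q₀ hi))
    refine h1.congr_of_eventuallyEq (Filter.Eventually.of_forall fun q => ?_)
    simp only [hincl]
    rw [← χ.sum_finsupport_smul_eq_finsum q fun i q => sg i ∘L (tcoord n i q ∘L tsymm n q₀ q)]
    ext1 v
    simp
  · intro q₀
    have h1 : ContMDiffAt (𝓡 n) 𝓘(ℝ, AmbientFibre n Q →L[ℝ] Euc n) ∞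
        (fun q => ∑ᶠ i, χ i q • ((tcoord n q₀ q ∘L tsymm n i q) ∘L ev i)) q₀ := by
      refine χ.contMDiffAt_finsum fun i hi => ?_
      exact (contMDiffAt_tcoord_comp_tsymm (hsrc i q₀ hi) (mem_chart_source _ q₀)).clm_comp
        contMDiffAt_const
    have h2 : ContMDiffAt (𝓡 n) 𝓘(ℝ, ℝ) ∞ (fun q => (s q)⁻¹) q₀ :=
      hssmooth.contMDiffAt.inv₀ (hspos q₀).ne'
    refine (h2.smul h1).congr_of_eventuallyEq (Filter.Eventually.of_forall fun q => ?_)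
    simp only [hr, Pi.smul_apply']
    rw [← χ.sum_finsupport_smul_eq_finsum q fun i q => (tcoord n q₀ q ∘L tsymm n i q) ∘L ev i]
    ext1 v
    simp

end Existence

/-! ### Covectors and tangent vectors as elements of fixed spaces -/

section Fibres

variable {n : ℕ} {Q : Type u} [TopologicalSpace Q] [ChartedSpace (Euc n) Q]
  [IsManifold (𝓡 n) ∞ Q]

/-- The fibre component of a covector, as a functional on the model space. -/
def covec (ξ : Cotangent n Q) : Euc n →L[ℝ] ℝ := ξ.2

/-- The fibre component of a tangent vector, as an element of the model space. -/
def tvec (v : TangentBundle (𝓡 n) Q) : Euc n := v.2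

/-- The covector at `q` with given fibre component. -/
def mkCov (q : Q) (p : Euc n →L[ℝ] ℝ) : Cotangent n Q := ⟨q, p⟩

theorem contMDiff_base : ContMDiff (cotangentModel n) (𝓡 n) ∞
    (fun ξ : Cotangent n Q => ξ.proj) :=
  Bundle.contMDiff_proj _

end Fibres

namespace TangentEmbedding

variable {n : ℕ} {Q : Type u} [TopologicalSpace Q] [ChartedSpace (Euc n) Q]
  [IsManifold (𝓡 n) ∞ Q] {V : Type*} [NormedAddCommGroup V] [NormedSpace ℝ V]
  (T : TangentEmbedding n Q V)
  {F : Type*} [NormedAddCommGroup F] [NormedSpace ℝ F] {H : Type*} [TopologicalSpace H]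
  {J : ModelWithCorners ℝ F H} {X : Type*} [TopologicalSpace X] [ChartedSpace H X]

/-- The projection of `V` onto the image of the tangent space. -/
def proj (q : Q) : V →L[ℝ] V := T.incl q ∘L T.retr q

theorem proj_incl (q : Q) (v : Euc n) : T.proj q (T.incl q v) = T.incl q v :=
  congrArg (T.incl q) (T.retr_incl q v)

theorem retr_proj (q : Q) (v : V) : T.retr q (T.proj q v) = T.retr q v := T.retr_incl q _

theorem incl_injective (q : Q) : Function.Injective (T.incl q) :=
  Function.LeftInverse.injective (T.retr_incl q)

theorem eventually_mem_source (n : ℕ) {Q : Type u} [TopologicalSpace Q] [ChartedSpace (Euc n) Q]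
    (q₀ : Q) : ∀ᶠ q in 𝓝 q₀, q ∈ (chartAt (Euc n) q₀).source :=
  (chartAt (Euc n) q₀).open_source.mem_nhds (mem_chart_source _ q₀)

theorem contMDiff_proj : ContMDiff (𝓡 n) 𝓘(ℝ, V →L[ℝ] V) ∞ T.proj := by
  intro q₀
  refine ((T.smooth_incl q₀).clm_comp (T.smooth_retr q₀)).congr_of_eventuallyEq ?_
  filter_upwards [eventually_mem_source n q₀] with q hq
  ext1 v
  simp [proj, tsymm_tcoord hq]

/-- The cotangent bundle in the dual of `V`. -/
def hat (ξ : Cotangent n Q) : V →L[ℝ] ℝ := covec ξ ∘L T.retr ξ.proj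

theorem hat_incl (ξ : Cotangent n Q) (v : Euc n) : T.hat ξ (T.incl ξ.proj v) = covec ξ v :=
  congrArg (covec ξ) (T.retr_incl ξ.proj v)

theorem inCoordinates_eq_comp_tsymm (q₀ : Q) (ξ : Cotangent n Q) :
    ContinuousLinearMap.inCoordinates (Euc n) (TangentSpace (𝓡 n) : Q → Type) ℝ
      (Bundle.Trivial Q ℝ) q₀ ξ.proj q₀ ξ.proj ξ.2 = covec ξ ∘L tsymm n q₀ ξ.proj := by
  ext1 v
  have h := Bundle.Trivial.continuousLinearMapAt_trivialization ℝ Q ℝ ξ.proj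
  exact DFunLike.congr_fun h (covec ξ (tsymm n q₀ ξ.proj v))

/-- A map into the cotangent bundle is smooth if the base point and the covector, as a functional
on `V`, are. -/
theorem contMDiffWithinAt_cotangent_iff {G : X → Cotangent n Q} {s : Set X} {z : X} :
    ContMDiffWithinAt J (cotangentModel n) ∞ G s z ↔
      ContMDiffWithinAt J (𝓡 n) ∞ (fun y => (G y).proj) s z ∧
      ContMDiffWithinAt J 𝓘(ℝ, V →L[ℝ] ℝ) ∞ (fun y => T.hat (G y)) s z := by
  rw [contMDiffWithinAt_hom_bundle]
  refine and_congr_right fun hb => ?_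
  have hb' : ∀ᶠ y in 𝓝[s] z, (G y).proj ∈ (chartAt (Euc n) (G z).proj).source :=
    hb.continuousWithinAt.eventually (eventually_mem_source n (G z).proj)
  simp only [inCoordinates_eq_comp_tsymm]
  constructor
  · intro h
    have h1 : ContMDiffWithinAt J 𝓘(ℝ, V →L[ℝ] Euc n) ∞
        (fun y => tcoord n (G z).proj (G y).proj ∘L T.retr (G y).proj) s z :=
      (T.smooth_retr (G z).proj).comp_contMDiffWithinAt z hb
    have key : ∀ y, (G y).proj ∈ (chartAt (Euc n) (G z).proj).source → T.hat (G y) =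
        (covec (G y) ∘L tsymm n (G z).proj (G y).proj) ∘L
          (tcoord n (G z).proj (G y).proj ∘L T.retr (G y).proj) := fun y hy => by
      ext1 v
      exact (congrArg (covec (G y)) (tsymm_tcoord hy (T.retr (G y).proj v))).symm
    exact (h.clm_comp h1).congr_of_eventuallyEq (hb'.mono key) (key z (mem_chart_source _ _))
  · intro h
    have h1 : ContMDiffWithinAt J 𝓘(ℝ, Euc n →L[ℝ] V) ∞
        (fun y => T.incl (G y).proj ∘L tsymm n (G z).proj (G y).proj) s z :=
      (T.smooth_incl (G z).proj).comp_contMDiffWithinAt z hb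
    refine (h.clm_comp h1).congr (fun y _ => ?_) ?_ <;> ext1 v <;>
    exact (T.hat_incl _ _).symm

theorem contMDiff_hat : ContMDiff (cotangentModel n) 𝓘(ℝ, V →L[ℝ] ℝ) ∞ T.hat := fun ξ =>
  (T.contMDiffWithinAt_cotangent_iff.1 (contMDiff_id (I := cotangentModel n) (M := Cotangent n Q)
    (n := ∞) ξ).contMDiffWithinAt).2.contMDiffAt Filter.univ_mem

/-- The tangent bundle in `V`. -/
def total (v : TangentBundle (𝓡 n) Q) : V := T.incl v.proj (tvec v)

theorem contMDiff_total : ContMDiff ((𝓡 n).prod 𝓘(ℝ, Euc n)) 𝓘(ℝ, V) ∞ T.total := by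
  intro v₀
  have hid := Bundle.contMDiffAt_totalSpace.1 (contMDiff_id (I := (𝓡 n).prod 𝓘(ℝ, Euc n))
    (M := TangentBundle (𝓡 n) Q) (n := ∞) v₀)
  have h1 : ContMDiffAt ((𝓡 n).prod 𝓘(ℝ, Euc n)) 𝓘(ℝ, Euc n →L[ℝ] V) ∞
      (fun v : TangentBundle (𝓡 n) Q => T.incl v.proj ∘L tsymm n v₀.proj v.proj) v₀ :=
    (T.smooth_incl v₀.proj).comp v₀ hid.1
  refine (h1.clm_apply hid.2).congr_of_eventuallyEq ?_
  filter_upwards [hid.1.continuousAt.eventually (eventually_mem_source n v₀.proj)] with v hv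
  have hv' : v.proj ∈ (chartAt (Euc n) v₀.proj).source := hv
  exact (congrArg (T.incl v.proj) ((congrArg (tsymm n v₀.proj v.proj)
    (tcoord_apply hv' (tvec v)).symm).trans (tsymm_tcoord hv' (tvec v)))).symm

/-- A map into the tangent bundle is continuous if the base point and the vector in `V` are. -/
theorem continuousWithinAt_tangentBundle {Y : Type*} [TopologicalSpace Y]
    {G : Y → TangentBundle (𝓡 n) Q} {s : Set Y} {z : Y}
    (hb : ContinuousWithinAt (fun y => (G y).proj) s z)
    (hv : ContinuousWithinAt (fun y => T.total (G y)) s z) : ContinuousWithinAt G s z := by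
  rw [FiberBundle.continuousWithinAt_totalSpace]
  refine ⟨hb, ?_⟩
  have h1 : ContinuousWithinAt
      (fun y => tcoord n (G z).proj (G y).proj ∘L T.retr (G y).proj) s z :=
    (T.smooth_retr (G z).proj).continuousAt.comp_continuousWithinAt (f := fun y => (G y).proj) hb
  have hb' := hb.eventually (eventually_mem_source n (G z).proj)
  have key : ∀ y, (G y).proj ∈ (chartAt (Euc n) (G z).proj).source →
      (trivializationAt (Euc n) (TangentSpace (𝓡 n)) (G z).proj (G y)).2 =
      (tcoord n (G z).proj (G y).proj ∘L T.retr (G y).proj) (T.total (G y)) := fun y hy =>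
    (tcoord_apply hy (tvec (G y))).symm.trans
      (congrArg (tcoord n (G z).proj (G y).proj) (T.retr_incl _ _).symm)
  exact (h1.clm_apply hv).congr_of_eventuallyEq (hb'.mono key) (key z (mem_chart_source _ _))

theorem continuous_tangentBundle {Y : Type*} [TopologicalSpace Y]
    {G : Y → TangentBundle (𝓡 n) Q} (hb : Continuous fun y => (G y).proj)
    (hv : Continuous fun y => T.total (G y)) : Continuous G := by
  rw [← continuousOn_univ]
  exact fun y _ => T.continuousWithinAt_tangentBundle hb.continuousWithinAt hv.continuousWithinAt

end TangentEmbedding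

/-! ### Orthogonal projections and transfers, with smooth dependence -/

section DualLift

variable {V F : Type*} [NormedAddCommGroup V] [NormedSpace ℝ V] [NormedAddCommGroup F]
  [NormedSpace ℝ F]

/-- The pullback of a bilinear form by a linear map. -/
def gram (G : V →L[ℝ] V →L[ℝ] ℝ) (a : F →L[ℝ] V) : F →L[ℝ] F →L[ℝ] ℝ := (a.precomp ℝ) ∘L (G ∘L a)

/-- The vector that represents the pullback of a functional by `a`, with respect to the pullback
of the bilinear form `G`. -/
def dualLift (G : V →L[ℝ] V →L[ℝ] ℝ) (a : F →L[ℝ] V) : (V →L[ℝ] ℝ) →L[ℝ] F :=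
  (gram G a).inverse ∘L (a.precomp ℝ)

/-- The hypothesis excludes a kernel, and `F` and its dual have the same dimension. Only `F` has to
be finite-dimensional, so this serves forms pulled back from the large space `V`. -/
theorem isInvertible_of_nondegenerate [FiniteDimensional ℝ F] {B : F →L[ℝ] F →L[ℝ] ℝ}
    (h : ∀ u, u ≠ 0 → B u u ≠ 0) : B.IsInvertible := by
  have hi : Function.Injective B := by
    rw [injective_iff_map_eq_zero]
    intro u hu
    by_contra h0
    exact h u h0 (by rw [hu]; rfl)
  have hd : Module.finrank ℝ F = Module.finrank ℝ (F →L[ℝ] ℝ) := by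
    rw [← (LinearMap.toContinuousLinearMap (E := F) (F' := ℝ) (𝕜 := ℝ)).finrank_eq,
      Module.finrank_linearMap]
    simp
  exact ⟨(LinearMap.linearEquivOfInjective B.toLinearMap hi hd).toContinuousLinearEquiv, by
    ext1 u; rfl⟩

variable {G : V →L[ℝ] V →L[ℝ] ℝ} {a : F →L[ℝ] V}

theorem apply_dualLift [FiniteDimensional ℝ F] (h : ∀ u, u ≠ 0 → G (a u) (a u) ≠ 0)
    (p : V →L[ℝ] ℝ) (u : F) : G (a (dualLift G a p)) (a u) = p (a u) := by
  have hinv : (gram G a).IsInvertible := isInvertible_of_nondegenerate h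
  exact DFunLike.congr_fun (hinv.self_apply_inverse (a.precomp ℝ p)) u

theorem eq_dualLift [FiniteDimensional ℝ F] (h : ∀ u, u ≠ 0 → G (a u) (a u) ≠ 0)
    {p : V →L[ℝ] ℝ} {w : F} (hw : ∀ u, G (a w) (a u) = p (a u)) : w = dualLift G a p := by
  have hinv : (gram G a).IsInvertible := isInvertible_of_nondegenerate h
  have h1 : gram G a w = a.precomp ℝ p := ContinuousLinearMap.ext hw
  rw [dualLift, ContinuousLinearMap.comp_apply, ← h1, hinv.inverse_apply_self]

/-- The linear map that agrees with `b ∘ a⁻¹` on the range of `a`, and is zero on its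
orthogonal complement. -/
def transfer (G : V →L[ℝ] V →L[ℝ] ℝ) (a b : F →L[ℝ] V) : V →L[ℝ] V := b ∘L (dualLift G a ∘L G)

theorem transfer_apply_self [FiniteDimensional ℝ F] (h : ∀ u, u ≠ 0 → G (a u) (a u) ≠ 0)
    (b : F →L[ℝ] V) (u : F) : transfer G a b (a u) = b u :=
  congrArg b (eq_dualLift h fun _ => rfl).symm

theorem transfer_apply_eq_zero [FiniteDimensional ℝ F] (h : ∀ u, u ≠ 0 → G (a u) (a u) ≠ 0)
    (b : F →L[ℝ] V) {w : V} (hw : ∀ u, G w (a u) = 0) : transfer G a b w = 0 :=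
  (congrArg b (eq_dualLift (w := 0) h fun u => by simp [hw u]).symm).trans (map_zero b)

/-- Any `v` differs from its projection to the range of `a` by a vector orthogonal to this range, so
the values on the range and on its complement determine `X`. -/
theorem eq_transfer [FiniteDimensional ℝ F] (h : ∀ u, u ≠ 0 → G (a u) (a u) ≠ 0)
    {b : F →L[ℝ] V} {X : V →L[ℝ] V} (h1 : ∀ u, X (a u) = b u)
    (h2 : ∀ w, (∀ u, G w (a u) = 0) → X w = 0) : X = transfer G a b := by
  ext1 v
  have h3 : X (v - a (dualLift G a (G v))) = 0 := h2 _ fun u => by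
    rw [map_sub, sub_apply, apply_dualLift h, sub_self]
  rw [map_sub, h1, sub_eq_zero] at h3
  exact h3

theorem apply_transfer_self [FiniteDimensional ℝ F] (h : ∀ u, u ≠ 0 → G (a u) (a u) ≠ 0)
    (v : V) (u : F) : G (transfer G a a v) (a u) = G v (a u) := apply_dualLift h (G v) u

variable {E : Type*} [NormedAddCommGroup E] [NormedSpace ℝ E] {H : Type*} [TopologicalSpace H]
  {J : ModelWithCorners ℝ E H} {X : Type*} [TopologicalSpace X] [ChartedSpace H X]

/-- Inversion of operators is smooth at an invertible one, so nondegeneracy is needed at `z` alone.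
-/
theorem ContMDiffWithinAt.dualLift [FiniteDimensional ℝ F] {G : X → V →L[ℝ] V →L[ℝ] ℝ}
    {a : X → F →L[ℝ] V} {s : Set X} {z : X}
    (hG : ContMDiffWithinAt J 𝓘(ℝ, V →L[ℝ] V →L[ℝ] ℝ) ∞ G s z)
    (ha : ContMDiffWithinAt J 𝓘(ℝ, F →L[ℝ] V) ∞ a s z)
    (h : ∀ u, u ≠ 0 → G z (a z u) (a z u) ≠ 0) :
    ContMDiffWithinAt J 𝓘(ℝ, (V →L[ℝ] ℝ) →L[ℝ] F) ∞ (fun y => dualLift (G y) (a y)) s z := by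
  have : CompleteSpace F := FiniteDimensional.complete ℝ F
  have h1 : ContMDiffWithinAt J 𝓘(ℝ, F →L[ℝ] F →L[ℝ] ℝ) ∞ (fun y => gram (G y) (a y)) s z :=
    (ha.clm_precomp (F₃ := ℝ)).clm_comp (hG.clm_comp ha)
  have hinv : (gram (G z) (a z)).IsInvertible := isInvertible_of_nondegenerate h
  have h2 : ContMDiffWithinAt J 𝓘(ℝ, (F →L[ℝ] ℝ) →L[ℝ] F) ∞
      (fun y => (gram (G y) (a y)).inverse) s z :=
    ContMDiffAt.comp_contMDiffWithinAt z
      (g := fun B : F →L[ℝ] F →L[ℝ] ℝ => B.inverse)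
      (hinv.contDiffAt_map_inverse (n := ∞)).contMDiffAt h1
  exact h2.clm_comp (ha.clm_precomp (F₃ := ℝ))

theorem ContMDiffWithinAt.transfer [FiniteDimensional ℝ F] {G : X → V →L[ℝ] V →L[ℝ] ℝ}
    {a b : X → F →L[ℝ] V} {s : Set X} {z : X}
    (hG : ContMDiffWithinAt J 𝓘(ℝ, V →L[ℝ] V →L[ℝ] ℝ) ∞ G s z)
    (ha : ContMDiffWithinAt J 𝓘(ℝ, F →L[ℝ] V) ∞ a s z)
    (hb : ContMDiffWithinAt J 𝓘(ℝ, F →L[ℝ] V) ∞ b s z)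
    (h : ∀ u, u ≠ 0 → G z (a z u) (a z u) ≠ 0) :
    ContMDiffWithinAt J 𝓘(ℝ, V →L[ℝ] V) ∞ (fun y => transfer (G y) (a y) (b y)) s z :=
  hb.clm_comp ((hG.dualLift ha h).clm_comp hG)

end DualLift

/-! ### The metric and the dual norm -/

section Metric

variable {n : ℕ} {Q : Type u} [TopologicalSpace Q] [ChartedSpace (Euc n) Q]
  [IsManifold (𝓡 n) ∞ Q] (g : RiemMetric n Q)

/-- The metric at `q`, as a bilinear form on the model space. -/
def gE (q : Q) : Euc n →L[ℝ] Euc n →L[ℝ] ℝ := g.inner q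

theorem gE_pos (q : Q) {v : Euc n} (hv : v ≠ 0) : 0 < gE g q v v := g.pos q v hv

/-- The vector that represents a functional. -/
def sharp (q : Q) : (Euc n →L[ℝ] ℝ) →L[ℝ] Euc n := (gE g q).inverse

theorem gE_sharp (q : Q) (p : Euc n →L[ℝ] ℝ) : gE g q (sharp g q p) = p :=
  (isInvertible_of_nondegenerate fun _ hu => (gE_pos g q hu).ne').self_apply_inverse p

theorem sharp_gE (q : Q) (v : Euc n) : sharp g q (gE g q v) = v :=
  (isInvertible_of_nondegenerate fun _ hu => (gE_pos g q hu).ne').inverse_apply_self v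

/-- The square of the norm of a covector. -/
def normSq (ξ : Cotangent n Q) : ℝ := covec ξ (sharp g ξ.proj (covec ξ))

theorem normSq_eq (ξ : Cotangent n Q) :
    normSq g ξ = gE g ξ.proj (sharp g ξ.proj (covec ξ)) (sharp g ξ.proj (covec ξ)) := by
  rw [gE_sharp]; rfl

theorem normSq_pos {ξ : Cotangent n Q} (h : covec ξ ≠ 0) : 0 < normSq g ξ := by
  rw [normSq_eq]
  refine gE_pos g _ fun h0 => h ?_
  rw [← gE_sharp g ξ.proj (covec ξ), h0, map_zero]

theorem normSq_mkCov_smul (q : Q) (c : ℝ) (p : Euc n →L[ℝ] ℝ) :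
    normSq g (mkCov q (c • p)) = c ^ 2 * normSq g (mkCov q p) := by
  change (c • p) (sharp g q (c • p)) = c ^ 2 * p (sharp g q p)
  rw [map_smul, smul_apply, map_smul, smul_eq_mul, smul_eq_mul]
  ring

theorem mem_unitCotangent_iff (ξ : Cotangent n Q) : ξ ∈ unitCotangent g ↔ normSq g ξ = 1 := by
  constructor
  · rintro ⟨v, h1, h2⟩
    have h3 : sharp g ξ.proj (covec ξ) = v :=
      (congrArg (sharp g ξ.proj) (show covec ξ = gE g ξ.proj v from h2.symm)).trans
        (sharp_gE g ξ.proj v)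
    rw [normSq_eq, h3]
    exact h1
  · intro h
    rw [normSq_eq] at h
    exact ⟨sharp g ξ.proj (covec ξ), h, gE_sharp g ξ.proj (covec ξ)⟩

namespace TangentEmbedding

variable {V : Type*} [NormedAddCommGroup V] [NormedSpace ℝ V] (T : TangentEmbedding n Q V)

/-- The metric as a family of bilinear forms on `V`. -/
def metric (q : Q) : V →L[ℝ] V →L[ℝ] ℝ := gram (gE g q) (T.retr q)

theorem metric_apply (q : Q) (v w : V) :
    T.metric g q v w = gE g q (T.retr q v) (T.retr q w) := rfl

theorem metric_incl (q : Q) (v w : Euc n) :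
    T.metric g q (T.incl q v) (T.incl q w) = gE g q v w := by
  rw [metric_apply, T.retr_incl, T.retr_incl]

theorem metric_proj (q : Q) (v : V) : T.metric g q (T.proj q v) = T.metric g q v := by
  ext1 w
  rw [metric_apply, metric_apply, T.retr_proj]

theorem contMDiff_metric : ContMDiff (𝓡 n) 𝓘(ℝ, V →L[ℝ] V →L[ℝ] ℝ) ∞ (T.metric g) := by
  intro q₀
  have h1 := ((contMDiffAt_hom_bundle _).1 (g.contMDiff q₀)).2
  refine ContMDiffAt.congr_of_eventuallyEq (((T.smooth_retr q₀).clm_precomp (F₃ := ℝ)).clm_comp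
    (h1.clm_comp (T.smooth_retr q₀))) ?_
  filter_upwards [eventually_mem_source n q₀] with q hq
  ext v w
  have h2 := inCoordinates_apply_eq₂ (𝕜 := ℝ) (F₁ := Euc n) (F₂ := Euc n) (F₃ := ℝ)
    (E₁ := (TangentSpace (𝓡 n) : Q → Type)) (E₂ := (TangentSpace (𝓡 n) : Q → Type))
    (E₃ := Bundle.Trivial Q ℝ) (x₀ := q₀) (x := q) (ϕ := g.inner q)
    (v := tcoord n q₀ q (T.retr q v)) (w := tcoord n q₀ q (T.retr q w)) hq hq (mem_univ _)
  refine Eq.trans ?_ h2.symm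
  have h3 : ∀ x : Euc n, (trivializationAt (Euc n) (TangentSpace (𝓡 n)) q₀).symm q
      (tcoord n q₀ q x) = x := fun x =>
    ((trivializationAt (Euc n) (TangentSpace (𝓡 n)) q₀).symmL_apply (R := ℝ) hq _).symm.trans
      (tsymm_tcoord hq x)
  have h4 : ∀ c : ℝ, Bundle.Trivialization.linearMapAt ℝ
      (trivializationAt ℝ (Bundle.Trivial Q ℝ) q₀) q c = c := fun c => by
    simp
  refine Eq.trans ?_ (h4 _).symm
  refine Eq.trans (metric_apply g T q v w) ?_
  exact congrArg₂ (fun a b => gE g q a b) (h3 (T.retr q v)).symm (h3 (T.retr q w)).symm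

/-- The vector that represents a functional, in `V`. -/
def sharpHat (q : Q) : (V →L[ℝ] ℝ) →L[ℝ] V := T.incl q ∘L (sharp g q ∘L (T.incl q).precomp ℝ)

theorem sharpHat_apply (q : Q) (p : V →L[ℝ] ℝ) :
    T.sharpHat g q p = T.incl q (sharp g q (p ∘L T.incl q)) := rfl

theorem sharpHat_hat (ξ : Cotangent n Q) :
    T.sharpHat g ξ.proj (T.hat ξ) = T.incl ξ.proj (sharp g ξ.proj (covec ξ)) := by
  rw [sharpHat_apply]
  congr 2
  ext1 v
  exact T.hat_incl ξ v

theorem normSq_eq_hat (ξ : Cotangent n Q) :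
    normSq g ξ = T.hat ξ (T.sharpHat g ξ.proj (T.hat ξ)) := by
  rw [sharpHat_hat, hat_incl]; rfl

/-- In a local trivialization, raising an index is the `dualLift` for the pulled back metric, which
depends smoothly on the point. -/
theorem contMDiff_sharpHat : ContMDiff (𝓡 n) 𝓘(ℝ, (V →L[ℝ] ℝ) →L[ℝ] V) ∞ (T.sharpHat g) := by
  intro q₀
  have hnd : ∀ q ∈ (chartAt (Euc n) q₀).source, ∀ u : Euc n, u ≠ 0 →
      T.metric g q ((T.incl q ∘L tsymm n q₀ q) u) ((T.incl q ∘L tsymm n q₀ q) u) ≠ 0 := by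
    intro q hq u hu
    rw [ContinuousLinearMap.comp_apply, metric_incl]
    refine (gE_pos g q fun h0 => hu ?_).ne'
    rw [← tcoord_tsymm hq u, h0, map_zero]
  have h1 := ((T.contMDiff_metric g q₀).contMDiffWithinAt (s := univ)).dualLift
    (T.smooth_incl q₀).contMDiffWithinAt (hnd q₀ (mem_chart_source _ _))
  refine ((T.smooth_incl q₀).clm_comp (h1.contMDiffAt Filter.univ_mem)).congr_of_eventuallyEq ?_
  filter_upwards [eventually_mem_source n q₀] with q hq
  ext1 p
  have h2 : tcoord n q₀ q (sharp g q (p ∘L T.incl q)) =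
      dualLift (T.metric g q) (T.incl q ∘L tsymm n q₀ q) p := by
    refine eq_dualLift (hnd q hq) fun u => ?_
    rw [ContinuousLinearMap.comp_apply, ContinuousLinearMap.comp_apply, tsymm_tcoord hq,
      metric_incl, gE_sharp]
    rfl
  rw [sharpHat_apply, ContinuousLinearMap.comp_apply, ContinuousLinearMap.comp_apply, ← h2,
    tsymm_tcoord hq]

theorem contMDiff_normSq (T : TangentEmbedding n Q V) : ContMDiff (cotangentModel n) 𝓘(ℝ, ℝ) ∞ (normSq g (Q := Q)) := by
  have h1 : ContMDiff (cotangentModel n) 𝓘(ℝ, (V →L[ℝ] ℝ) →L[ℝ] V) ∞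
      (fun ξ : Cotangent n Q => T.sharpHat g ξ.proj) :=
    (T.contMDiff_sharpHat g).comp contMDiff_base
  have h2 := T.contMDiff_hat.clm_apply (h1.clm_apply T.contMDiff_hat)
  exact h2.congr fun ξ => T.normSq_eq_hat g ξ

end TangentEmbedding

end Metric

/-! ### Vertical vectors of the cotangent bundle -/

section Vertical

/-- The model space of the cotangent bundle. -/
abbrev CotModel (n : ℕ) := Euc n × (Euc n →L[ℝ] ℝ)

variable {n : ℕ} {Q : Type u} [TopologicalSpace Q] [ChartedSpace (Euc n) Q]
  [IsManifold (𝓡 n) ∞ Q]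

/-- The differential of the projection of the cotangent bundle. -/
def dbase (ξ : Cotangent n Q) : CotModel n →L[ℝ] Euc n :=
  mfderiv (cotangentModel n) (𝓡 n) (fun η : Cotangent n Q => η.proj) ξ

theorem hasMFDerivAt_base (ξ : Cotangent n Q) :
    HasMFDerivAt (cotangentModel n) (𝓡 n) (fun η : Cotangent n Q => η.proj) ξ (dbase ξ) :=
  ((contMDiff_base ξ).mdifferentiableAt (by simp)).hasMFDerivAt

/-- The vertical lift, as a linear map. -/
def vert (ξ : Cotangent n Q) : (Euc n →L[ℝ] ℝ) →L[ℝ] CotModel n :=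
  mfderiv 𝓘(ℝ, Euc n →L[ℝ] ℝ) (cotangentModel n) (mkCov ξ.proj) (covec ξ)

namespace TangentEmbedding

variable {V : Type*} [NormedAddCommGroup V] [NormedSpace ℝ V] (T : TangentEmbedding n Q V)

/-- The differential of the embedding of the cotangent bundle in the dual of `V`. -/
def dhat (ξ : Cotangent n Q) : CotModel n →L[ℝ] (V →L[ℝ] ℝ) :=
  mfderiv (cotangentModel n) 𝓘(ℝ, V →L[ℝ] ℝ) T.hat ξ

theorem hasMFDerivAt_hat (ξ : Cotangent n Q) :
    HasMFDerivAt (cotangentModel n) 𝓘(ℝ, V →L[ℝ] ℝ) T.hat ξ (T.dhat ξ) :=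
  ((T.contMDiff_hat ξ).mdifferentiableAt (by simp)).hasMFDerivAt

theorem contMDiff_mkCov (T : TangentEmbedding n Q V) (q : Q) :
    ContMDiff 𝓘(ℝ, Euc n →L[ℝ] ℝ) (cotangentModel n) ∞ (mkCov q : _ → Cotangent n Q) := by
  intro p
  refine ContMDiffWithinAt.contMDiffAt (s := univ) ?_ Filter.univ_mem
  let L : (Euc n →L[ℝ] ℝ) →L[ℝ] (V →L[ℝ] ℝ) := (T.retr q).precomp ℝ
  have h : ContMDiff 𝓘(ℝ, Euc n →L[ℝ] ℝ) 𝓘(ℝ, V →L[ℝ] ℝ) ∞ L := L.contMDiff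
  exact T.contMDiffWithinAt_cotangent_iff.2 ⟨contMDiffWithinAt_const, (h p).contMDiffWithinAt⟩

theorem hasMFDerivAt_mkCov (T : TangentEmbedding n Q V) (ξ : Cotangent n Q) :
    HasMFDerivAt 𝓘(ℝ, Euc n →L[ℝ] ℝ) (cotangentModel n) (mkCov ξ.proj) (covec ξ) (vert ξ) :=
  ((T.contMDiff_mkCov ξ.proj (covec ξ)).mdifferentiableAt (by simp)).hasMFDerivAt

/-- The velocity of a straight line in the fibre is the differential of the inclusion of the fibre;
this makes `verticalLift` linear in the covector. -/
theorem verticalLift_eq_vert (T : TangentEmbedding n Q V) (ξ : Cotangent n Q)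
    (η : Euc n →L[ℝ] ℝ) : verticalLift ξ η = vert ξ η := by
  have h1 : HasMFDerivAt 𝓘(ℝ, ℝ) 𝓘(ℝ, Euc n →L[ℝ] ℝ) (fun t : ℝ => covec ξ + t • η) 0
      (ContinuousLinearMap.toSpanSingleton ℝ η) := by
    have h : HasDerivAt (fun t : ℝ => covec ξ + t • η) ((1 : ℝ) • η) 0 :=
      ((hasDerivAt_id (0 : ℝ)).smul_const η).const_add (covec ξ)
    rw [one_smul] at h
    exact h.hasFDerivAt.hasMFDerivAt
  have h0 : covec ξ + (0 : ℝ) • η = covec ξ := by simp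
  have h2 := HasMFDerivAt.comp (0 : ℝ) (g := (mkCov ξ.proj : _ → Cotangent n Q))
    (g' := vert ξ) (by rw [h0]; exact T.hasMFDerivAt_mkCov ξ) h1
  have h3 := h2.mfderiv
  have h4 : verticalLift ξ η = (vert ξ) ((ContinuousLinearMap.toSpanSingleton ℝ η) (1 : ℝ)) :=
    DFunLike.congr_fun h3 (1 : ℝ)
  rw [h4, ContinuousLinearMap.toSpanSingleton_apply, one_smul]

theorem dbase_vert (T : TangentEmbedding n Q V) (ξ : Cotangent n Q) (η : Euc n →L[ℝ] ℝ) :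
    dbase ξ (vert ξ η) = 0 := by
  have h1 := HasMFDerivAt.comp (covec ξ) (g := fun η : Cotangent n Q => η.proj) (g' := dbase ξ)
    (hasMFDerivAt_base ξ) (T.hasMFDerivAt_mkCov ξ)
  have h2 : HasMFDerivAt 𝓘(ℝ, Euc n →L[ℝ] ℝ) (𝓡 n)
      ((fun η : Cotangent n Q => η.proj) ∘ mkCov ξ.proj) (covec ξ)
      (0 : (Euc n →L[ℝ] ℝ) →L[ℝ] Euc n) := hasMFDerivAt_const ξ.proj (covec ξ)
  exact DFunLike.congr_fun (hasMFDerivAt_unique h1 h2) η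

theorem dhat_vert (ξ : Cotangent n Q) (η : Euc n →L[ℝ] ℝ) :
    T.dhat ξ (vert ξ η) = η ∘L T.retr ξ.proj := by
  have h1 := HasMFDerivAt.comp (covec ξ) (g := T.hat) (g' := T.dhat ξ)
    (T.hasMFDerivAt_hat ξ) (T.hasMFDerivAt_mkCov ξ)
  have h2 : HasMFDerivAt 𝓘(ℝ, Euc n →L[ℝ] ℝ) 𝓘(ℝ, V →L[ℝ] ℝ)
      (T.hat ∘ mkCov ξ.proj) (covec ξ) ((T.retr ξ.proj).precomp ℝ) :=
    ((T.retr ξ.proj).precomp ℝ).hasFDerivAt.hasMFDerivAt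
  exact DFunLike.congr_fun (hasMFDerivAt_unique h1 h2) η

theorem vert_injective (T : TangentEmbedding n Q V) (ξ : Cotangent n Q) :
    Function.Injective (vert ξ) := by
  intro η η' h
  have h1 : η ∘L T.retr ξ.proj = η' ∘L T.retr ξ.proj := by
    rw [← T.dhat_vert ξ η, ← T.dhat_vert ξ η', h]
  ext1 v
  have h2 := DFunLike.congr_fun h1 (T.incl ξ.proj v)
  rwa [ContinuousLinearMap.comp_apply, ContinuousLinearMap.comp_apply, T.retr_incl] at h2

/-- The smooth extension of a covector given by a functional on `V`. -/
def extend (p : V →L[ℝ] ℝ) (q : Q) : Cotangent n Q := mkCov q (p ∘L T.incl q)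

theorem contMDiff_extend (p : V →L[ℝ] ℝ) :
    ContMDiff (𝓡 n) (cotangentModel n) ∞ (T.extend p) := by
  intro q
  refine ContMDiffWithinAt.contMDiffAt (s := univ) ?_ Filter.univ_mem
  refine T.contMDiffWithinAt_cotangent_iff.2 ⟨contMDiffWithinAt_id, ?_⟩
  exact (((contMDiffAt_const (c := p)).clm_comp (T.contMDiff_proj q)).contMDiffWithinAt)

theorem extend_hat (ξ : Cotangent n Q) : T.extend (T.hat ξ) ξ.proj = ξ := by
  have : T.hat ξ ∘L T.incl ξ.proj = covec ξ := by
    ext1 v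
    exact T.hat_incl ξ v
  rw [extend, this]
  rfl

/-- `extend (hat ξ)` is a smooth section through `ξ`, and its differential is a right inverse of
`dbase ξ`. -/
theorem exists_dbase_eq (T : TangentEmbedding n Q V) (ξ : Cotangent n Q) (a : Euc n) :
    ∃ v, dbase ξ v = a := by
  have h1 : HasMFDerivAt (𝓡 n) (cotangentModel n) (T.extend (T.hat ξ)) ξ.proj
      (mfderiv (𝓡 n) (cotangentModel n) (T.extend (T.hat ξ)) ξ.proj) :=
    ((T.contMDiff_extend (T.hat ξ) ξ.proj).mdifferentiableAt (by simp)).hasMFDerivAt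
  have h2 := HasMFDerivAt.comp ξ.proj (g := fun η : Cotangent n Q => η.proj) (g' := dbase ξ)
    (by rw [T.extend_hat]; exact hasMFDerivAt_base ξ) h1
  have h3 : HasMFDerivAt (𝓡 n) (𝓡 n) ((fun η : Cotangent n Q => η.proj) ∘ T.extend (T.hat ξ))
    ξ.proj (ContinuousLinearMap.id ℝ (Euc n)) := hasMFDerivAt_id ξ.proj
  exact ⟨_, DFunLike.congr_fun (hasMFDerivAt_unique h2 h3) a⟩

/-- The vertical lifts form an `n`-dimensional subspace of the kernel of the surjection `dbase ξ`,
whose dimension is also `n`. The covector is then read off with `dhat`. -/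
theorem eq_vert_of_dbase_eq_zero (ξ : Cotangent n Q) {v : CotModel n} (hv : dbase ξ v = 0) :
    v = vert ξ (T.dhat ξ v ∘L T.incl ξ.proj) := by
  have hle : LinearMap.range (vert ξ).toLinearMap ≤ LinearMap.ker (dbase ξ).toLinearMap := by
    rintro _ ⟨η, rfl⟩
    exact T.dbase_vert ξ η
  have hd : Module.finrank ℝ (Euc n →L[ℝ] ℝ) = n := by
    rw [← (LinearMap.toContinuousLinearMap (E := Euc n) (F' := ℝ) (𝕜 := ℝ)).finrank_eq,
      Module.finrank_linearMap]
    simp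
  have hr : Module.finrank ℝ (LinearMap.range (vert ξ).toLinearMap) = n := by
    rw [LinearMap.finrank_range_of_inj (T.vert_injective ξ), hd]
  have hk := LinearMap.finrank_range_add_finrank_ker (dbase ξ).toLinearMap
  rw [LinearMap.range_eq_top.2 (T.exists_dbase_eq ξ), finrank_top, Module.finrank_prod, hd,
    finrank_euclideanSpace_fin] at hk
  have heq := Submodule.eq_of_le_of_finrank_eq hle (by omega)
  have hv' : v ∈ LinearMap.range (vert ξ).toLinearMap := heq ▸ hv
  obtain ⟨η, rfl⟩ := hv'
  have h1 : T.dhat ξ (vert ξ η) ∘L T.incl ξ.proj = η := by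
    rw [T.dhat_vert]
    ext1 w
    exact congrArg η (T.retr_incl ξ.proj w)
  exact (congrArg (vert ξ) h1).symm

theorem continuous_dhat : Continuous fun v : TangentBundle (cotangentModel n) (Cotangent n Q) =>
    T.dhat v.proj v.2 := by
  have h1 : Continuous (tangentMap (cotangentModel n) 𝓘(ℝ, V →L[ℝ] ℝ) T.hat) :=
    T.contMDiff_hat.continuous_tangentMap (by simp)
  exact continuous_snd.comp ((tangentBundleModelSpaceHomeomorph 𝓘(ℝ, V →L[ℝ] ℝ)).continuous.comp h1)

end TangentEmbedding

/-- The differential of the projection of the cotangent bundle, as a map of tangent bundles. -/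
def dbaseTotal (v : TangentBundle (cotangentModel n) (Cotangent n Q)) : TangentBundle (𝓡 n) Q :=
  ⟨v.proj.proj, dbase v.proj v.2⟩

theorem continuous_dbaseTotal : Continuous (dbaseTotal (n := n) (Q := Q)) :=
  contMDiff_base.continuous_tangentMap (by simp)

end Vertical

/-! ### Parametrized tangent spaces as operators into `V` -/

section Frame

variable {n k : ℕ} {Q : Type u} [TopologicalSpace Q] [ChartedSpace (Euc n) Q]
  [IsManifold (𝓡 n) ∞ Q] {V : Type*} [NormedAddCommGroup V] [NormedSpace ℝ V]
  (T : TangentEmbedding n Q V) {K : Set Q} (p : LocalParam (𝓡 n) K k)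

/-- The domain is finite-dimensional, so the operator is a finite sum of its values on a basis times
coordinate functionals. -/
theorem contMDiffOn_clm_of_apply {F : Type*} [NormedAddCommGroup F] [NormedSpace ℝ F] {H : Type*}
    [TopologicalSpace H] {J : ModelWithCorners ℝ F H} {X : Type*} [TopologicalSpace X]
    [ChartedSpace H X] {a : X → Euc k →L[ℝ] V} {s : Set X}
    (h : ∀ w, ContMDiffOn J 𝓘(ℝ, V) ∞ (fun x => a x w) s) :
    ContMDiffOn J 𝓘(ℝ, Euc k →L[ℝ] V) ∞ a s := by
  let L : Fin k → V →L[ℝ] (Euc k →L[ℝ] V) := fun j =>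
    ContinuousLinearMap.smulRightL ℝ (Euc k) V (EuclideanSpace.proj j)
  have h1 : ContMDiffOn J 𝓘(ℝ, Euc k →L[ℝ] V) ∞
      (fun x => ∑ j, L j (a x (EuclideanSpace.single j 1))) s :=
    contMDiffOn_finsetSum fun j _ => (L j).contMDiff.comp_contMDiffOn (h _)
  refine h1.congr fun x _ => ?_
  ext1 w
  have h2 : w = ∑ j, w j • EuclideanSpace.single j (1 : ℝ) := by
    ext i
    simp [Finset.sum_apply, Pi.single_apply]
  rw [sum_apply]
  conv_lhs => rw [h2, map_sum]
  refine Finset.sum_congr rfl fun j _ => ?_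
  rw [map_smul]
  rfl

/-- The differential of `f` along a parametrized submanifold, with values in `V`. -/
def TangentEmbedding.frame (f : Q → Q) (b : Euc k) : Euc k →L[ℝ] V :=
  T.incl (f (p.param b)) ∘L (mfderiv (𝓡 k) (𝓡 n) (f ∘ p.param) b : Euc k →L[ℝ] Euc n)

/-- For fixed `w`, the total differential of the family is evaluated on the smooth field `(0, w)`,
and the result is included in `V`. -/
theorem TangentEmbedding.contMDiffOn_frame {S : Set ℝ} (hS : UniqueDiffOn ℝ S) {f : ℝ → Q → Q}
    (hf : ContMDiffOn (𝓘(ℝ, ℝ).prod (𝓡 n)) (𝓡 n) ∞ (fun z : ℝ × Q => f z.1 z.2) (S ×ˢ K)) :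
    ContMDiffOn (𝓘(ℝ, ℝ).prod (𝓡 k)) 𝓘(ℝ, Euc k →L[ℝ] V) ∞
      (fun z : ℝ × Euc k => T.frame p (f z.1) z.2) (S ×ˢ p.B) := by
  refine contMDiffOn_clm_of_apply fun w => ?_
  have hfp := p.contMDiffOn_family hf
  have hu : UniqueMDiffOn (𝓘(ℝ, ℝ).prod (𝓡 k)) (S ×ˢ p.B) :=
    (uniqueMDiffOn_iff_uniqueDiffOn.2 hS).prod p.isOpen_B.uniqueMDiffOn
  have h1 := hfp.contMDiffOn_tangentMapWithin (m := ∞) (by simp) hu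
  have h2 : ContMDiff (𝓘(ℝ, ℝ).prod (𝓡 k)) (𝓘(ℝ, ℝ).prod (𝓡 k)).tangent ∞
      (fun z : ℝ × Euc k =>
        (⟨z, ((0, w) : ℝ × Euc k)⟩ : TangentBundle (𝓘(ℝ, ℝ).prod (𝓡 k)) (ℝ × Euc k))) := by
    have h3 : ContMDiff 𝓘(ℝ, ℝ) 𝓘(ℝ, ℝ).tangent ∞
        (fun t : ℝ => (⟨t, (0 : ℝ)⟩ : TangentBundle 𝓘(ℝ, ℝ) ℝ)) :=
      contMDiff_vectorSpace_iff_contDiff.2 contDiff_const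
    have h4 : ContMDiff (𝓡 k) (𝓡 k).tangent ∞
        (fun b : Euc k => (⟨b, w⟩ : TangentBundle (𝓡 k) (Euc k))) :=
      contMDiff_vectorSpace_iff_contDiff.2 contDiff_const
    exact (contMDiff_equivTangentBundleProd_symm (I := 𝓘(ℝ, ℝ)) (M := ℝ) (I' := 𝓡 k)
      (M' := Euc k) (n := ∞)).comp ((h3.comp contMDiff_fst).prodMk (h4.comp contMDiff_snd))
  have h5 := T.contMDiff_total.comp_contMDiffOn (h1.comp h2.contMDiffOn fun z hz => hz)
  refine h5.congr ?_
  rintro ⟨t, b⟩ ⟨ht, hb⟩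
  have h6 := mfderivWithin_family (G := fun t b => f t (p.param b)) p.isOpen_B hfp ht hb w
  exact congrArg (T.incl (f t (p.param b))) h6.symm

theorem TangentEmbedding.contMDiffOn_frame_id :
    ContMDiffOn (𝓡 k) 𝓘(ℝ, Euc k →L[ℝ] V) ∞ (fun b => T.frame p id b) p.B := by
  have h := T.contMDiffOn_frame p (S := univ) uniqueDiffOn_univ (f := fun _ => id)
    (contMDiff_snd.contMDiffOn)
  exact h.comp (f := fun b : Euc k => ((0 : ℝ), b)) (contMDiff_const.prodMk contMDiff_id).contMDiffOn
    fun b hb => ⟨mem_univ _, hb⟩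

theorem TangentEmbedding.frame_id_apply (b w : Euc k) :
    T.frame p id b w = T.incl (p.param b) (mfderiv (𝓡 k) (𝓡 n) p.param b w) := rfl

theorem TangentEmbedding.frame_apply {f : Q → Q} {b : Euc k} (hb : b ∈ p.B)
    (hf : MDifferentiableWithinAt (𝓡 n) (𝓡 n) f K (p.param b)) (w : Euc k) :
    T.frame p f b w = T.incl (f (p.param b))
      ((mfderivWithin (𝓡 n) (𝓡 n) f K (p.param b) : Euc n →L[ℝ] Euc n)
        (mfderiv (𝓡 k) (𝓡 n) p.param b w)) :=
  congrArg (T.incl (f (p.param b))) (p.mfderivWithin_mfderiv_param hb hf w).symm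

end Frame

/-! ### Conormal and unit conormal bundles as submanifolds -/

section Conormal

variable {n : ℕ} {Q : Type u} [TopologicalSpace Q] [ChartedSpace (Euc n) Q]
  [IsManifold (𝓡 n) ∞ Q] {V : Type*} [NormedAddCommGroup V] [NormedSpace ℝ V]
  (T : TangentEmbedding n Q V) {K : Set Q} {k : ℕ}

/-- The tangent space of `K` at `q`, as a subspace of the model space. -/
def tanE (n : ℕ) {Q : Type u} [TopologicalSpace Q] [ChartedSpace (Euc n) Q]
    (K : Set Q) (q : Q) : Submodule ℝ (Euc n) := tangentSpaceOf (𝓡 n) K q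

theorem LocalParam.exists_mfderiv_param_eq (p : LocalParam (𝓡 n) K k) {b : Euc k} (hb : b ∈ p.B)
    {v : Euc n} (hv : v ∈ tanE n K (p.param b)) :
    ∃ w : Euc k, (mfderiv (𝓡 k) (𝓡 n) p.param b : Euc k →L[ℝ] Euc n) w = v :=
  ⟨_, p.mfderiv_param_mfderiv_coord hb hv⟩

/-- This replaces the conormal condition, which involves a tangent space varying with `q`, by the
vanishing of a functional on the fixed space `Euc k`. Together with the equations of `K` it cuts out
the conormal bundle. -/
theorem TangentEmbedding.comp_frame_eq_zero_iff (p : LocalParam (𝓡 n) K k) {q : Q}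
    (hq : q ∈ K) (hqU : q ∈ p.U) (η : Euc n →L[ℝ] ℝ) :
    (η ∘L T.retr q) ∘L T.frame p id (p.coord q) = 0 ↔ ∀ v ∈ tanE n K q, η v = 0 := by
  obtain ⟨b, hb, rfl⟩ := p.exists_eq_param hq hqU
  rw [p.coord_param b hb]
  have key : ∀ w, ((η ∘L T.retr (p.param b)) ∘L T.frame p id b) w =
      η ((mfderiv (𝓡 k) (𝓡 n) p.param b : Euc k →L[ℝ] Euc n) w) := fun w =>
    congrArg η (T.retr_incl _ _)
  constructor
  · intro h v hv
    obtain ⟨w, rfl⟩ := p.exists_mfderiv_param_eq hb hv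
    rw [← key w, h]
    rfl
  · intro h
    ext1 w
    exact (key w).trans (h _ (p.mfderiv_param_mem hb w))

/-- Near each of its points, the conormal bundle is a regular level set; a vertical tangent vector
is tangent to it if it is given by a conormal covector. -/
theorem TangentEmbedding.exists_conormal_levelSet (T : TangentEmbedding n Q V)
    (hK : IsSubmanifold (𝓡 n) k K)
    {ξ : Cotangent n Q} (hξ : ξ ∈ conormalBundle K) :
    ∃ (c : ℕ) (O : Set (Cotangent n Q)) (h : Cotangent n Q → Euc c × (Euc k →L[ℝ] ℝ))
      (D : CotModel n →L[ℝ] Euc c × (Euc k →L[ℝ] ℝ)),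
      c + k = n ∧ IsOpen O ∧ ξ ∈ O ∧
      ContMDiffOn (cotangentModel n) 𝓘(ℝ, Euc c × (Euc k →L[ℝ] ℝ)) ∞ h O ∧
      HasMFDerivAt (cotangentModel n) 𝓘(ℝ, Euc c × (Euc k →L[ℝ] ℝ)) h ξ D ∧
      Function.Surjective D ∧
      conormalBundle K ∩ O = {η ∈ O | h η = 0} ∧
      ∀ η : Euc n →L[ℝ] ℝ, (∀ v ∈ tanE n K ξ.proj, η v = 0) ↔ D (vert ξ η) = 0 := by
  obtain ⟨c, U, h, hc, hU, hxU, hh, hs, he⟩ := hK ξ.proj hξ.1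
  obtain ⟨p, hp⟩ := hK.exists_localParam hξ.1
  have hπ : Continuous (fun η : Cotangent n Q => η.proj) := contMDiff_base.continuous
  let W := U ∩ p.U
  let O : Set (Cotangent n Q) := (fun η => η.proj) ⁻¹' W
  have hO : IsOpen O := (hU.inter p.isOpen_U).preimage hπ
  have hξO : ξ ∈ O := ⟨hxU, hp⟩
  have ha : ContMDiffOn (𝓡 n) 𝓘(ℝ, Euc k →L[ℝ] V) ∞ (fun q => T.frame p id (p.coord q)) W :=
    (T.contMDiffOn_frame_id p).comp (p.smooth_coord.mono inter_subset_right)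
      fun q hq => p.coord_mem q hq.2
  have h1 : ContMDiffOn (cotangentModel n) 𝓘(ℝ, Euc c) ∞ (fun η => h η.proj) O :=
    (hh.mono inter_subset_left).comp contMDiff_base.contMDiffOn fun η hη => hη
  have h2 : ContMDiffOn (cotangentModel n) 𝓘(ℝ, Euc k →L[ℝ] ℝ) ∞
      (fun η => T.hat η ∘L T.frame p id (p.coord η.proj)) O :=
    T.contMDiff_hat.contMDiffOn.clm_comp (ha.comp contMDiff_base.contMDiffOn fun η hη => hη)
  have hdh : HasMFDerivAt (𝓡 n) 𝓘(ℝ, Euc c) h ξ.proj (mfderiv (𝓡 n) 𝓘(ℝ, Euc c) h ξ.proj) :=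
    (((hh _ hxU).contMDiffAt (hU.mem_nhds hxU)).mdifferentiableAt (by simp)).hasMFDerivAt
  set Dh : Euc n →L[ℝ] Euc c := mfderiv (𝓡 n) 𝓘(ℝ, Euc c) h ξ.proj with hDh
  have hd1 : HasMFDerivAt (cotangentModel n) 𝓘(ℝ, Euc c) (fun η => h η.proj) ξ (Dh ∘L dbase ξ) :=
    hdh.comp ξ (hasMFDerivAt_base ξ)
  let D2 : CotModel n →L[ℝ] (Euc k →L[ℝ] ℝ) := mfderiv (cotangentModel n) 𝓘(ℝ, Euc k →L[ℝ] ℝ)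
    (fun η => T.hat η ∘L T.frame p id (p.coord η.proj)) ξ
  have hd2 : HasMFDerivAt (cotangentModel n) 𝓘(ℝ, Euc k →L[ℝ] ℝ)
      (fun η => T.hat η ∘L T.frame p id (p.coord η.proj)) ξ D2 :=
    (((h2 _ hξO).contMDiffAt (hO.mem_nhds hξO)).mdifferentiableAt (by simp)).hasMFDerivAt
  have hD2 : ∀ η : Euc n →L[ℝ] ℝ,
      D2 (vert ξ η) = (η ∘L T.retr ξ.proj) ∘L T.frame p id (p.coord ξ.proj) := by
    intro η
    have e1 := HasMFDerivAt.comp (covec ξ) (g' := D2) (f := mkCov ξ.proj) hd2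
      (T.hasMFDerivAt_mkCov ξ)
    let L : (Euc n →L[ℝ] ℝ) →L[ℝ] (Euc k →L[ℝ] ℝ) :=
      (T.retr ξ.proj ∘L T.frame p id (p.coord ξ.proj)).precomp ℝ
    have e2 : HasMFDerivAt 𝓘(ℝ, Euc n →L[ℝ] ℝ) 𝓘(ℝ, Euc k →L[ℝ] ℝ)
        ((fun η : Cotangent n Q => T.hat η ∘L T.frame p id (p.coord η.proj)) ∘ mkCov ξ.proj)
        (covec ξ) L := L.hasFDerivAt.hasMFDerivAt
    exact DFunLike.congr_fun (hasMFDerivAt_unique e1 e2) η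
  have hd := hd1.prodMk_vectorSpace hd2
  refine ⟨c, O, fun η => (h η.proj, T.hat η ∘L T.frame p id (p.coord η.proj)),
    (Dh ∘L dbase ξ).prod D2, by simpa using hc, hO, hξO, h1.prodMk_space h2, hd, ?_, ?_, ?_⟩
  · rintro ⟨y, l⟩
    obtain ⟨v₀, hv₀⟩ := hs y
    obtain ⟨v₁, hv₁⟩ := T.exists_dbase_eq ξ v₀
    have hb := p.coord_mem _ hp
    let C : Euc n →L[ℝ] Euc k := mfderiv (𝓡 n) (𝓡 k) p.coord (p.param (p.coord ξ.proj))
    let η : Euc n →L[ℝ] ℝ := (l - D2 v₁) ∘L C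
    refine ⟨v₁ + vert ξ η, ?_⟩
    have e1 : D2 (vert ξ η) = l - D2 v₁ := by
      rw [hD2]
      ext1 w
      have e0 := p.mfderiv_coord_mfderiv_param hb w
      have e2 : T.retr ξ.proj (T.frame p id (p.coord ξ.proj) w) =
          (mfderiv (𝓡 k) (𝓡 n) p.param (p.coord ξ.proj) : Euc k →L[ℝ] Euc n) w := by
        rw [T.frame_id_apply, p.param_coord _ hξ.1 hp]
        exact T.retr_incl _ _
      change (l - D2 v₁) (C (T.retr ξ.proj (T.frame p id (p.coord ξ.proj) w))) = (l - D2 v₁) w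
      rw [e2]
      exact congrArg (l - D2 v₁) e0
    rw [ContinuousLinearMap.prod_apply, map_add, map_add, e1, ContinuousLinearMap.comp_apply,
      ContinuousLinearMap.comp_apply, T.dbase_vert, hv₁, map_zero, add_zero, add_sub_cancel]
    exact congrArg (fun z => (z, l)) hv₀
  · ext η
    constructor
    · rintro ⟨hη, hηO⟩
      refine ⟨hηO, ?_⟩
      have e1 : η.proj ∈ {y ∈ U | h y = 0} := he ▸ ⟨hη.1, hηO.1⟩
      exact Prod.ext e1.2 ((T.comp_frame_eq_zero_iff p hη.1 hηO.2 (covec η)).2 hη.2)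
    · rintro ⟨hηO, hη⟩
      have e1 : η.proj ∈ K ∩ U := he ▸ ⟨hηO.1, congrArg Prod.fst hη⟩
      exact ⟨⟨e1.1, (T.comp_frame_eq_zero_iff p e1.1 hηO.2 (covec η)).1
        (congrArg Prod.snd hη)⟩, hηO⟩
  · intro η
    rw [ContinuousLinearMap.prod_apply, hD2, ContinuousLinearMap.comp_apply, T.dbase_vert,
      map_zero, Prod.mk_eq_zero, ← T.comp_frame_eq_zero_iff p hξ.1 hp]
    simp

theorem finrank_dual_euc (k : ℕ) : Module.finrank ℝ (Euc k →L[ℝ] ℝ) = k := by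
  rw [← (LinearMap.toContinuousLinearMap (E := Euc k) (F' := ℝ) (𝕜 := ℝ)).finrank_eq,
    Module.finrank_linearMap]
  simp

/-- The tangent space of a subset of the cotangent bundle, as a subspace of the model space. -/
def tanC (n : ℕ) {Q : Type u} [TopologicalSpace Q] [ChartedSpace (Euc n) Q]
    [IsManifold (𝓡 n) ∞ Q] (L : Set (Cotangent n Q)) (ξ : Cotangent n Q) :
    Submodule ℝ (CotModel n) := tangentSpaceOf (cotangentModel n) L ξ

theorem TangentEmbedding.isSubmanifold_conormalBundle (T : TangentEmbedding n Q V)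
    (hK : IsSubmanifold (𝓡 n) k K) :
    IsSubmanifold (cotangentModel n) n (conormalBundle K : Set (Cotangent n Q)) := by
  intro ξ hξ
  obtain ⟨c, O, h, D, hc, hO, hξO, hh, hD, hs, he, -⟩ := T.exists_conormal_levelSet hK hξ
  refine isSubmanifold_of_levelSet ?_ hO hξO hh (by rw [hD.mfderiv]; exact hs) he
  rw [Module.finrank_prod, Module.finrank_prod, finrank_dual_euc, finrank_dual_euc]
  simp
  omega

theorem dbase_mem_tanE {ξ : Cotangent n Q} {v : CotModel n}
    (hv : v ∈ tanC n (conormalBundle K) ξ) : dbase ξ v ∈ tanE n K ξ.proj :=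
  (hasMFDerivAt_base ξ).hasMFDerivWithinAt.mem_tangentSpaceOf
    (Filter.Eventually.of_forall fun _ hη => hη.1) hv

theorem TangentEmbedding.vert_mem_tanC_iff (T : TangentEmbedding n Q V)
    (hK : IsSubmanifold (𝓡 n) k K) {ξ : Cotangent n Q} (hξ : ξ ∈ conormalBundle K)
    (η : Euc n →L[ℝ] ℝ) :
    vert ξ η ∈ tanC n (conormalBundle K) ξ ↔ ∀ v ∈ tanE n K ξ.proj, η v = 0 := by
  obtain ⟨c, O, h, D, hc, hO, hξO, hh, hD, hs, he, hη⟩ := T.exists_conormal_levelSet hK hξ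
  rw [hη]
  have h1 := tangentSpaceOf_eq_ker (k := n) (by
    rw [Module.finrank_prod, Module.finrank_prod, finrank_dual_euc, finrank_dual_euc]
    simp
    omega) hO hξO hh (by rw [hD.mfderiv]; exact hs) he hξ (vert ξ η)
  rw [hD.mfderiv] at h1
  exact h1

variable (g : RiemMetric n Q)

/-- The differential of the square of the norm. -/
def dnormSq (ξ : Cotangent n Q) : CotModel n →L[ℝ] ℝ :=
  mfderiv (cotangentModel n) 𝓘(ℝ, ℝ) (normSq g) ξ

theorem TangentEmbedding.hasMFDerivAt_normSq (T : TangentEmbedding n Q V) (ξ : Cotangent n Q) :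
    HasMFDerivAt (cotangentModel n) 𝓘(ℝ, ℝ) (normSq g) ξ (dnormSq g ξ) :=
  ((T.contMDiff_normSq g ξ).mdifferentiableAt (by simp)).hasMFDerivAt

/-- Euler's identity for a function that is quadratic on the fibres. It makes the radial vector
transverse to the unit sphere bundle. -/
theorem TangentEmbedding.dnormSq_vert_self (T : TangentEmbedding n Q V) (ξ : Cotangent n Q) :
    dnormSq g ξ (vert ξ (covec ξ)) = 2 * normSq g ξ := by
  let c : ℝ → Euc n →L[ℝ] ℝ := fun t => t • covec ξ
  have hc1 : c 1 = covec ξ := one_smul _ _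
  have h1 : HasMFDerivAt 𝓘(ℝ, ℝ) 𝓘(ℝ, Euc n →L[ℝ] ℝ) c 1
      (ContinuousLinearMap.toSpanSingleton ℝ (covec ξ)) := by
    have h : HasDerivAt c ((1 : ℝ) • covec ξ) 1 := (hasDerivAt_id (1 : ℝ)).smul_const (covec ξ)
    rw [one_smul] at h
    exact h.hasFDerivAt.hasMFDerivAt
  have h2 := HasMFDerivAt.comp (1 : ℝ) (g := (mkCov ξ.proj : _ → Cotangent n Q))
    (g' := vert ξ) (by rw [hc1]; exact T.hasMFDerivAt_mkCov ξ) h1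
  have h3 := HasMFDerivAt.comp (1 : ℝ) (g := normSq g) (g' := dnormSq g ξ)
    (f := mkCov ξ.proj ∘ c) (by
      rw [Function.comp_apply, hc1]; exact T.hasMFDerivAt_normSq g ξ) h2
  have h4 : HasMFDerivAt 𝓘(ℝ, ℝ) 𝓘(ℝ, ℝ) (normSq g ∘ mkCov ξ.proj ∘ c) 1
      (ContinuousLinearMap.toSpanSingleton ℝ (2 * normSq g ξ)) := by
    have h5 : normSq g ∘ mkCov ξ.proj ∘ c = fun t => t ^ 2 * normSq g ξ :=
      funext fun t => normSq_mkCov_smul g ξ.proj t (covec ξ)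
    have h6 : HasDerivAt (fun t : ℝ => t ^ 2 * normSq g ξ) (2 * normSq g ξ) 1 := by
      simpa using (hasDerivAt_pow 2 (1 : ℝ)).mul_const (normSq g ξ)
    rw [h5]
    exact h6.hasFDerivAt.hasMFDerivAt
  have h7 := DFunLike.congr_fun (hasMFDerivAt_unique h3 h4) (1 : ℝ)
  have h8 : dnormSq g ξ (vert ξ (ContinuousLinearMap.toSpanSingleton ℝ (covec ξ) (1 : ℝ))) =
    ContinuousLinearMap.toSpanSingleton ℝ (2 * normSq g ξ) (1 : ℝ) := h7
  rw [ContinuousLinearMap.toSpanSingleton_apply, ContinuousLinearMap.toSpanSingleton_apply,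
    one_smul, one_smul] at h8
  exact h8

theorem mem_unitConormalBundle_iff (ξ : Cotangent n Q) :
    ξ ∈ unitConormalBundle g K ↔ ξ ∈ conormalBundle K ∧ normSq g ξ = 1 :=
  and_congr_right fun _ => mem_unitCotangent_iff g ξ

/-- Near each of its points, the unit conormal bundle is a regular level set. -/
theorem TangentEmbedding.exists_unitConormal_levelSet (T : TangentEmbedding n Q V)
    (hK : IsSubmanifold (𝓡 n) k K) {ξ : Cotangent n Q} (hξ : ξ ∈ unitConormalBundle g K) :
    ∃ (c : ℕ) (O : Set (Cotangent n Q)) (h : Cotangent n Q → (Euc c × (Euc k →L[ℝ] ℝ)) × ℝ)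
      (D : CotModel n →L[ℝ] Euc c × (Euc k →L[ℝ] ℝ)),
      c + k = n ∧ IsOpen O ∧ ξ ∈ O ∧
      ContMDiffOn (cotangentModel n) 𝓘(ℝ, (Euc c × (Euc k →L[ℝ] ℝ)) × ℝ) ∞ h O ∧
      HasMFDerivAt (cotangentModel n) 𝓘(ℝ, (Euc c × (Euc k →L[ℝ] ℝ)) × ℝ) h ξ
        (D.prod (dnormSq g ξ)) ∧
      Function.Surjective (D.prod (dnormSq g ξ)) ∧
      unitConormalBundle g K ∩ O = {η ∈ O | h η = 0} ∧
      ∀ v, v ∈ tanC n (conormalBundle K) ξ ↔ D v = 0 := by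
  rw [mem_unitConormalBundle_iff] at hξ
  obtain ⟨c, O, h, D, hc, hO, hξO, hh, hD, hs, he, hη⟩ := T.exists_conormal_levelSet hK hξ.1
  have hn1 : HasMFDerivAt (cotangentModel n) 𝓘(ℝ, ℝ) (fun η => normSq g η - 1) ξ
      (dnormSq g ξ) := by
    exact ((T.hasMFDerivAt_normSq g ξ).sub (hasMFDerivAt_const (1 : ℝ) ξ)).congr_mfderiv
      (sub_zero (dnormSq g ξ))
  refine ⟨c, O, fun η => (h η, normSq g η - 1), D, hc, hO, hξO,
    hh.prodMk_space ((T.contMDiff_normSq g).contMDiffOn.sub contMDiffOn_const),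
    hD.prodMk_vectorSpace hn1, ?_, ?_, ?_⟩
  · rintro ⟨w, s⟩
    obtain ⟨v, hv⟩ := hs w
    have h0 : D (vert ξ (covec ξ)) = 0 := (hη _).1 hξ.1.2
    -- The radial vector is tangent to the conormal bundle, so it changes the norm component alone;
    -- the `2` is its value under `dnormSq` at a unit covector.
    refine ⟨v + ((s - dnormSq g ξ v) / 2) • vert ξ (covec ξ), ?_⟩
    rw [ContinuousLinearMap.prod_apply, map_add, map_add, map_smul, map_smul, h0, hv,
      T.dnormSq_vert_self, hξ.2]
    simp
  · ext η
    rw [mem_inter_iff, mem_unitConormalBundle_iff, mem_ofPred_eq, Prod.mk_eq_zero, sub_eq_zero]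
    constructor
    · rintro ⟨⟨h1, h2⟩, h3⟩
      have h4 : η ∈ {η ∈ O | h η = 0} := he ▸ ⟨h1, h3⟩
      exact ⟨h3, h4.2, h2⟩
    · rintro ⟨h3, h4, h2⟩
      have h5 : η ∈ conormalBundle K ∩ O := he ▸ ⟨h3, h4⟩
      exact ⟨⟨h5.1, h2⟩, h3⟩
  · intro v
    have h1 := tangentSpaceOf_eq_ker (k := n) (by
      rw [Module.finrank_prod, Module.finrank_prod, finrank_dual_euc, finrank_dual_euc]
      simp
      omega) hO hξO hh (by rw [hD.mfderiv]; exact hs) he hξ.1 v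
    rw [hD.mfderiv] at h1
    exact h1

end Conormal

section UnitConormal

variable {m : ℕ} {Q : Type u} [TopologicalSpace Q] [ChartedSpace (Euc (m + 1)) Q]
  [IsManifold (𝓡 (m + 1)) ∞ Q] {V : Type*} [NormedAddCommGroup V] [NormedSpace ℝ V]
  {K : Set Q} {k : ℕ} (g : RiemMetric (m + 1) Q)

theorem TangentEmbedding.isSubmanifold_unitConormalBundle (T : TangentEmbedding (m + 1) Q V)
    (hK : IsSubmanifold (𝓡 (m + 1)) k K) :
    IsSubmanifold (cotangentModel (m + 1)) m (unitConormalBundle g K) := by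
  intro ξ hξ
  obtain ⟨c, O, h, D, hc, hO, hξO, hh, hD, hs, he, -⟩ := T.exists_unitConormal_levelSet g hK hξ
  refine isSubmanifold_of_levelSet ?_ hO hξO hh (by rw [hD.mfderiv]; exact hs) he
  rw [Module.finrank_prod, Module.finrank_prod, Module.finrank_prod, finrank_dual_euc,
    finrank_dual_euc]
  simp
  omega

theorem TangentEmbedding.mem_tanC_unitConormalBundle_iff (T : TangentEmbedding (m + 1) Q V)
    (hK : IsSubmanifold (𝓡 (m + 1)) k K) {ξ : Cotangent (m + 1) Q}
    (hξ : ξ ∈ unitConormalBundle g K) (v : CotModel (m + 1)) :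
    v ∈ tanC (m + 1) (unitConormalBundle g K) ξ ↔
      v ∈ tanC (m + 1) (conormalBundle K) ξ ∧ dnormSq g ξ v = 0 := by
  obtain ⟨c, O, h, D, hc, hO, hξO, hh, hD, hs, he, hη⟩ := T.exists_unitConormal_levelSet g hK hξ
  have h1 := tangentSpaceOf_eq_ker (k := m) (by
    rw [Module.finrank_prod, Module.finrank_prod, Module.finrank_prod, finrank_dual_euc,
      finrank_dual_euc]
    simp
    omega) hO hξO hh (by rw [hD.mfderiv]; exact hs) he hξ v
  rw [hD.mfderiv] at h1
  rw [hη, ← Prod.mk_eq_zero]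
  exact h1

/-- A tangent vector projects to a vector tangent to `K`, which the conormal covector annihilates.
-/
theorem TangentEmbedding.isLegendrian_unitConormalBundle (T : TangentEmbedding (m + 1) Q V)
    (hK : IsSubmanifold (𝓡 (m + 1)) k K) : IsLegendrian g (unitConormalBundle g K) where
  subset := inter_subset_right
  isSubmanifold := T.isSubmanifold_unitConormalBundle g hK
  liouville := fun _ hξ _ hv => hξ.1.2 _ (dbase_mem_tanE (tangentSpaceOf_mono inter_subset_left _ hv))

end UnitConormal

/-! ### Projections to the tangent spaces of moving submanifolds -/

section Transfer

variable {V F F' : Type*} [NormedAddCommGroup V] [NormedSpace ℝ V] [NormedAddCommGroup F]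
  [NormedSpace ℝ F] [FiniteDimensional ℝ F] [NormedAddCommGroup F'] [NormedSpace ℝ F']
  [FiniteDimensional ℝ F']

/-- `transfer` does not depend on the parametrization. -/
theorem transfer_eq_transfer {G : V →L[ℝ] V →L[ℝ] ℝ} {a b : F →L[ℝ] V} {a' b' : F' →L[ℝ] V}
    (h : ∀ u, u ≠ 0 → G (a u) (a u) ≠ 0) (h' : ∀ u, u ≠ 0 → G (a' u) (a' u) ≠ 0)
    (h1 : ∀ u, ∃ u', a' u' = a u ∧ b' u' = b u) (h2 : ∀ u', ∃ u, a u = a' u' ∧ b u = b' u') :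
    transfer G a b = transfer G a' b' := by
  refine eq_transfer h' (fun u' => ?_) fun w hw => ?_
  · obtain ⟨u, e1, e2⟩ := h2 u'
    rw [← e1, ← e2, transfer_apply_self h]
  · refine transfer_apply_eq_zero h _ fun u => ?_
    obtain ⟨u', e1, -⟩ := h1 u
    rw [← e1, hw]

end Transfer

section Projection

variable {n k : ℕ} {Q : Type u} [TopologicalSpace Q] [ChartedSpace (Euc n) Q]
  [IsManifold (𝓡 n) ∞ Q] {V : Type*} [NormedAddCommGroup V] [NormedSpace ℝ V]
  (T : TangentEmbedding n Q V) (g : RiemMetric n Q) {K K' : Set Q}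

namespace TangentEmbedding

theorem metric_incl_comp_ne {F : Type*} [NormedAddCommGroup F] [NormedSpace ℝ F] (q : Q)
    {a : F →L[ℝ] Euc n} (ha : Function.Injective a) (u : F) (hu : u ≠ 0) :
    T.metric g q ((T.incl q ∘L a) u) ((T.incl q ∘L a) u) ≠ 0 := by
  rw [ContinuousLinearMap.comp_apply, T.metric_incl]
  exact (gE_pos g q fun h => hu (ha (h.trans (map_zero a).symm))).ne'

/-- The orthogonal projection to the tangent space of `K`, in `V`. -/
def tangentProj (K : Set Q) (q : Q) : V →L[ℝ] V :=
  transfer (T.metric g q) (T.incl q ∘L (tanE n K q).subtypeL) (T.incl q ∘L (tanE n K q).subtypeL)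

theorem exists_tangentProj_eq (q : Q) (w : V) :
    ∃ v ∈ tanE n K q, T.tangentProj g K q w = T.incl q v := ⟨_, Subtype.prop _, rfl⟩

theorem proj_tangentProj (q : Q) (w : V) :
    T.proj q (T.tangentProj g K q w) = T.tangentProj g K q w := by
  obtain ⟨v, -, hv⟩ := T.exists_tangentProj_eq g (K := K) q w
  rw [hv, T.proj_incl]

theorem tangentProj_eq_zero {q : Q} {w : V} (hw : ∀ v ∈ tanE n K q, gE g q (T.retr q w) v = 0) :
    T.tangentProj g K q w = 0 := by
  refine transfer_apply_eq_zero (T.metric_incl_comp_ne g q Subtype.val_injective) _ fun u => ?_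
  rw [metric_apply, ContinuousLinearMap.comp_apply, T.retr_incl]
  exact hw _ u.2

theorem gE_tangentProj {q : Q} (w : V) {v : Euc n} (hv : v ∈ tanE n K q) :
    gE g q (T.retr q (T.tangentProj g K q w)) v = gE g q (T.retr q w) v := by
  have h := apply_transfer_self (T.metric_incl_comp_ne g q
    (a := (tanE n K q).subtypeL) Subtype.val_injective) w ⟨v, hv⟩
  rw [metric_apply, metric_apply, ContinuousLinearMap.comp_apply, T.retr_incl] at h
  exact h

/-- The differential of `f` on the tangent space of `K`, with values in `V`. -/
def diffHat (K : Set Q) (f : Q → Q) (x : Q) : tanE n K x →L[ℝ] V :=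
  T.incl (f x) ∘L ((mfderivWithin (𝓡 n) (𝓡 n) f K x : Euc n →L[ℝ] Euc n) ∘L (tanE n K x).subtypeL)

/-- The map that is given by the differentials of `f` and `f'` on the tangent space of the image of
`f`, and is zero on its orthogonal complement. -/
def imageTransfer (K : Set Q) (f f' : Q → Q) (x : Q) : V →L[ℝ] V :=
  transfer (T.metric g (f x)) (T.diffHat K f x) (T.diffHat K f' x)

theorem metric_diffHat_ne {f : Q → Q} {x : Q}
    (hi : InjOn (mfderivWithin (𝓡 n) (𝓡 n) f K x) (tangentSpaceOf (𝓡 n) K x))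
    (u : tanE n K x) (hu : u ≠ 0) :
    T.metric g (f x) (T.diffHat K f x u) (T.diffHat K f x u) ≠ 0 :=
  T.metric_incl_comp_ne g (f x)
    (a := (mfderivWithin (𝓡 n) (𝓡 n) f K x : Euc n →L[ℝ] Euc n) ∘L (tanE n K x).subtypeL)
    (fun u u' h => Subtype.ext (hi u.2 u'.2 h)) u hu

theorem imageTransfer_apply {f : Q → Q} {x : Q}
    (hi : InjOn (mfderivWithin (𝓡 n) (𝓡 n) f K x) (tangentSpaceOf (𝓡 n) K x))
    (f' : Q → Q) {v : Euc n} (hv : v ∈ tanE n K x) :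
    T.imageTransfer g K f f' x
      (T.incl (f x) ((mfderivWithin (𝓡 n) (𝓡 n) f K x : Euc n →L[ℝ] Euc n) v)) =
      T.incl (f' x) ((mfderivWithin (𝓡 n) (𝓡 n) f' K x : Euc n →L[ℝ] Euc n) v) :=
  transfer_apply_self (T.metric_diffHat_ne g hi) (T.diffHat K f' x) ⟨v, hv⟩

theorem imageTransfer_proj (f f' : Q → Q) (x : Q) (w : V) :
    T.imageTransfer g K f f' x (T.proj (f x) w) = T.imageTransfer g K f f' x w :=
  congrArg (fun z => T.diffHat K f' x (dualLift (T.metric g (f x)) (T.diffHat K f x) z))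
    (T.metric_proj g (f x) w)

theorem proj_imageTransfer (f f' : Q → Q) (x : Q) (w : V) :
    T.proj (f' x) (T.imageTransfer g K f f' x w) = T.imageTransfer g K f f' x w :=
  T.proj_incl _ _

/-- The definition of `imageTransfer` uses the domain `tanE n K x`, which varies with `x`. In a
parametrization the domain becomes `Euc k`, where smooth dependence makes sense. -/
theorem imageTransfer_eq_transfer_frame (p : LocalParam (𝓡 n) K k) {f f' : Q → Q} {b : Euc k}
    (hb : b ∈ p.B) (hf : MDifferentiableWithinAt (𝓡 n) (𝓡 n) f K (p.param b))
    (hf' : MDifferentiableWithinAt (𝓡 n) (𝓡 n) f' K (p.param b))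
    (hi : InjOn (mfderivWithin (𝓡 n) (𝓡 n) f K (p.param b)) (tangentSpaceOf (𝓡 n) K (p.param b))) :
    (∀ u, u ≠ 0 → T.metric g (f (p.param b)) (T.frame p f b u) (T.frame p f b u) ≠ 0) ∧
    T.imageTransfer g K f f' (p.param b) =
      transfer (T.metric g (f (p.param b))) (T.frame p f b) (T.frame p f' b) := by
  have key : ∀ w : Euc k, ∃ u : tanE n K (p.param b),
      (u : Euc n) = (mfderiv (𝓡 k) (𝓡 n) p.param b : Euc k →L[ℝ] Euc n) w ∧
      T.diffHat K f (p.param b) u = T.frame p f b w ∧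
      T.diffHat K f' (p.param b) u = T.frame p f' b w := fun w =>
    ⟨⟨_, p.mfderiv_param_mem hb w⟩, rfl, (T.frame_apply p hb hf w).symm,
      (T.frame_apply p hb hf' w).symm⟩
  have hne : ∀ u, u ≠ 0 → T.metric g (f (p.param b)) (T.frame p f b u) (T.frame p f b u) ≠ 0 := by
    intro w hw
    obtain ⟨u, hu, e, -⟩ := key w
    rw [← e]
    refine T.metric_diffHat_ne g hi u fun h0 => hw ?_
    have h1 := p.mfderiv_coord_mfderiv_param hb w
    have h2 : (mfderiv (𝓡 k) (𝓡 n) p.param b : Euc k →L[ℝ] Euc n) w = 0 := by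
      rw [← hu, h0]; rfl
    refine h1.symm.trans (Eq.trans ?_ (map_zero
      (mfderiv (𝓡 n) (𝓡 k) p.coord (p.param b) : Euc n →L[ℝ] Euc k)))
    exact congrArg (mfderiv (𝓡 n) (𝓡 k) p.coord (p.param b) : Euc n →L[ℝ] Euc k) h2
  refine ⟨hne, transfer_eq_transfer (T.metric_diffHat_ne g hi) hne (fun u => ?_) fun w => ?_⟩
  · obtain ⟨w, hw⟩ := p.exists_mfderiv_param_eq hb u.2
    obtain ⟨u', hu', e1, e2⟩ := key w
    have : u' = u := Subtype.ext (hu'.trans hw)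
    subst this
    exact ⟨w, e1.symm, e2.symm⟩
  · obtain ⟨u, -, e1, e2⟩ := key w
    exact ⟨u, e1, e2⟩

/-- Both sides project orthogonally to the same space, in two parametrizations. The right side is
the one for which continuity in the time of an isotopy is known. -/
theorem tangentProj_image (hK : IsSubmanifold (𝓡 n) k K) {f : Q → Q}
    (hf : ContMDiffOn (𝓡 n) (𝓡 n) ∞ f K) (he : IsEmbedding (K.domRestrict f)) {x : Q} (hx : x ∈ K)
    (hi : InjOn (mfderivWithin (𝓡 n) (𝓡 n) f K x) (tangentSpaceOf (𝓡 n) K x)) :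
    T.tangentProj g (f '' K) (f x) = T.imageTransfer g K f f x := by
  have hm := hK.mem_tangentSpaceOf_image_iff hf he hx hi
  refine transfer_eq_transfer (T.metric_incl_comp_ne g _ Subtype.val_injective)
    (T.metric_diffHat_ne g hi) (fun u => ?_) fun u => ?_
  · obtain ⟨w, hw, e⟩ := (hm _).1 u.2
    have : T.diffHat K f x ⟨w, hw⟩ = (T.incl (f x) ∘L (tanE n (f '' K) (f x)).subtypeL) u :=
      congrArg (T.incl (f x)) e
    exact ⟨⟨w, hw⟩, this, this⟩
  · exact ⟨⟨_, (hm _).2 ⟨(u : Euc n), u.2, rfl⟩⟩, rfl, rfl⟩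

variable {f : ℝ → Q → Q}

/-- The maps `imageTransfer` of an isotopy depend smoothly on the times and on the point. -/
theorem contMDiffOn_imageTransfer (hK : IsSubmanifold (𝓡 n) k K)
    (hf : IsSmoothIsotopy (𝓡 n) K K' f) :
    ContMDiffOn ((𝓘(ℝ, ℝ).prod 𝓘(ℝ, ℝ)).prod (𝓡 n)) 𝓘(ℝ, V →L[ℝ] V) ∞
      (fun z : (ℝ × ℝ) × Q => T.imageTransfer g K (f z.1.1) (f z.1.2) z.2)
      ((Icc 0 1 ×ˢ Icc 0 1) ×ˢ K) := by
  rintro ⟨⟨s, t⟩, x⟩ ⟨⟨hs, ht⟩, hx⟩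
  obtain ⟨p, hp⟩ := hK.exists_localParam hx
  have hIcc : UniqueDiffOn ℝ (Icc (0 : ℝ) 1) := uniqueDiffOn_Icc zero_lt_one
  have hfr := T.contMDiffOn_frame p hIcc hf.contMDiffOn
  let D : Set ((ℝ × ℝ) × Q) := ((Icc 0 1 ×ˢ Icc 0 1) ×ˢ (K ∩ p.U))
  have hD : ∀ z ∈ D, p.coord z.2 ∈ p.B ∧ p.param (p.coord z.2) = z.2 := fun z hz =>
    ⟨p.coord_mem _ hz.2.2, p.param_coord _ hz.2.1 hz.2.2⟩
  have hmem : ((s, t), x) ∈ D := ⟨⟨hs, ht⟩, hx, hp⟩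
  have hc : ContMDiffOn ((𝓘(ℝ, ℝ).prod 𝓘(ℝ, ℝ)).prod (𝓡 n)) (𝓡 k) ∞
      (fun z : (ℝ × ℝ) × Q => p.coord z.2) D :=
    p.smooth_coord.comp contMDiff_snd.contMDiffOn fun z hz => hz.2.2
  have hf1 : ContMDiffOn ((𝓘(ℝ, ℝ).prod 𝓘(ℝ, ℝ)).prod (𝓡 n)) 𝓘(ℝ, ℝ) ∞
      (fun z : (ℝ × ℝ) × Q => z.1.1) D := (contMDiff_fst.comp contMDiff_fst).contMDiffOn
  have hf2 : ContMDiffOn ((𝓘(ℝ, ℝ).prod 𝓘(ℝ, ℝ)).prod (𝓡 n)) 𝓘(ℝ, ℝ) ∞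
      (fun z : (ℝ × ℝ) × Q => z.1.2) D := (contMDiff_snd.comp contMDiff_fst).contMDiffOn
  have ha : ContMDiffOn ((𝓘(ℝ, ℝ).prod 𝓘(ℝ, ℝ)).prod (𝓡 n)) 𝓘(ℝ, Euc k →L[ℝ] V) ∞
      (fun z : (ℝ × ℝ) × Q => T.frame p (f z.1.1) (p.coord z.2)) D :=
    hfr.comp (hf1.prodMk hc) fun z hz => ⟨hz.1.1, (hD z hz).1⟩
  have hb : ContMDiffOn ((𝓘(ℝ, ℝ).prod 𝓘(ℝ, ℝ)).prod (𝓡 n)) 𝓘(ℝ, Euc k →L[ℝ] V) ∞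
      (fun z : (ℝ × ℝ) × Q => T.frame p (f z.1.2) (p.coord z.2)) D :=
    hfr.comp (hf2.prodMk hc) fun z hz => ⟨hz.1.2, (hD z hz).1⟩
  have hG : ContMDiffOn ((𝓘(ℝ, ℝ).prod 𝓘(ℝ, ℝ)).prod (𝓡 n)) 𝓘(ℝ, V →L[ℝ] V →L[ℝ] ℝ) ∞
      (fun z : (ℝ × ℝ) × Q => T.metric g (f z.1.1 z.2)) D :=
    (T.contMDiff_metric g).comp_contMDiffOn
      (hf.contMDiffOn.comp (hf1.prodMk contMDiff_snd.contMDiffOn) fun z hz => ⟨hz.1.1, hz.2.1⟩)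
  have key : ∀ z ∈ D,
      (∀ u, u ≠ 0 → T.metric g (f z.1.1 z.2) (T.frame p (f z.1.1) (p.coord z.2) u)
        (T.frame p (f z.1.1) (p.coord z.2) u) ≠ 0) ∧
      T.imageTransfer g K (f z.1.1) (f z.1.2) z.2 = transfer (T.metric g (f z.1.1 z.2))
        (T.frame p (f z.1.1) (p.coord z.2)) (T.frame p (f z.1.2) (p.coord z.2)) := by
    rintro ⟨⟨s, t⟩, x⟩ hz
    have h := T.imageTransfer_eq_transfer_frame g p (f := f s) (f' := f t) (hD _ hz).1
      (by
        rw [(hD _ hz).2]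
        exact ContMDiffOn.mdifferentiableWithinAt_family hf.contMDiffOn hz.1.1 hz.2.1)
      (by
        rw [(hD _ hz).2]
        exact ContMDiffOn.mdifferentiableWithinAt_family hf.contMDiffOn hz.1.2 hz.2.1)
      (by
        rw [(hD _ hz).2]
        exact hf.immersion s hz.1.1 x hz.2.1)
    rw [(hD _ hz).2] at h
    exact h
  have h1 := (hG _ hmem).transfer (ha _ hmem) (hb _ hmem) (key _ hmem).1
  have h2 : ContMDiffWithinAt ((𝓘(ℝ, ℝ).prod 𝓘(ℝ, ℝ)).prod (𝓡 n)) 𝓘(ℝ, V →L[ℝ] V) ∞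
      (fun z : (ℝ × ℝ) × Q => T.imageTransfer g K (f z.1.1) (f z.1.2) z.2) D ((s, t), x) :=
    h1.congr (fun z hz => (key z hz).2) (key _ hmem).2
  refine (contMDiffWithinAt_inter (t := univ ×ˢ p.U)
    (prod_mem_nhds Filter.univ_mem (p.isOpen_U.mem_nhds hp))).1 ?_
  rw [prod_inter_prod, inter_univ]
  exact h2

/-- The constant isotopy turns statements about families into statements about a fixed submanifold.
-/
theorem isSmoothIsotopy_refl (K : Set Q) : IsSmoothIsotopy (𝓡 n) K K (fun _ x => x) where
  contMDiffOn := contMDiff_snd.contMDiffOn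
  isEmbedding := fun _ _ => IsEmbedding.subtypeVal
  immersion := fun t _ x _ => by
    intro v hv w hw h
    have h1 : HasMFDerivWithinAt (𝓡 n) (𝓡 n) (fun x : Q => x) K x
        (mfderivWithin (𝓡 n) (𝓡 n) (fun x : Q => x) K x : Euc n →L[ℝ] Euc n) :=
      (mdifferentiableAt_id (I := 𝓡 n)).mdifferentiableWithinAt.hasMFDerivWithinAt
    have h2 : HasMFDerivWithinAt (𝓡 n) (𝓡 n) (fun x : Q => x) K x
      (ContinuousLinearMap.id ℝ (Euc n)) := hasMFDerivWithinAt_id K x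
    have h3 := h1.eq_on_tangentSpaceOf h2 hv
    have h4 := h1.eq_on_tangentSpaceOf h2 hw
    exact h3.symm.trans (Eq.trans h h4)
  map_zero := fun _ _ => rfl
  image_one := image_id' K

theorem continuousOn_tangentProj_family (hK : IsSubmanifold (𝓡 n) k K)
    (hf : IsSmoothIsotopy (𝓡 n) K K' f) :
    ContinuousOn (fun z : ℝ × Q => T.tangentProj g (f z.1 '' K) (f z.1 z.2)) (Icc 0 1 ×ˢ K) := by
  have h1 := (T.contMDiffOn_imageTransfer g hK hf).continuousOn
  have h2 : ContinuousOn (fun z : ℝ × Q => T.imageTransfer g K (f z.1) (f z.1) z.2)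
      (Icc 0 1 ×ˢ K) :=
    h1.comp (f := fun z : ℝ × Q => ((z.1, z.1), z.2)) (by fun_prop)
      fun z hz => ⟨⟨hz.1, hz.1⟩, hz.2⟩
  refine h2.congr fun z hz => ?_
  refine T.tangentProj_image g hK ?_ (hf.isEmbedding _ hz.1) hz.2 (hf.immersion _ hz.1 _ hz.2)
  exact hf.contMDiffOn.comp (f := fun y : Q => (z.1, y)) (contMDiffOn_const.prodMk contMDiffOn_id)
    fun y hy => ⟨hz.1, hy⟩

theorem continuousOn_tangentProj (hK : IsSubmanifold (𝓡 n) k K) :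
    ContinuousOn (T.tangentProj g K) K := by
  have h := T.continuousOn_tangentProj_family g hK (isSmoothIsotopy_refl K)
  simp only [image_id'] at h
  exact h.comp (f := fun q : Q => ((0 : ℝ), q)) (by fun_prop) fun q hq =>
    ⟨⟨le_rfl, zero_le_one⟩, hq⟩

end TangentEmbedding

end Projection

/-! ### Pullbacks of coverings and connectedness of fibres -/

section Coverings

/-- The pullback of a covering map is a covering map. -/
theorem IsCoveringMap.pullback {E X Y : Type*} [TopologicalSpace E] [TopologicalSpace X]
    [TopologicalSpace Y] {p : E → X} (hp : IsCoveringMap p) {φ : Y → X} (hφ : Continuous φ) :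
    IsCoveringMap (fun z : {z : Y × E // p z.2 = φ z.1} => z.1.1) := by
  intro y
  obtain ⟨inst, U, hxU, hU, hfU, H, hH⟩ := hp (φ y)
  have hc : Continuous (fun z : {z : Y × E // p z.2 = φ z.1} => z.1.1) := by fun_prop
  refine IsEvenlyCovered.to_isEvenlyCovered_preimage (I := p ⁻¹' {φ y})
    ⟨inst, φ ⁻¹' U, hxU, hU.preimage hφ, (hU.preimage hφ).preimage hc, ?_⟩
  have hs : ∀ w, p (H.symm w).1 = w.1.1 := fun w => by rw [← hH, H.apply_symm_apply]
  refine ⟨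
    { toFun := fun z => (⟨z.1.1.1, z.2⟩, (H ⟨z.1.1.2, by
        rw [mem_preimage, z.1.2]; exact z.2⟩).2)
      invFun := fun w => ⟨⟨(w.1.1, (H.symm (⟨φ w.1.1, w.1.2⟩, w.2)).1), hs _⟩, w.1.2⟩
      left_inv := ?_
      right_inv := ?_
      continuous_toFun := by fun_prop
      continuous_invFun := ?_ }, fun _ => rfl⟩
  · rintro ⟨⟨⟨y', e⟩, h⟩, hy'⟩
    refine Subtype.ext (Subtype.ext (Prod.ext rfl ?_))
    have h1 : (⟨φ y', hy'⟩, (H ⟨e, by rw [mem_preimage, h]; exact hy'⟩).2) =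
        H ⟨e, by rw [mem_preimage, h]; exact hy'⟩ :=
      Prod.ext (Subtype.ext ((hH _).trans h).symm) rfl
    dsimp only
    rw [h1, H.symm_apply_apply]
  · rintro ⟨⟨y', hy'⟩, i⟩
    refine Prod.ext rfl ?_
    dsimp only
    rw [Subtype.coe_eta, H.apply_symm_apply]
  · refine Continuous.subtype_mk (Continuous.subtype_mk ?_ _) _
    refine (continuous_subtype_val.comp continuous_fst).prodMk (continuous_subtype_val.comp
      (H.symm.continuous.comp (Continuous.prodMk ?_ continuous_snd)))
    exact (hφ.comp (continuous_subtype_val.comp continuous_fst)).subtype_mk _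

open scoped InnerProductSpace

/-- The vectors `u` and `w` are nonzero, and do not point in opposite directions. -/
def NotOpposite {E : Type*} [NormedAddCommGroup E] [InnerProductSpace ℝ E] (u w : E) : Prop :=
  0 < ⟪u, w⟫_ℝ + ‖u‖ * ‖w‖

section NotOpposite

variable {E : Type*} [NormedAddCommGroup E] [InnerProductSpace ℝ E]

theorem NotOpposite.symm {u w : E} (h : NotOpposite u w) : NotOpposite w u := by
  rw [NotOpposite, real_inner_comm, mul_comm]
  exact h

theorem notOpposite_self {u : E} (h : u ≠ 0) : NotOpposite u u := by
  have : 0 < ‖u‖ := norm_pos_iff.2 h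
  rw [NotOpposite, real_inner_self_eq_norm_sq]
  positivity

theorem isOpen_notOpposite {X : Type*} [TopologicalSpace X] {a b : X → E} (ha : Continuous a)
    (hb : Continuous b) : IsOpen {x | NotOpposite (a x) (b x)} :=
  isOpen_lt continuous_const (by fun_prop)

/-- This is the equality case of the Cauchy–Schwarz inequality. -/
theorem notOpposite_of_notMem_span {u e : E} (he : e ≠ 0) (h : u ∉ Submodule.span ℝ {e}) :
    NotOpposite u e := by
  by_contra h0
  have h1 : ⟪u, e⟫_ℝ = -(‖u‖ * ‖e‖) := by
    have h2 := neg_le_of_abs_le (abs_real_inner_le_norm u e)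
    rw [NotOpposite, not_lt] at h0
    linarith
  have h3 : ⟪e, -u⟫_ℝ = ‖e‖ * ‖-u‖ := by
    rw [inner_neg_right, real_inner_comm, h1, norm_neg]; ring
  rw [inner_eq_norm_mul_iff_real] at h3
  refine h (Submodule.mem_span_singleton.2 ⟨-(‖u‖ / ‖e‖), ?_⟩)
  have he' : ‖e‖ ≠ 0 := norm_ne_zero_iff.2 he
  rw [norm_neg, smul_neg] at h3
  rw [neg_smul, div_eq_inv_mul, mul_smul, h3, smul_neg, neg_neg, smul_smul, inv_mul_cancel₀ he',
    one_smul]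

/-- The two expressions add up to `2 * ‖u‖ * ‖e‖`, which is positive. So two open sets cover the
nonzero vectors. -/
theorem notOpposite_or {u e : E} (hu : u ≠ 0) (he : e ≠ 0) :
    NotOpposite u e ∨ NotOpposite u (-e) := by
  by_contra! h
  have h1 : 0 < ‖u‖ * ‖e‖ := mul_pos (norm_pos_iff.2 hu) (norm_pos_iff.2 he)
  obtain ⟨h2, h3⟩ := h
  rw [NotOpposite, not_lt] at h2 h3
  rw [inner_neg_right, norm_neg] at h3
  linarith

end NotOpposite

/-- If the fibres of `v` can be identified along segments that avoid the origin, and the total space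
is connected, then the fibres are connected. -/
theorem isPreconnected_fiber_of_transport {X E : Type*} [TopologicalSpace X] [PreconnectedSpace X]
    [NormedAddCommGroup E] [InnerProductSpace ℝ E] {v : X → E} (hv : Continuous v)
    (hv0 : ∀ x, v x ≠ 0) (Tr : {z : X × E // NotOpposite (v z.1) z.2} → X) (hTr : Continuous Tr)
    (h1 : ∀ z, v (Tr z) = z.1.2) (h2 : ∀ c h, Tr ⟨(c, v c), h⟩ = c)
    (h3 : ∀ z h, Tr ⟨(Tr z, v z.1.1), h⟩ = z.1.1) {e w₀ : E} (he : e ≠ 0)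
    (hw₀ : NotOpposite w₀ e ∧ NotOpposite w₀ (-e))
    (hW : IsPreconnected {w : E | NotOpposite w e ∧ NotOpposite w (-e)}) :
    IsPreconnected (v ⁻¹' {e}) := by
  classical
  -- A locally constant `β` on the fibre over `e` is extended to a continuous function `B` on the
  -- connected space `X`, which forces it to be constant.
  refine isPreconnected_of_forall_constant fun β hβ => ?_
  have he' : -e ≠ 0 := neg_ne_zero.2 he
  let s : X → E → X := fun c w => if h : NotOpposite (v c) w then Tr ⟨(c, w), h⟩ else c
  have hs : ∀ c w, NotOpposite (v c) w → v (s c w) = w := fun c w h => by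
    simp only [s, dif_pos h, h1]
  have hsc : ContinuousOn (fun z : X × E => s z.1 z.2) {z | NotOpposite (v z.1) z.2} := by
    rw [continuousOn_iff_continuous_domRestrict]
    refine hTr.congr fun z => ?_
    have hz : NotOpposite (v z.1.1) z.1.2 := z.2
    simp only [s, domRestrict_apply, dif_pos hz]
  have hsl : ∀ w, ContinuousOn (fun c => s c w) {c | NotOpposite (v c) w} := fun w =>
    hsc.comp (f := fun c => (c, w)) (by fun_prop) fun c hc => hc
  have hsr : ∀ c, ContinuousOn (fun w => s c w) {w | NotOpposite (v c) w} := fun c =>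
    hsc.comp (f := fun w => (c, w)) (by fun_prop) fun c hc => hc
  have hss : ∀ c w, NotOpposite (v c) w → s (s c w) (v c) = c := fun c w h => by
    have h4 : NotOpposite (v (Tr ⟨(c, w), h⟩)) (v c) := by rw [h1]; exact h.symm
    simp only [s, dif_pos h, dif_pos h4]
    exact h3 ⟨(c, w), h⟩ h4
  -- Fibres over opposite vectors cannot be compared directly, so `β` reaches the fibre over `-e`
  -- through the auxiliary vector `w₀`.
  let β' : X → Bool := fun c => β (s (s c w₀) e)
  have hβ' : ContinuousOn β' (v ⁻¹' {-e}) := by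
    have h4 : ∀ c ∈ v ⁻¹' {-e}, NotOpposite (v c) w₀ := fun c hc => by
      rw [show v c = -e from hc]; exact hw₀.2.symm
    have h5 : ∀ c ∈ v ⁻¹' {-e}, NotOpposite (v (s c w₀)) e := fun c hc => by
      rw [hs _ _ (h4 c hc)]; exact hw₀.1
    exact hβ.comp ((hsl e).comp ((hsl w₀).mono h4) h5) fun c hc => hs _ _ (h5 c hc)
  -- Start at the point `z` over `-e` and go to `e` through `w`. The value of `β` at the end is
  -- locally constant in `w`, hence the same for `w = v c`, where the path passes through `c`, and
  -- for `w = w₀`.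
  have key : ∀ c, NotOpposite (v c) e → NotOpposite (v c) (-e) →
      β (s c e) = β' (s c (-e)) := by
    intro c hc hc'
    set z := s c (-e) with hz
    have hvz : v z = -e := hs _ _ hc'
    have hγ : ContinuousOn (fun w => β (s (s z w) e))
        {w : E | NotOpposite w e ∧ NotOpposite w (-e)} := by
      have h4 : ∀ w, NotOpposite w e ∧ NotOpposite w (-e) → NotOpposite (v z) w := fun w hw => by
        rw [hvz]; exact hw.2.symm
      have h5 : ∀ w, NotOpposite w e ∧ NotOpposite w (-e) → NotOpposite (v (s z w)) e :=
        fun w hw => by rw [hs _ _ (h4 w hw)]; exact hw.1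
      exact hβ.comp ((hsl e).comp ((hsr z).mono h4) h5) fun w hw => hs _ _ (h5 w hw)
    have h4 := hW.constant hγ (x := v c) (y := w₀) ⟨hc, hc'⟩ hw₀
    rw [hz, hss c (-e) hc'] at h4
    exact h4
  -- The two formulas agree on the overlap by `key`, and their open domains cover `X`.
  let B : X → Bool := fun c => if NotOpposite (v c) e then β (s c e) else β' (s c (-e))
  have hU : IsOpen {c | NotOpposite (v c) e} := isOpen_notOpposite hv continuous_const
  have hU' : IsOpen {c | NotOpposite (v c) (-e)} := isOpen_notOpposite hv continuous_const
  have hBU : ContinuousOn B {c | NotOpposite (v c) e} := by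
    refine ContinuousOn.congr (f := fun c => β (s c e)) ?_ fun c hc => if_pos hc
    exact hβ.comp (hsl e) fun c hc =>
      hs _ _ hc
  have hBU' : ContinuousOn B {c | NotOpposite (v c) (-e)} := by
    refine ContinuousOn.congr (f := fun c => β' (s c (-e))) ?_ fun c hc => ?_
    · exact hβ'.comp (hsl (-e)) fun c hc =>
        hs _ _ hc
    · by_cases h : NotOpposite (v c) e
      · exact (if_pos h).trans (key c h hc)
      · exact if_neg h
  have hB : Continuous B := by
    rw [continuous_iff_continuousAt]
    intro c
    rcases notOpposite_or (hv0 c) he with h | h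
    · exact hBU.continuousAt (hU.mem_nhds h)
    · exact hBU'.continuousAt (hU'.mem_nhds h)
  have hBe : ∀ c ∈ v ⁻¹' {e}, B c = β c := by
    intro c hc
    have hc' : v c = e := hc
    have h : NotOpposite (v c) e := by rw [hc']; exact notOpposite_self he
    have h4 : s c e = c := by
      simp only [s, dif_pos h]
      subst hc'
      exact h2 c h
    exact (if_pos h).trans (by rw [h4])
  intro x hx y hy
  rw [← hBe x hx, ← hBe y hy]
  exact PreconnectedSpace.constant inferInstance hB

end Coverings

/-! ### Frames, and lifts of motions of frames -/

section FrameBundle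

variable {E : Type} [NormedAddCommGroup E] [NormedSpace ℝ E]
  {H : Type} [TopologicalSpace H] {I : ModelWithCorners ℝ E H}
  {M : Type u} [TopologicalSpace M] [ChartedSpace H M] [IsManifold I ∞ M] {S : Set M} {k : ℕ}

theorem TangentFrame.ext_toBundle {f f' : TangentFrame I S k} (hp : f.pt = f'.pt)
    (h : ∀ i, f.toBundle i = f'.toBundle i) : f = f' := by
  obtain ⟨x, hx, v, hv, hi⟩ := f
  obtain ⟨x', hx', v', hv', hi'⟩ := f'
  dsimp only at hp
  subst hp
  have : v = v' := funext fun i => by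
    have := h i
    simp only [TangentFrame.toBundle] at this
    exact eq_of_heq (Bundle.TotalSpace.mk.inj this).2
  subst this
  rfl

theorem TangentFrame.continuous_pt : Continuous fun f : TangentFrame I S k => f.pt :=
  continuous_fst.comp (continuous_induced_dom (f := fun f : TangentFrame I S k =>
    (f.pt, f.toBundle)) (t := inferInstanceAs (TopologicalSpace (M × (Fin k → TangentBundle I M)))))

theorem TangentFrame.continuous_toBundle (i : Fin k) :
    Continuous fun f : TangentFrame I S k => f.toBundle i :=
  (continuous_apply i).comp (continuous_snd.comp (continuous_induced_dom
    (f := fun f : TangentFrame I S k => (f.pt, f.toBundle))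
    (t := inferInstanceAs (TopologicalSpace (M × (Fin k → TangentBundle I M))))))

theorem TangentFrame.continuous_of {Y : Type*} [TopologicalSpace Y] {φ : Y → TangentFrame I S k}
    (h1 : Continuous fun y => (φ y).pt) (h2 : ∀ i, Continuous fun y => (φ y).toBundle i) :
    Continuous φ :=
  continuous_induced_rng.2 (h1.prodMk (continuous_pi h2))

/-- The vectors of a frame, as elements of the model space. -/
def TangentFrame.vecE (f : TangentFrame I S k) (i : Fin k) : E := f.vec i

theorem TangentFrame.toBundle_eq (f : TangentFrame I S k) (i : Fin k) :
    f.toBundle i = ⟨f.pt, (f.vecE i : TangentSpace I f.pt)⟩ := rfl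

theorem TangentFrame.linearIndependent_vecE (f : TangentFrame I S k) :
    LinearIndependent ℝ f.vecE := f.indep

end FrameBundle

section FramesAt

variable {n : ℕ} {Q : Type u} [TopologicalSpace Q] [ChartedSpace (Euc n) Q]
  [IsManifold (𝓡 n) ∞ Q] {V : Type*} [NormedAddCommGroup V] [NormedSpace ℝ V]

/-- The frame at `q` with given vectors. -/
def mkFrame (q : Q) (w : Fin n → Euc n) (hw : LinearIndependent ℝ w) :
    TangentFrame (𝓡 n) (univ : Set Q) n where
  pt := q
  mem := mem_univ q
  vec := w
  tangent := fun i => by rw [tangentSpaceOf_univ]; exact Submodule.mem_top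
  indep := hw

theorem continuous_mkFrame {Y : Type*} [TopologicalSpace Y] (q : Q) {w : Y → Fin n → Euc n}
    (hw : ∀ y, LinearIndependent ℝ (w y)) (hc : Continuous w) :
    Continuous fun y => mkFrame q (w y) (hw y) := by
  refine TangentFrame.continuous_of continuous_const fun i => ?_
  exact (FiberBundle.continuous_totalSpaceMk (Euc n) (TangentSpace (𝓡 n)) q).comp
    ((continuous_apply i).comp hc)

theorem mkFrame_vecE {q : Q} {f : TangentFrame (𝓡 n) (univ : Set Q) n} (h : f.pt = q) :
    mkFrame q f.vecE f.linearIndependent_vecE = f := by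
  subst h
  rfl

theorem mkFrame_congr {q : Q} {w w' : Fin n → Euc n} (hw : LinearIndependent ℝ w)
    (hw' : LinearIndependent ℝ w') (h : w = w') : mkFrame q w hw = mkFrame q w' hw' := by
  subst h
  rfl

/-- The points of the covering over the frames at `q`. -/
abbrev SpinStructure.CoverAt (σ : SpinStructure (𝓡 n) (univ : Set Q) n) (q : Q) :=
  {c : σ.cover // (σ.proj c).pt = q}

/-- The vectors of the frame below a point of the covering. -/
def SpinStructure.vecs (σ : SpinStructure (𝓡 n) (univ : Set Q) n) {q : Q} (c : σ.CoverAt q) :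
    Fin n → Euc n := (σ.proj c.1).vecE

theorem SpinStructure.proj_eq (σ : SpinStructure (𝓡 n) (univ : Set Q) n) {q : Q}
    (c : σ.CoverAt q) :
    σ.proj c.1 = mkFrame q (σ.vecs c) (σ.proj c.1).linearIndependent_vecE :=
  (mkFrame_vecE c.2).symm

theorem SpinStructure.linearIndependent_vecs (σ : SpinStructure (𝓡 n) (univ : Set Q) n) {q : Q}
    (c : σ.CoverAt q) : LinearIndependent ℝ (σ.vecs c) := (σ.proj c.1).linearIndependent_vecE

theorem SpinStructure.continuous_vecs (T : TangentEmbedding n Q V)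
    (σ : SpinStructure (𝓡 n) (univ : Set Q) n) (q : Q) : Continuous (σ.vecs (q := q)) := by
  refine continuous_pi fun i => ?_
  have h1 : Continuous fun c : σ.CoverAt q => T.retr q (T.total ((σ.proj c.1).toBundle i)) :=
    (T.retr q).continuous.comp (T.contMDiff_total.continuous.comp
      ((TangentFrame.continuous_toBundle i).comp
        (σ.isCoveringMap.continuous.comp continuous_subtype_val)))
  refine h1.congr fun c => ?_
  obtain ⟨c, rfl⟩ := c
  exact T.retr_incl _ _

/-- Homotopies of frames at `q` lift to the covering. -/
theorem SpinStructure.exists_lift_frames (σ : SpinStructure (𝓡 n) (univ : Set Q) n) {q : Q}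
    {A : Type*} [TopologicalSpace A] {w : unitInterval × A → Fin n → Euc n} (hw : Continuous w)
    (hi : ∀ z, LinearIndependent ℝ (w z)) {f : A → σ.CoverAt q} (hf : Continuous f)
    (h0 : ∀ a, w (0, a) = σ.vecs (f a)) :
    ∃ D : unitInterval × A → σ.CoverAt q, Continuous D ∧ (∀ z, σ.vecs (D z) = w z) ∧
      ∀ a, D (0, a) = f a := by
  let H : C(unitInterval × A, TangentFrame (𝓡 n) (univ : Set Q) n) :=
    ⟨fun z => mkFrame q (w z) (hi z), continuous_mkFrame q hi hw⟩
  let F : C(A, σ.cover) := ⟨fun a => (f a).1, continuous_subtype_val.comp hf⟩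
  have hH : ∀ a, H (0, a) = σ.proj (F a) := fun a => by
    change mkFrame q (w (0, a)) (hi (0, a)) = σ.proj (f a).1
    exact (mkFrame_congr _ _ (h0 a)).trans (σ.proj_eq _).symm
  let L := σ.isCoveringMap.liftHomotopy H F hH
  have hL : ∀ z, σ.proj (L z) = mkFrame q (w z) (hi z) := fun z =>
    congrFun (σ.isCoveringMap.liftHomotopy_lifts H F hH) z
  refine ⟨fun z => ⟨L z, by rw [hL]; rfl⟩, by fun_prop, fun z => ?_, fun a => ?_⟩
  · change (σ.proj (L z)).vecE = w z
    rw [hL]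
    rfl
  · exact Subtype.ext (σ.isCoveringMap.liftHomotopy_zero H F hH a)

/-- Uniqueness of path lifting, expressed by the vectors below. It identifies the ends of lifted
motions that are constant or run backwards. -/
theorem SpinStructure.eq_of_vecs_eq (σ : SpinStructure (𝓡 n) (univ : Set Q) n) {q : Q}
    {γ γ' : unitInterval → σ.CoverAt q} (hγ : Continuous γ) (hγ' : Continuous γ')
    (h : ∀ t, σ.vecs (γ t) = σ.vecs (γ' t)) {t₀ : unitInterval} (h0 : γ t₀ = γ' t₀) : γ = γ' := by
  have h1 := σ.isCoveringMap.eq_of_comp_eq (continuous_subtype_val.comp hγ)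
    (continuous_subtype_val.comp hγ') (by
      funext t
      exact (σ.proj_eq _).trans ((mkFrame_congr _ _ (h t)).trans (σ.proj_eq _).symm)) t₀ (congrArg Subtype.val h0)
  exact funext fun t => Subtype.ext (congrFun h1 t)

end FramesAt

/-! ### Linear motions that turn one vector into another -/

section Shear

open scoped InnerProductSpace

variable {E : Type*} [NormedAddCommGroup E] [InnerProductSpace ℝ E]

/-- The functional with value `1` at `u` and kernel orthogonal to the bisector of `u` and `w`. -/
def shearCoeff (u w x : E) : ℝ := ⟪x, ‖w‖ • u + ‖u‖ • w⟫_ℝ / ⟪u, ‖w‖ • u + ‖u‖ • w⟫_ℝ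

/-- A linear motion that takes `u` to `w` at time `1`. -/
def shear (t : ℝ) (u w x : E) : E := x + (t * shearCoeff u w x) • (w - u)

theorem shear_zero (u w x : E) : shear 0 u w x = x := by simp [shear]

theorem shear_self (t : ℝ) (u x : E) : shear t u u x = x := by simp [shear]

theorem NotOpposite.ne_zero {u w : E} (h : NotOpposite u w) : u ≠ 0 := by
  rintro rfl
  simp [NotOpposite] at h

/-- The inner product of `u` with the bisector is `‖u‖` times the expression in `NotOpposite`. So
the denominator of `shearCoeff` does not vanish. -/
theorem NotOpposite.inner_left_pos {u w : E} (h : NotOpposite u w) :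
    0 < ⟪u, ‖w‖ • u + ‖u‖ • w⟫_ℝ := by
  have h1 : ⟪u, ‖w‖ • u + ‖u‖ • w⟫_ℝ = ‖u‖ * (⟪u, w⟫_ℝ + ‖u‖ * ‖w‖) := by
    rw [inner_add_right, inner_smul_right, inner_smul_right, real_inner_self_eq_norm_sq]
    ring
  rw [h1]
  exact mul_pos (norm_pos_iff.2 h.ne_zero) h

theorem NotOpposite.inner_right_pos {u w : E} (h : NotOpposite u w) :
    0 < ⟪w, ‖w‖ • u + ‖u‖ • w⟫_ℝ := by
  rw [add_comm]
  exact h.symm.inner_left_pos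

theorem shearCoeff_self {u w : E} (h : NotOpposite u w) : shearCoeff u w u = 1 :=
  div_self h.inner_left_pos.ne'

theorem shear_one_self {u w : E} (h : NotOpposite u w) : shear 1 u w u = w := by
  simp [shear, shearCoeff_self h]

theorem shearCoeff_add (u w x y : E) :
    shearCoeff u w (x + y) = shearCoeff u w x + shearCoeff u w y := by
  simp only [shearCoeff, inner_add_left, add_div]

theorem shearCoeff_smul (u w : E) (c : ℝ) (x : E) :
    shearCoeff u w (c • x) = c * shearCoeff u w x := by
  simp only [shearCoeff, real_inner_smul_left, mul_div_assoc]

theorem shearCoeff_shear {u w : E} (h : NotOpposite u w) (t : ℝ) (x : E) :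
    shearCoeff u w (shear t u w x) =
      shearCoeff u w x * (1 + t * (shearCoeff u w w - 1)) := by
  rw [shear, shearCoeff_add, shearCoeff_smul, sub_eq_add_neg w u, shearCoeff_add,
    ← neg_one_smul ℝ u, shearCoeff_smul, shearCoeff_self h]
  ring

/-- The factor interpolates linearly between `1` and the coefficient of `w`, which is positive
because `u` and `w` lie on the same side of the hyperplane orthogonal to their bisector. -/
theorem shearCoeff_shear_pos {u w : E} (h : NotOpposite u w) {t : ℝ} (h0 : 0 ≤ t) (h1 : t ≤ 1) :
    0 < 1 + t * (shearCoeff u w w - 1) := by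
  have h2 : 0 < shearCoeff u w w := div_pos h.inner_right_pos h.inner_left_pos
  rcases h1.lt_or_eq with h3 | rfl
  · nlinarith [mul_nonneg h0 h2.le]
  · linarith

/-- A shear, as a linear map. -/
def shearLinear (t : ℝ) (u w : E) : E →ₗ[ℝ] E where
  toFun := shear t u w
  map_add' x y := by simp only [shear, shearCoeff_add, mul_add, add_smul]; abel
  map_smul' c x := by
    simp only [shear, shearCoeff_smul, smul_add, RingHom.id_apply, smul_smul]
    congr 2
    ring

theorem shearLinear_injective {u w : E} (h : NotOpposite u w) {t : ℝ} (h0 : 0 ≤ t) (h1 : t ≤ 1) :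
    Function.Injective (shearLinear t u w) := by
  rw [injective_iff_map_eq_zero]
  intro x hx
  have hx' : shear t u w x = 0 := hx
  have h2 := shearCoeff_shear h t x
  rw [hx', show shearCoeff u w (0 : E) = 0 by simp [shearCoeff]] at h2
  have h3 : shearCoeff u w x = 0 :=
    (mul_eq_zero.1 h2.symm).resolve_right (shearCoeff_shear_pos h h0 h1).ne'
  rwa [shear, h3, mul_zero, zero_smul, add_zero] at hx'

/-- The motion from `w` back to `u` is the reverse of that from `u` to `w`. -/
theorem shear_shear_one {u w : E} (h : NotOpposite u w) (s : ℝ) (x : E) :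
    shear s w u (shear 1 u w x) = shear (1 - s) u w x := by
  have h1 : shearCoeff w u (shear 1 u w x) = shearCoeff u w x := by
    have e1 : ∀ y, shearCoeff w u y = ⟪y, ‖w‖ • u + ‖u‖ • w⟫_ℝ / ⟪w, ‖w‖ • u + ‖u‖ • w⟫_ℝ :=
      fun y => by rw [shearCoeff, add_comm]
    have e2 : ∀ y, shearCoeff w u y = shearCoeff u w y / shearCoeff u w w := fun y => by
      rw [e1, shearCoeff, shearCoeff, div_div_div_cancel_right₀ h.inner_left_pos.ne']
    have h2 : 0 < shearCoeff u w w := div_pos h.inner_right_pos h.inner_left_pos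
    rw [e2, shearCoeff_shear h]
    field_simp
    ring
  rw [shear, h1, shear, shear]
  module

theorem continuous_shear {X : Type*} [TopologicalSpace X] {t : X → ℝ} {u w x : X → E}
    (ht : Continuous t) (hu : Continuous u) (hw : Continuous w) (hx : Continuous x)
    (h : ∀ y, NotOpposite (u y) (w y)) : Continuous fun y => shear (t y) (u y) (w y) (x y) := by
  have h1 : Continuous fun y => shearCoeff (u y) (w y) (x y) := by
    unfold shearCoeff
    exact Continuous.div (by fun_prop) (by fun_prop) fun y => (h y).inner_left_pos.ne'
  unfold shear
  fun_prop

end Shear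

/-- The change of frame is triangular with ones on the diagonal, since `c 0 = 0` fixes the first
vector. -/
theorem linearIndependent_sub_smul {E : Type*} [AddCommGroup E] [Module ℝ E] {k : ℕ}
    {v : Fin (k + 1) → E} (hv : LinearIndependent ℝ v) (c : Fin (k + 1) → ℝ) (hc : c 0 = 0) :
    LinearIndependent ℝ fun i => v i - c i • v 0 := by
  rw [Fintype.linearIndependent_iff] at hv ⊢
  intro a ha
  have h1 : ∑ i, (a i - if i = 0 then ∑ j, a j * c j else 0) • v i = 0 := by
    rw [← ha]
    simp only [smul_sub, sub_smul, Finset.sum_sub_distrib, ite_smul, zero_smul,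
      Finset.sum_ite_eq', Finset.mem_univ, if_true, Finset.sum_smul, smul_smul]
  have h2 := hv _ h1
  have h3 : ∀ i : Fin k, a i.succ = 0 := fun i => by
    simpa [Fin.succ_ne_zero] using h2 i.succ
  have h4 : a 0 = 0 := by
    have := h2 0
    simpa [Fin.sum_univ_succ, h3, hc] using this
  exact Fin.cases h4 h3

/-! ### Connectedness over adapted frames -/

section Adapted

variable {m : ℕ} {Q : Type u} [TopologicalSpace Q] [ChartedSpace (Euc (m + 1)) Q]
  [IsManifold (𝓡 (m + 1)) ∞ Q] {V : Type*} [NormedAddCommGroup V] [NormedSpace ℝ V]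

/-- The set is the complement of the line spanned by `e`, and `2 ≤ m` gives this line codimension at
least two. -/
theorem isConnected_notOpposite (hm : 2 ≤ m) {e : Euc (m + 1)} (he : e ≠ 0) :
    IsConnected {w : Euc (m + 1) | NotOpposite w e ∧ NotOpposite w (-e)} := by
  have h1 : {w : Euc (m + 1) | NotOpposite w e ∧ NotOpposite w (-e)} =
      ((Submodule.span ℝ {e} : Submodule ℝ (Euc (m + 1))) : Set (Euc (m + 1)))ᶜ := by
    ext w
    constructor
    · rintro ⟨h1, h2⟩ hw
      obtain ⟨c, rfl⟩ := Submodule.mem_span_singleton.1 hw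
      rw [NotOpposite, real_inner_smul_left, norm_smul] at h1 h2
      rw [inner_neg_right, norm_neg] at h2
      rw [real_inner_self_eq_norm_sq, Real.norm_eq_abs] at h1 h2
      rcases le_total 0 c with hc | hc
      · rw [abs_of_nonneg hc] at h2
        nlinarith
      · rw [abs_of_nonpos hc] at h1
        nlinarith
    · intro hw
      exact ⟨notOpposite_of_notMem_span he hw,
        notOpposite_of_notMem_span (neg_ne_zero.2 he) fun h => hw (by
          obtain ⟨c, rfl⟩ := Submodule.mem_span_singleton.1 h
          exact Submodule.mem_span_singleton.2 ⟨-c, by simp⟩)⟩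
  rw [h1]
  refine (isPathConnected_compl_of_one_lt_codim ?_).isConnected
  have h2 := (Submodule.span ℝ {e}).finrank_quotient_add_finrank
  rw [finrank_span_singleton he, finrank_euclideanSpace_fin] at h2
  rw [← Module.finrank_eq_rank]
  exact_mod_cast (by omega : 1 < Module.finrank ℝ (Euc (m + 1) ⧸ Submodule.span ℝ {e}))

/-- Over the frames at a point with a given first vector and the others in a given complementary
hyperplane, a spin structure is connected, if the hyperplane has dimension at least `2`. -/
theorem SpinStructure.isConnected_adapted (T : TangentEmbedding (m + 1) Q V)
    (σ : SpinStructure (𝓡 (m + 1)) (univ : Set Q) (m + 1)) (hm : 2 ≤ m) (q : Q)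
    (e : Euc (m + 1)) (l : Euc (m + 1) →L[ℝ] ℝ) (hl : l e = 1) :
    IsConnected {c : σ.cover | (σ.proj c).pt = q ∧ (σ.proj c).vecE 0 = e ∧
      ∀ i : Fin m, l ((σ.proj c).vecE i.succ) = 0} := by
  have he : e ≠ 0 := by rintro rfl; simp at hl
  have hX : IsConnected {c : σ.cover | (σ.proj c).pt = q} :=
    σ.nontrivial (by omega) q (mem_univ q)
  have : ConnectedSpace (σ.CoverAt q) := isConnected_iff_connectedSpace.1 hX
  have hvecs := σ.continuous_vecs T q
  let v : σ.CoverAt q → Euc (m + 1) := fun c => σ.vecs c 0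
  have hv : Continuous v := (continuous_apply 0).comp hvecs
  have hv0 : ∀ c, v c ≠ 0 := fun c => (σ.linearIndependent_vecs c).ne_zero 0
  -- The shear taking the first vector to a new one is applied to the whole frame and lifted to the
  -- covering. The map at time `1` moves points of the covering between fibres of `v`.
  obtain ⟨D, hD, hDv, hD0⟩ := σ.exists_lift_frames (q := q)
    (A := {z : σ.CoverAt q × Euc (m + 1) // NotOpposite (v z.1) z.2})
    (w := fun z i => shear (z.1 : ℝ) (v z.2.1.1) z.2.1.2 (σ.vecs z.2.1.1 i))
    (continuous_pi fun i => continuous_shear (by fun_prop) (by fun_prop) (by fun_prop)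
      (by fun_prop) fun z => z.2.2)
    (fun z => (σ.linearIndependent_vecs z.2.1.1).map' (shearLinear (z.1 : ℝ) (v z.2.1.1) z.2.1.2)
      (LinearMap.ker_eq_bot.2 (shearLinear_injective z.2.2 z.1.2.1 z.1.2.2)))
    (f := fun a => a.1.1) (by fun_prop)
    (fun a => funext fun i => shear_zero _ _ _)
  let Tr : {z : σ.CoverAt q × Euc (m + 1) // NotOpposite (v z.1) z.2} → σ.CoverAt q := fun a => D (1, a)
  have hTr : Continuous Tr := hD.comp (by fun_prop)
  have hTrv : ∀ a i, σ.vecs (Tr a) i = shear 1 (v a.1.1) a.1.2 (σ.vecs a.1.1 i) := fun a i =>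
    congrFun (hDv (1, a)) i
  have h1 : ∀ a, v (Tr a) = a.1.2 := fun a => (hTrv a 0).trans (shear_one_self a.2)
  have h2 : ∀ c h, Tr ⟨(c, v c), h⟩ = c := by
    intro c h
    have e1 := σ.eq_of_vecs_eq (γ := fun t => D (t, ⟨(c, v c), h⟩)) (γ' := fun _ => c)
      (hD.comp (by fun_prop)) continuous_const
      (fun t => (hDv _).trans (funext fun i => shear_self _ _ _)) (t₀ := 0) (hD0 _)
    exact congrFun e1 1
  have h3 : ∀ z h, Tr ⟨(Tr z, v z.1.1), h⟩ = z.1.1 := by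
    intro z h
    have e1 := σ.eq_of_vecs_eq (γ := fun t => D (t, ⟨(Tr z, v z.1.1), h⟩))
      (γ' := fun t => D (unitInterval.symm t, z)) (hD.comp (by fun_prop)) (hD.comp (by fun_prop))
      (fun t => by
        funext i
        rw [hDv]
        dsimp only
        rw [h1, hTrv, hDv]
        exact shear_shear_one z.2 _ _) (t₀ := 0) (by
          rw [hD0]
          simp only [unitInterval.symm_zero]
          rfl)
    refine (congrFun e1 1).trans ?_
    simp only [unitInterval.symm_one]
    exact hD0 z
  obtain ⟨⟨w₀, hw₀⟩, hW⟩ := isConnected_notOpposite hm he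
  have hZ : IsPreconnected (v ⁻¹' {e}) :=
    isPreconnected_fiber_of_transport hv hv0 Tr hTr h1 h2 h3 he hw₀ hW
  -- If the first vector may be opposite to `e`, the detour through `-e` and `w₀` reaches `e` by
  -- admissible shears.
  obtain ⟨z₀, hz₀⟩ : (v ⁻¹' {e}).Nonempty := by
    obtain ⟨c⟩ : Nonempty (σ.CoverAt q) := inferInstance
    rcases notOpposite_or (hv0 c) he with h | h
    · exact ⟨Tr ⟨(c, e), h⟩, h1 _⟩
    · let c₁ := Tr ⟨(c, -e), h⟩
      have hc₁ : v c₁ = -e := h1 _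
      let c₂ := Tr ⟨(c₁, w₀), by rw [hc₁]; exact hw₀.2.symm⟩
      have hc₂ : v c₂ = w₀ := h1 _
      exact ⟨Tr ⟨(c₂, e), by rw [hc₂]; exact hw₀.1⟩, h1 _⟩
  let δ : Fin (m + 1) → ℝ := fun i => if i = 0 then 1 else 0
  have hδ : ∀ i : Fin m, δ i.succ = 0 := fun i => if_neg (Fin.succ_ne_zero i)
  -- The other vectors slide parallel to `e` into the kernel of `l`; `δ` lists the values of `l` at
  -- the end. Adapted frames do not move, so the end map `ρ` is onto the set in question and carries
  -- over connectedness.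
  obtain ⟨D', hD', hDv', hD0'⟩ := σ.exists_lift_frames (q := q)
    (A := {c : σ.CoverAt q // v c = e})
    (w := fun z i => σ.vecs z.2.1 i - ((z.1 : ℝ) * (l (σ.vecs z.2.1 i) - δ i)) • e)
    (by fun_prop)
    (fun z => by
      have h4 := linearIndependent_sub_smul (σ.linearIndependent_vecs z.2.1)
        (fun i => (z.1 : ℝ) * (l (σ.vecs z.2.1 i) - δ i)) (by
          have h5 : σ.vecs z.2.1 0 = e := z.2.2
          simp [h5, hl, δ])
      have h5 : σ.vecs z.2.1 0 = e := z.2.2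
      rwa [h5] at h4) (f := fun a => a.1) (by fun_prop)
    (fun a => funext fun i => by simp)
  let ρ : {c : σ.CoverAt q // v c = e} → σ.cover := fun z => (D' (1, z)).1
  have hρ : Continuous ρ := continuous_subtype_val.comp (hD'.comp (by fun_prop))
  have hρv : ∀ z i, (σ.proj (ρ z)).vecE i =
      σ.vecs z.1 i - (1 * (l (σ.vecs z.1 i) - δ i)) • e := fun z i => congrFun (hDv' (1, z)) i
  have hZc : ConnectedSpace {c : σ.CoverAt q // v c = e} :=
    isConnected_iff_connectedSpace.1 ⟨⟨z₀, hz₀⟩, hZ⟩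
  have himg : {c : σ.cover | (σ.proj c).pt = q ∧ (σ.proj c).vecE 0 = e ∧
      ∀ i : Fin m, l ((σ.proj c).vecE i.succ) = 0} = range ρ := by
    ext c
    constructor
    · rintro ⟨hc1, hc2, hc3⟩
      let z : {c : σ.CoverAt q // v c = e} := ⟨⟨c, hc1⟩, hc2⟩
      refine ⟨z, ?_⟩
      have e1 := σ.eq_of_vecs_eq (γ := fun t => D' (t, z)) (γ' := fun _ => z.1)
        (hD'.comp (by fun_prop)) continuous_const (fun t => (hDv' _).trans (funext fun i => by
          have h4 : l (σ.vecs z.1 i) - δ i = 0 := by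
            refine Fin.cases ?_ (fun j => ?_) i
            · have h5 : σ.vecs z.1 0 = e := hc2
              simp [h5, hl, δ]
            · rw [hδ, sub_zero]
              exact hc3 j
          dsimp only
          rw [h4, mul_zero, zero_smul, sub_zero])) (t₀ := 0) (hD0' _)
      exact congrArg Subtype.val (congrFun e1 1)
    · rintro ⟨z, rfl⟩
      refine ⟨(D' (1, z)).2, (hρv z 0).trans ?_, fun i => ?_⟩
      · have h5 : σ.vecs z.1 0 = e := z.2
        simp [h5, hl, δ]
      · rw [hρv, hδ, map_sub, map_smul, hl, smul_eq_mul]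
        ring
  rw [himg]
  exact isConnected_range hρ

end Adapted

/-! ### The tangent bundle of the conormal bundle as a pullback of that of `Q` -/

section CotangentTangent

variable {n : ℕ} {Q : Type u} [TopologicalSpace Q] [ChartedSpace (Euc n) Q]
  [IsManifold (𝓡 n) ∞ Q] {V : Type*} [NormedAddCommGroup V] [NormedSpace ℝ V]
  (T : TangentEmbedding n Q V)

namespace TangentEmbedding

theorem contMDiff_extend_prod : ContMDiff ((𝓡 n).prod 𝓘(ℝ, V →L[ℝ] ℝ)) (cotangentModel n) ∞
    (fun z : Q × (V →L[ℝ] ℝ) => T.extend z.2 z.1) := by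
  intro z
  refine ContMDiffWithinAt.contMDiffAt (s := univ) ?_ Filter.univ_mem
  refine T.contMDiffWithinAt_cotangent_iff.2 ⟨contMDiffWithinAt_fst, ?_⟩
  exact (contMDiff_snd.clm_comp (T.contMDiff_proj.comp contMDiff_fst)).contMDiffAt.contMDiffWithinAt

/-- A map into the tangent bundle of the cotangent bundle is continuous if its components are. -/
theorem continuous_tangentBundle_cotangent {Y : Type*} [TopologicalSpace Y]
    {G : Y → TangentBundle (cotangentModel n) (Cotangent n Q)}
    (h1 : Continuous fun y => dbaseTotal (G y)) (h2 : Continuous fun y => T.hat (G y).proj)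
    (h3 : Continuous fun y => T.dhat (G y).proj (G y).2) : Continuous G := by
  -- `μ` is a smooth left inverse of `ξ ↦ (ξ.proj, hat ξ)`, so its differential recovers a tangent
  -- vector continuously from the two components.
  let μ : Q × (V →L[ℝ] ℝ) → Cotangent n Q := fun z => T.extend z.2 z.1
  have hμ : Continuous (tangentMap ((𝓡 n).prod 𝓘(ℝ, V →L[ℝ] ℝ)) (cotangentModel n) μ) :=
    T.contMDiff_extend_prod.continuous_tangentMap (by simp)
  have h4 : Continuous fun y => (⟨T.hat (G y).proj, T.dhat (G y).proj (G y).2⟩ :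
      TangentBundle 𝓘(ℝ, V →L[ℝ] ℝ) (V →L[ℝ] ℝ)) :=
    (tangentBundleModelSpaceHomeomorph 𝓘(ℝ, V →L[ℝ] ℝ)).symm.continuous.comp (h2.prodMk h3)
  have h5 := hμ.comp ((contMDiff_equivTangentBundleProd_symm (I := 𝓡 n) (M := Q)
    (I' := 𝓘(ℝ, V →L[ℝ] ℝ)) (M' := V →L[ℝ] ℝ) (n := 0)).continuous.comp (h1.prodMk h4))
  suffices key : ∀ x : TangentBundle (cotangentModel n) (Cotangent n Q),
      (⟨μ (x.proj.proj, T.hat x.proj), mfderiv ((𝓡 n).prod 𝓘(ℝ, V →L[ℝ] ℝ)) (cotangentModel n) μ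
        (x.proj.proj, T.hat x.proj) ((dbase x.proj x.2, T.dhat x.proj x.2) : Euc n × (V →L[ℝ] ℝ))⟩ :
        TangentBundle (cotangentModel n) (Cotangent n Q)) = x from h5.congr fun y => key (G y)
  rintro ⟨ξ, v⟩
  have e1 : HasMFDerivAt (cotangentModel n) ((𝓡 n).prod 𝓘(ℝ, V →L[ℝ] ℝ))
      (fun η : Cotangent n Q => (η.proj, T.hat η)) ξ ((dbase ξ).prod (T.dhat ξ)) :=
    (hasMFDerivAt_base ξ).prodMk (T.hasMFDerivAt_hat ξ)
  have e2 : HasMFDerivAt ((𝓡 n).prod 𝓘(ℝ, V →L[ℝ] ℝ)) (cotangentModel n) μ (ξ.proj, T.hat ξ)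
      (mfderiv ((𝓡 n).prod 𝓘(ℝ, V →L[ℝ] ℝ)) (cotangentModel n) μ (ξ.proj, T.hat ξ)) :=
    ((T.contMDiff_extend_prod _).mdifferentiableAt (by simp)).hasMFDerivAt
  have e3 := HasMFDerivAt.comp ξ e2 e1
  have e4 : μ ∘ (fun η : Cotangent n Q => (η.proj, T.hat η)) = id :=
    funext fun η => T.extend_hat η
  rw [e4] at e3
  have e5 := DFunLike.congr_fun (hasMFDerivAt_unique e3 (hasMFDerivAt_id ξ)) v
  have e6 : μ (ξ.proj, T.hat ξ) = ξ := T.extend_hat ξ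
  refine Bundle.TotalSpace.ext e6 (heq_of_eq ?_)
  exact e5

end TangentEmbedding

end CotangentTangent

theorem exists_inverse_of_injOn {E F : Type*} [NormedAddCommGroup E] [NormedSpace ℝ E]
    [FiniteDimensional ℝ E] [NormedAddCommGroup F] [NormedSpace ℝ F] [FiniteDimensional ℝ F]
    {W : Submodule ℝ E} {A : E →L[ℝ] F} (hA : ∀ v ∈ W, A v = 0 → v = 0)
    (hd : Module.finrank ℝ W = Module.finrank ℝ F) :
    ∃ R : F →L[ℝ] E, (∀ w, R w ∈ W) ∧ (∀ w, A (R w) = w) ∧ ∀ v ∈ W, R (A v) = v := by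
  let L : W →ₗ[ℝ] F := A.toLinearMap ∘ₗ W.subtype
  have hL : Function.Injective L := by
    rw [injective_iff_map_eq_zero]
    exact fun v hv => Subtype.ext (hA v v.2 hv)
  let e := LinearMap.linearEquivOfInjective L hL hd
  refine ⟨(W.subtype ∘ₗ e.symm.toLinearMap).toContinuousLinearMap,
    fun w => (e.symm w).2, fun w => e.apply_symm_apply w, fun v hv => ?_⟩
  exact congrArg Subtype.val (e.symm_apply_apply ⟨v, hv⟩)

section ConormalMap

variable {n k : ℕ} {Q : Type u} [TopologicalSpace Q] [ChartedSpace (Euc n) Q]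
  [IsManifold (𝓡 n) ∞ Q] {V : Type*} [NormedAddCommGroup V] [NormedSpace ℝ V]
  (T : TangentEmbedding n Q V) (g : RiemMetric n Q) {K : Set Q}

namespace TangentEmbedding

/-- The map from the tangent spaces of the conormal bundle to those of `Q`, given by the
projection and by the normal part of the vertical component. -/
def conormalMap (K : Set Q) (ξ : Cotangent n Q) : CotModel n →L[ℝ] Euc n :=
  dbase ξ + T.retr ξ.proj ∘L ((ContinuousLinearMap.id ℝ V - T.tangentProj g K ξ.proj) ∘L
    (T.sharpHat g ξ.proj ∘L T.dhat ξ))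

theorem incl_conormalMap (ξ : Cotangent n Q) (v : CotModel n) :
    T.incl ξ.proj (T.conormalMap g K ξ v) = T.incl ξ.proj (dbase ξ v) +
      (T.sharpHat g ξ.proj (T.dhat ξ v) -
        T.tangentProj g K ξ.proj (T.sharpHat g ξ.proj (T.dhat ξ v))) := by
  change T.incl ξ.proj (dbase ξ v + T.retr ξ.proj (T.sharpHat g ξ.proj (T.dhat ξ v) -
        T.tangentProj g K ξ.proj (T.sharpHat g ξ.proj (T.dhat ξ v)))) = _
  rw [map_add]
  congr 1
  change T.proj ξ.proj _ = _
  rw [map_sub, T.proj_tangentProj]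
  congr 1
  exact T.proj_incl _ _

theorem conormalMap_of_dhat (ξ : Cotangent n Q) {v : CotModel n} {η : Euc n →L[ℝ] ℝ}
    (hv : T.dhat ξ v = η ∘L T.retr ξ.proj) (hη : ∀ w ∈ tanE n K ξ.proj, η w = 0) :
    T.conormalMap g K ξ v = dbase ξ v + sharp g ξ.proj η := by
  apply T.incl_injective ξ.proj
  have h1 : T.sharpHat g ξ.proj (T.dhat ξ v) = T.incl ξ.proj (sharp g ξ.proj η) := by
    rw [hv, sharpHat_apply]
    congr 2
    ext1 w
    exact congrArg η (T.retr_incl _ _)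
  rw [incl_conormalMap, h1, T.tangentProj_eq_zero g (fun w hw => ?_), sub_zero, map_add]
  rw [T.retr_incl, gE_sharp]
  exact hη w hw

theorem conormalMap_vert (ξ : Cotangent n Q) {η : Euc n →L[ℝ] ℝ}
    (hη : ∀ w ∈ tanE n K ξ.proj, η w = 0) : T.conormalMap g K ξ (vert ξ η) = sharp g ξ.proj η := by
  rw [T.conormalMap_of_dhat g ξ (T.dhat_vert ξ η) hη, T.dbase_vert, zero_add]

/-- Pairing the image with `dbase ξ v`, which is tangent to `K`, removes the normal summand and
gives `dbase ξ v = 0`. So `v` is the vertical lift of a conormal covector, and on these the map is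
`sharp`. -/
theorem conormalMap_injOn (hK : IsSubmanifold (𝓡 n) k K) {ξ : Cotangent n Q}
    (hξ : ξ ∈ conormalBundle K) {v : CotModel n} (hv : v ∈ tanC n (conormalBundle K) ξ)
    (h0 : T.conormalMap g K ξ v = 0) : v = 0 := by
  have hb := dbase_mem_tanE hv
  have h1 := T.incl_conormalMap g (K := K) ξ v
  rw [h0, map_zero] at h1
  have h2 : dbase ξ v = 0 := by
    by_contra hne
    have h3 := congrArg (fun z => gE g ξ.proj (T.retr ξ.proj z) (dbase ξ v)) h1
    simp only [map_add, map_sub, map_zero, add_apply, sub_apply, zero_apply,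
      T.gE_tangentProj g _ hb, sub_self, add_zero, T.retr_incl] at h3
    exact (gE_pos g ξ.proj hne).ne h3
  have h4 := T.eq_vert_of_dbase_eq_zero ξ h2
  set η := T.dhat ξ v ∘L T.incl ξ.proj with hη
  have h5 : ∀ w ∈ tanE n K ξ.proj, η w = 0 := (T.vert_mem_tanC_iff hK hξ η).1 (h4 ▸ hv)
  rw [h4, T.conormalMap_vert g ξ h5] at h0
  have h6 : η = 0 := by rw [← gE_sharp g ξ.proj η, h0, map_zero]
  rw [h4, h6, map_zero]

/-- The map `conormalMap` has an inverse on the tangent space of the conormal bundle. -/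
theorem exists_conormalMap_inverse (hK : IsSubmanifold (𝓡 n) k K) {ξ : Cotangent n Q}
    (hξ : ξ ∈ conormalBundle K) :
    ∃ R : Euc n →L[ℝ] CotModel n, (∀ w, R w ∈ tanC n (conormalBundle K) ξ) ∧
      (∀ w, T.conormalMap g K ξ (R w) = w) ∧
      ∀ v ∈ tanC n (conormalBundle K) ξ, R (T.conormalMap g K ξ v) = v := by
  refine exists_inverse_of_injOn (fun v hv h0 => T.conormalMap_injOn g hK hξ hv h0) ?_
  rw [finrank_euclideanSpace_fin]
  exact (T.isSubmanifold_conormalBundle hK).finrank_tangentSpaceOf hξ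

/-- The map `conormalMap`, as a map of tangent bundles. -/
def conormalTotal (K : Set Q) (v : TangentBundle (cotangentModel n) (Cotangent n Q)) :
    TangentBundle (𝓡 n) Q := ⟨v.proj.proj, T.conormalMap g K v.proj v.2⟩

/-- The submanifold `L y` may vary, as it does along an isotopy; only its tangent projection has to
be continuous. -/
theorem continuous_conormalTotal {Y : Type*} [TopologicalSpace Y]
    {G : Y → TangentBundle (cotangentModel n) (Cotangent n Q)} {L : Y → Set Q}
    (hG : Continuous G) (hL : Continuous fun y => T.tangentProj g (L y) (G y).proj.proj) :
    Continuous fun y => T.conormalTotal g (L y) (G y) := by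
  have hb : Continuous fun y => (G y).proj := (Bundle.contMDiff_proj (IB := cotangentModel n)
    (n := 0) (TangentSpace (cotangentModel n))).continuous.comp hG
  have hq : Continuous fun y => (G y).proj.proj := contMDiff_base.continuous.comp hb
  refine T.continuous_tangentBundle hq ?_
  have h1 : Continuous fun y => T.total (dbaseTotal (G y)) :=
    T.contMDiff_total.continuous.comp (continuous_dbaseTotal.comp hG)
  have h2 : Continuous fun y => T.sharpHat g (G y).proj.proj (T.dhat (G y).proj (G y).2) :=
    ((T.contMDiff_sharpHat g).continuous.comp hq).clm_apply (T.continuous_dhat.comp hG)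
  refine (h1.add (h2.sub (hL.clm_apply h2))).congr fun y => ?_
  exact (T.incl_conormalMap g (G y).proj (G y).2).symm

theorem linearIndependent_conormalMap (hK : IsSubmanifold (𝓡 n) k K) {ξ : Cotangent n Q}
    (hξ : ξ ∈ conormalBundle K) {ι : Type*} {v : ι → CotModel n} (hv : LinearIndependent ℝ v)
    (ht : ∀ i, v i ∈ tanC n (conormalBundle K) ξ) :
    LinearIndependent ℝ fun i => T.conormalMap g K ξ (v i) := by
  refine hv.map (f := (T.conormalMap g K ξ).toLinearMap) ?_
  rw [Submodule.disjoint_def]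
  intro w hw hw0
  have hw' : w ∈ tanC n (conormalBundle K) ξ :=
    (Submodule.span_le.2 (by rintro _ ⟨i, rfl⟩; exact ht i) :
      Submodule.span ℝ (range v) ≤ tanC n (conormalBundle K) ξ) hw
  exact T.conormalMap_injOn g hK hξ hw' hw0

/-- The frame of `Q` given by a frame of the conormal bundle. -/
def conormalFrame (hK : IsSubmanifold (𝓡 n) k K)
    (f : TangentFrame (cotangentModel n) (conormalBundle K : Set (Cotangent n Q)) n) :
    TangentFrame (𝓡 n) (univ : Set Q) n :=
  mkFrame f.pt.proj (fun i => T.conormalMap g K f.pt (f.vecE i))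
    (T.linearIndependent_conormalMap g hK f.mem f.linearIndependent_vecE f.tangent)

theorem conormalFrame_toBundle (hK : IsSubmanifold (𝓡 n) k K)
    (f : TangentFrame (cotangentModel n) (conormalBundle K : Set (Cotangent n Q)) n) (i : Fin n) :
    (T.conormalFrame g hK f).toBundle i = T.conormalTotal g K (f.toBundle i) := rfl

theorem continuous_conormalFrame (hK : IsSubmanifold (𝓡 n) k K) :
    Continuous (T.conormalFrame g hK) := by
  have hpt : Continuous fun f : TangentFrame (cotangentModel n)
      (conormalBundle K : Set (Cotangent n Q)) n => f.pt.proj :=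
    contMDiff_base.continuous.comp TangentFrame.continuous_pt
  refine TangentFrame.continuous_of hpt fun i => ?_
  refine T.continuous_conormalTotal g (L := fun _ => K) (TangentFrame.continuous_toBundle i) ?_
  exact (T.continuousOn_tangentProj g hK).comp_continuous hpt fun f => f.mem.1

theorem dbase_zeroSectionVector (T : TangentEmbedding n Q V) (q : Q) (a w : Euc n) :
    dbase (zeroCovector q) (zeroSectionVector g q a w) = a ∧
      T.dhat (zeroCovector q) (zeroSectionVector g q a w) = gE g q w ∘L T.retr q := by
  have hz : ContMDiff (𝓡 n) (cotangentModel n) ∞ (zeroCovector : Q → Cotangent n Q) :=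
    (T.contMDiff_extend 0).congr fun q => by
      rw [extend, ContinuousLinearMap.zero_comp]; rfl
  let Z : Euc n →L[ℝ] CotModel n :=
    mfderiv (𝓡 n) (cotangentModel n) (zeroCovector : Q → Cotangent n Q) q
  have hZ : HasMFDerivAt (𝓡 n) (cotangentModel n) (zeroCovector : Q → Cotangent n Q) q Z :=
    ((hz q).mdifferentiableAt (by simp)).hasMFDerivAt
  have e0 : zeroSectionVector g q a w = Z a + vert (zeroCovector q) (gE g q w) :=
    congrArg (fun z => Z a + z) (T.verticalLift_eq_vert (zeroCovector q) (gE g q w))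
  have e1 : dbase (zeroCovector q) (Z a) = a := by
    have h1 := HasMFDerivAt.comp q (hasMFDerivAt_base (zeroCovector q)) hZ
    have h2 : HasMFDerivAt (𝓡 n) (𝓡 n)
      ((fun η : Cotangent n Q => η.proj) ∘ zeroCovector) q (ContinuousLinearMap.id ℝ (Euc n)) :=
      hasMFDerivAt_id q
    exact DFunLike.congr_fun (hasMFDerivAt_unique h1 h2) a
  have e2 : T.dhat (zeroCovector q) (Z a) = 0 := by
    have h1 := HasMFDerivAt.comp q (T.hasMFDerivAt_hat (zeroCovector q)) hZ
    have h3 : T.hat ∘ zeroCovector = fun _ : Q => (0 : V →L[ℝ] ℝ) :=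
      funext fun q => ContinuousLinearMap.zero_comp _
    rw [h3] at h1
    exact DFunLike.congr_fun (hasMFDerivAt_unique h1 (hasMFDerivAt_const _ _)) a
  rw [e0, map_add, map_add, e1, e2, T.dbase_vert, T.dhat_vert, add_zero, zero_add]
  exact ⟨rfl, rfl⟩

end TangentEmbedding

end ConormalMap

/-! ### Spin structures by pullback; the conormal bundle -/

section PullbackSpin

variable {E E' H H' : Type} [NormedAddCommGroup E] [NormedSpace ℝ E]
  [NormedAddCommGroup E'] [NormedSpace ℝ E'] [TopologicalSpace H] [TopologicalSpace H']
  {I : ModelWithCorners ℝ E H} {I' : ModelWithCorners ℝ E' H'}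
  {M M' : Type u} [TopologicalSpace M] [ChartedSpace H M] [IsManifold I ∞ M]
  [TopologicalSpace M'] [ChartedSpace H' M'] [IsManifold I' ∞ M']

/-- The spin structure on `S` whose covering is the pullback of that of `σ` by the map `Φ` of
frame bundles. -/
def SpinStructure.pullback {S : Set M} {S' : Set M'} {k k' : ℕ} (σ : SpinStructure I' S' k')
    (Φ : TangentFrame I S k → TangentFrame I' S' k') (hΦ : Continuous Φ)
    (P : Set (TangentFrame I S k)) (hP : IsClopen P)
    (hA : ∀ (f f' : TangentFrame I S k) (A : Matrix (Fin k) (Fin k) ℝ), f'.pt = f.pt →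
      (∀ i, f'.toBundle i = ⟨f.pt, ∑ j, A i j • f.vec j⟩) → (f' ∈ P ↔ (f ∈ P ↔ 0 < A.det)))
    (hr : ∀ f, Φ f ∈ range σ.proj ↔ k = 0 ∨ f ∈ P)
    (hc : 2 ≤ k → ∀ x ∈ S,
      IsConnected {z : {z : TangentFrame I S k × σ.cover // σ.proj z.2 = Φ z.1} | z.1.1.pt = x}) :
    SpinStructure I S k where
  positive := P
  isClopen_positive := hP
  positive_iff := hA
  cover := {z : TangentFrame I S k × σ.cover // σ.proj z.2 = Φ z.1}
  proj := fun z => z.1.1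
  isCoveringMap := σ.isCoveringMap.pullback hΦ
  range_proj := by
    ext f
    rw [mem_ofPred_eq, ← hr f]
    constructor
    · rintro ⟨z, rfl⟩
      exact ⟨z.1.2, z.2⟩
    · rintro ⟨c, hc⟩
      exact ⟨⟨(f, c), hc⟩, rfl⟩
  ncard_fiber := by
    rintro _ ⟨z, rfl⟩
    rw [← σ.ncard_fiber (Φ z.1.1) ⟨z.1.2, z.2⟩]
    refine ncard_congr (fun y _ => y.1.2) ?_ ?_ ?_
    · rintro y hy
      have hy' : y.1.1 = z.1.1 := hy
      rw [mem_preimage, mem_singleton_iff, y.2, hy']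
    · intro y y' hy hy' h
      exact Subtype.ext (Prod.ext (hy.trans hy'.symm) h)
    · intro c hc
      exact ⟨⟨(z.1.1, c), hc⟩, rfl, rfl⟩
  nontrivial := hc

end PullbackSpin

section ConormalSpin

variable {m k : ℕ} {Q : Type u} [TopologicalSpace Q] [ChartedSpace (Euc (m + 1)) Q]
  [IsManifold (𝓡 (m + 1)) ∞ Q] {V : Type*} [NormedAddCommGroup V] [NormedSpace ℝ V]
  (T : TangentEmbedding (m + 1) Q V) (g : RiemMetric (m + 1) Q) {K : Set Q}
  (hK : IsSubmanifold (𝓡 (m + 1)) k K)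
  (σQ : SpinStructure (𝓡 (m + 1)) (univ : Set Q) (m + 1))

theorem SpinStructure.mem_range_proj_iff (f : TangentFrame (𝓡 (m + 1)) (univ : Set Q) (m + 1)) :
    f ∈ range σQ.proj ↔ f ∈ σQ.positive := by
  rw [σQ.range_proj, mem_ofPred_eq]
  simp

namespace TangentEmbedding

theorem conormalFrame_combination
    {f f' : TangentFrame (cotangentModel (m + 1))
      (conormalBundle K : Set (Cotangent (m + 1) Q)) (m + 1)}
    {A : Matrix (Fin (m + 1)) (Fin (m + 1)) ℝ}
    (h : ∀ i, f'.toBundle i = ⟨f.pt, ∑ j, A i j • f.vec j⟩) (i : Fin (m + 1)) :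
    (T.conormalFrame g hK f').toBundle i =
      ⟨(T.conormalFrame g hK f).pt, ∑ j, A i j • (T.conormalFrame g hK f).vec j⟩ := by
  rw [conormalFrame_toBundle, h i]
  have h1 : T.conormalMap g K f.pt (∑ j, A i j • f.vecE j) =
      ∑ j, A i j • T.conormalMap g K f.pt (f.vecE j) := by
    rw [map_sum]
    exact Finset.sum_congr rfl fun j _ => map_smul _ _ _
  exact congrArg (Bundle.TotalSpace.mk (E := (TangentSpace (𝓡 (m + 1)) : Q → Type)) f.pt.proj) h1

/-- The frame of the conormal bundle at `ξ` given by a frame of `Q`. -/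
def inverseFrame {ξ : Cotangent (m + 1) Q} (hξ : ξ ∈ conormalBundle K)
    {R : Euc (m + 1) →L[ℝ] CotModel (m + 1)} (hR : ∀ w, R w ∈ tanC (m + 1) (conormalBundle K) ξ)
    {w : Fin (m + 1) → Euc (m + 1)} (hw : LinearIndependent ℝ fun i => R (w i)) :
    TangentFrame (cotangentModel (m + 1)) (conormalBundle K : Set (Cotangent (m + 1) Q)) (m + 1) where
  pt := ξ
  mem := hξ
  vec := fun i => R (w i)
  tangent := fun i => hR (w i)
  indep := hw

/-- The spin structure of the conormal bundle. -/
def conormalSpin : SpinStructure (cotangentModel (m + 1))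
    (conormalBundle K : Set (Cotangent (m + 1) Q)) (m + 1) :=
  σQ.pullback (T.conormalFrame g hK) (T.continuous_conormalFrame g hK)
    (T.conormalFrame g hK ⁻¹' σQ.positive)
    (σQ.isClopen_positive.preimage (T.continuous_conormalFrame g hK))
    (fun f f' A hp h => σQ.positive_iff (T.conormalFrame g hK f) (T.conormalFrame g hK f') A
      (congrArg Bundle.TotalSpace.proj hp) (T.conormalFrame_combination g hK h))
    (fun f => by rw [σQ.mem_range_proj_iff]; simp)
    (fun hm ξ hξ => by
      -- By `R`, the frames of the conormal bundle at `ξ` are the frames of `Q` at `ξ.proj`. The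
      -- fibre to be treated is therefore a continuous image of the connected fibre of `σQ`.
      obtain ⟨R, hR1, hR2, hR3⟩ := T.exists_conormalMap_inverse g hK hξ
      have hRi : Function.Injective R := Function.LeftInverse.injective hR2
      have hcon : ConnectedSpace (σQ.CoverAt ξ.proj) :=
        isConnected_iff_connectedSpace.1 (σQ.nontrivial hm ξ.proj (mem_univ _))
      have hli : ∀ c : σQ.CoverAt ξ.proj, LinearIndependent ℝ fun i => R (σQ.vecs c i) := fun c =>
        (σQ.linearIndependent_vecs c).map' R.toLinearMap (LinearMap.ker_eq_bot.2 hRi)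
      let F : σQ.CoverAt ξ.proj → {z : TangentFrame (cotangentModel (m + 1))
          (conormalBundle K : Set (Cotangent (m + 1) Q)) (m + 1) × σQ.cover //
          σQ.proj z.2 = T.conormalFrame g hK z.1} := fun c =>
        ⟨(inverseFrame hξ hR1 (hli c), c.1), (σQ.proj_eq c).trans (mkFrame_congr _ _
          (funext fun i => (hR2 (σQ.vecs c i)).symm))⟩
      have hF : Continuous F := by
        refine Continuous.subtype_mk (Continuous.prodMk ?_ continuous_subtype_val) _
        refine TangentFrame.continuous_of continuous_const fun i => ?_
        exact (FiberBundle.continuous_totalSpaceMk (CotModel (m + 1))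
          (TangentSpace (cotangentModel (m + 1))) ξ).comp (R.continuous.comp
            ((continuous_apply i).comp (σQ.continuous_vecs T ξ.proj)))
      have himg : {z : {z : TangentFrame (cotangentModel (m + 1))
          (conormalBundle K : Set (Cotangent (m + 1) Q)) (m + 1) × σQ.cover //
          σQ.proj z.2 = T.conormalFrame g hK z.1} | z.1.1.pt = ξ} = range F := by
        ext z
        constructor
        · rintro rfl
          obtain ⟨⟨f, c⟩, hz⟩ := z
          dsimp only at hz hξ R hR1 hR2 hR3
          have hc : (σQ.proj c).pt = f.pt.proj := by rw [hz]; rfl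
          refine ⟨⟨c, hc⟩, Subtype.ext (Prod.ext (TangentFrame.ext_toBundle rfl fun i => ?_) rfl)⟩
          have h1 : σQ.vecs (⟨c, hc⟩ : σQ.CoverAt f.pt.proj) =
              fun i => T.conormalMap g K f.pt (f.vecE i) := by
            change (σQ.proj c).vecE = _
            rw [hz]
            rfl
          have h2 : R (σQ.vecs (⟨c, hc⟩ : σQ.CoverAt f.pt.proj) i) = f.vecE i := by
            rw [h1]
            exact hR3 _ (f.tangent i)
          exact congrArg (Bundle.TotalSpace.mk
            (E := (TangentSpace (cotangentModel (m + 1)) : Cotangent (m + 1) Q → Type)) f.pt) h2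
        · rintro ⟨c, rfl⟩
          rfl
      rw [himg]
      exact isConnected_range hF)

end TangentEmbedding

end ConormalSpin

/-! ### The spin structure of the unit conormal bundle -/

section UnitConormalSpin

variable {m k : ℕ} {Q : Type u} [TopologicalSpace Q] [ChartedSpace (Euc (m + 1)) Q]
  [IsManifold (𝓡 (m + 1)) ∞ Q] {V : Type*} [NormedAddCommGroup V] [NormedSpace ℝ V]
  (T : TangentEmbedding (m + 1) Q V) (g : RiemMetric (m + 1) Q) {K : Set Q}
  (hK : IsSubmanifold (𝓡 (m + 1)) k K)
  (σQ : SpinStructure (𝓡 (m + 1)) (univ : Set Q) (m + 1))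

/-- The matrix of a change of frame after the radial vector has been put in front. -/
theorem det_cons_one {m : ℕ} (A : Matrix (Fin m) (Fin m) ℝ) :
    (Matrix.of (Fin.cons (Fin.cons 1 0) fun i => Fin.cons 0 (A i)) :
      Matrix (Fin (m + 1)) (Fin (m + 1)) ℝ).det = A.det := by
  rw [Matrix.det_succ_row_zero, Fin.sum_univ_succ]
  simp only [Matrix.of_apply, Fin.cons_zero, Fin.cons_succ, Pi.zero_apply, mul_zero, zero_mul,
    Finset.sum_const_zero, add_zero, Fin.val_zero, pow_zero, mul_one, one_mul]
  congr 1

theorem SpinStructure.mem_positive_iff_of_neg (hm : m = 0)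
    {f f' : TangentFrame (𝓡 (m + 1)) (univ : Set Q) (m + 1)} (hp : f'.pt = f.pt)
    (h : f'.vecE 0 = -f.vecE 0) : f' ∈ σQ.positive ↔ f ∉ σQ.positive := by
  have hd : (Matrix.diagonal fun _ => -1 : Matrix (Fin (m + 1)) (Fin (m + 1)) ℝ).det = -1 := by
    rw [Matrix.det_diagonal, Finset.prod_const, Finset.card_univ, Fintype.card_fin, hm]
    norm_num
  rw [σQ.positive_iff f f' (Matrix.diagonal fun _ => -1) hp fun i => ?_, hd]
  · norm_num
  have hi : i = 0 := Fin.ext (by have := i.2; simp only [Fin.val_zero]; omega)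
  subst hi
  have h2 : (∑ j, (Matrix.diagonal fun _ => -1 : Matrix (Fin (m + 1)) (Fin (m + 1)) ℝ) 0 j •
      f.vecE j) = f'.vecE 0 := by
    rw [h, Finset.sum_eq_single 0 (fun j _ hj => by
      rw [Matrix.diagonal_apply_ne _ hj.symm, zero_smul]) (fun h => absurd (Finset.mem_univ _) h),
      Matrix.diagonal_apply_eq, neg_smul, one_smul]
  rw [TangentFrame.toBundle_eq, hp]
  exact congrArg (Bundle.TotalSpace.mk (E := (TangentSpace (𝓡 (m + 1)) : Q → Type)) f.pt) h2.symm

namespace TangentEmbedding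

/-- The frame `(s ∂_r, f)` of the conormal bundle, for a frame `f` of the unit conormal bundle. -/
def radialFrame {s : ℝ} (hs : s ≠ 0)
    (f : TangentFrame (cotangentModel (m + 1)) (unitConormalBundle g K) m) :
    TangentFrame (cotangentModel (m + 1)) (conormalBundle K : Set (Cotangent (m + 1) Q)) (m + 1) where
  pt := f.pt
  mem := f.mem.1
  vec := (Fin.cons (s • vert f.pt (covec f.pt)) f.vecE : Fin (m + 1) → CotModel (m + 1))
  tangent := Fin.cases
    (Submodule.smul_mem (tanC (m + 1) (conormalBundle K) f.pt) s
      ((T.vert_mem_tanC_iff hK f.mem.1 (covec f.pt)).2 f.mem.1.2))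
    fun i => ((T.mem_tanC_unitConormalBundle_iff g hK f.mem (f.vecE i)).1 (f.tangent i)).1
  indep := by
    refine linearIndependent_finCons.2 ⟨f.linearIndependent_vecE, fun h => ?_⟩
    -- `dnormSq` vanishes on the vectors of `f`, but is `2 s` on the radial vector scaled by `s`.
    have h1 : Submodule.span ℝ (range f.vecE) ≤ LinearMap.ker (dnormSq g f.pt).toLinearMap := by
      rw [Submodule.span_le]
      rintro _ ⟨i, rfl⟩
      exact ((T.mem_tanC_unitConormalBundle_iff g hK f.mem (f.vecE i)).1 (f.tangent i)).2
    have h2 : dnormSq g f.pt (s • vert f.pt (covec f.pt)) = 0 := h1 h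
    rw [map_smul, T.dnormSq_vert_self, ((mem_unitConormalBundle_iff g _).1 f.mem).2] at h2
    simp [hs] at h2

theorem continuous_radialFrame {Y : Type*} [TopologicalSpace Y] {s : Y → ℝ} (hs : ∀ y, s y ≠ 0)
    (hsc : Continuous s)
    {f : Y → TangentFrame (cotangentModel (m + 1)) (unitConormalBundle g K) m}
    (hf : Continuous f) : Continuous fun y => T.radialFrame g hK (hs y) (f y) := by
  have hpt : Continuous fun y => (f y).pt := TangentFrame.continuous_pt.comp hf
  have hq : Continuous fun y => (f y).pt.proj := contMDiff_base.continuous.comp hpt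
  have hh : Continuous fun y => T.hat (f y).pt := T.contMDiff_hat.continuous.comp hpt
  refine TangentFrame.continuous_of hpt (Fin.cases ?_ fun i => ?_)
  · refine T.continuous_tangentBundle_cotangent ?_ hh ?_
    · have h1 : Continuous fun y => Bundle.zeroSection (Euc (m + 1))
          (TangentSpace (𝓡 (m + 1)) : Q → Type) (f y).pt.proj :=
        (Bundle.contMDiff_zeroSection (n := 0) (IB := 𝓡 (m + 1)) ℝ
          (TangentSpace (𝓡 (m + 1)) : Q → Type)).continuous.comp hq
      refine h1.congr fun y => ?_
      have h2 : dbase (f y).pt (s y • vert (f y).pt (covec (f y).pt)) = 0 := by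
        rw [map_smul, T.dbase_vert, smul_zero]
      exact congrArg (Bundle.TotalSpace.mk
        (E := (TangentSpace (𝓡 (m + 1)) : Q → Type)) (f y).pt.proj) h2.symm
    · refine (hsc.smul hh).congr fun y => ?_
      have h2 : T.dhat (f y).pt (s y • vert (f y).pt (covec (f y).pt)) =
          s y • T.hat (f y).pt := by
        rw [map_smul, T.dhat_vert]
        rfl
      exact h2.symm
  · exact (TangentFrame.continuous_toBundle i).comp hf

theorem radialFrame_combination {s : ℝ} (hs : s ≠ 0)
    {f f' : TangentFrame (cotangentModel (m + 1)) (unitConormalBundle g K) m}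
    {A : Matrix (Fin m) (Fin m) ℝ} (hp : f'.pt = f.pt)
    (h : ∀ i, f'.toBundle i = ⟨f.pt, ∑ j, A i j • f.vec j⟩) (i : Fin (m + 1)) :
    (T.radialFrame g hK hs f').toBundle i = ⟨(T.radialFrame g hK hs f).pt,
      ∑ j, (Matrix.of (Fin.cons (Fin.cons 1 0) fun i => Fin.cons 0 (A i)) :
        Matrix (Fin (m + 1)) (Fin (m + 1)) ℝ) i j • (T.radialFrame g hK hs f).vec j⟩ := by
  have key : ∀ (c : Fin (m + 1) → ℝ),
      (∑ j, c j • (Fin.cons (s • vert f.pt (covec f.pt)) f.vecE : Fin (m + 1) → CotModel (m + 1)) j)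
        = c 0 • (s • vert f.pt (covec f.pt)) + ∑ j, c (Fin.succ j) • f.vecE j := fun c => by
    rw [Fin.sum_univ_succ]
    rfl
  refine Fin.cases ?_ (fun i => ?_) i
  · have h1 := key (Fin.cons 1 0)
    simp only [Fin.cons_zero, Fin.cons_succ, one_smul, Pi.zero_apply, zero_smul,
      Finset.sum_const_zero, add_zero] at h1
    have h2 : (T.radialFrame g hK hs f').toBundle 0 =
      (⟨f.pt, s • vert f.pt (covec f.pt)⟩ : TangentBundle (cotangentModel (m + 1)) _) :=
      congrArg (fun ξ => (⟨ξ, s • vert ξ (covec ξ)⟩ :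
        TangentBundle (cotangentModel (m + 1)) (Cotangent (m + 1) Q))) hp
    exact h2.trans (congrArg (Bundle.TotalSpace.mk
      (E := (TangentSpace (cotangentModel (m + 1)) : Cotangent (m + 1) Q → Type)) f.pt) h1.symm)
  · have h1 := key (Fin.cons 0 (A i))
    simp only [Fin.cons_zero, Fin.cons_succ, zero_smul, zero_add] at h1
    exact (h i).trans (congrArg (Bundle.TotalSpace.mk
      (E := (TangentSpace (cotangentModel (m + 1)) : Cotangent (m + 1) Q → Type)) f.pt) h1.symm)

/-- The frame of `Q` given by a frame of the unit conormal bundle. -/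
def unitFrame {s : ℝ} (hs : s ≠ 0)
    (f : TangentFrame (cotangentModel (m + 1)) (unitConormalBundle g K) m) :
    TangentFrame (𝓡 (m + 1)) (univ : Set Q) (m + 1) :=
  T.conormalFrame g hK (T.radialFrame g hK hs f)

theorem unitFrame_pt {s : ℝ} (hs : s ≠ 0)
    (f : TangentFrame (cotangentModel (m + 1)) (unitConormalBundle g K) m) :
    (T.unitFrame g hK hs f).pt = f.pt.proj := rfl

theorem unitFrame_vecE_zero {s : ℝ} (hs : s ≠ 0)
    (f : TangentFrame (cotangentModel (m + 1)) (unitConormalBundle g K) m) :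
    (T.unitFrame g hK hs f).vecE 0 = s • sharp g f.pt.proj (covec f.pt) := by
  have h : T.conormalMap g K f.pt (s • vert f.pt (covec f.pt)) =
      s • sharp g f.pt.proj (covec f.pt) := by
    rw [map_smul, T.conormalMap_vert g f.pt (η := covec f.pt) f.mem.1.2]
  exact h

theorem unitFrame_vecE_succ {s : ℝ} (hs : s ≠ 0)
    (f : TangentFrame (cotangentModel (m + 1)) (unitConormalBundle g K) m) (i : Fin m) :
    (T.unitFrame g hK hs f).vecE i.succ = T.conormalMap g K f.pt (f.vecE i) := rfl

/-- The positive frames of the unit conormal bundle. -/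
def unitPositive : Set (TangentFrame (cotangentModel (m + 1)) (unitConormalBundle g K) m) :=
  {f | T.unitFrame g hK one_ne_zero f ∈ σQ.positive}

theorem isClopen_unitPositive : IsClopen (T.unitPositive g hK σQ) :=
  σQ.isClopen_positive.preimage ((T.continuous_conormalFrame g hK).comp
    (T.continuous_radialFrame g hK (fun _ => one_ne_zero) continuous_const continuous_id))

open Classical in
/-- The sign of the radial vector that makes a frame of the conormal bundle positive, if the unit
conormal bundle has dimension `0`. -/
def radialSign (f : TangentFrame (cotangentModel (m + 1)) (unitConormalBundle g K) m) : ℝ :=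
  if m = 0 ∧ f ∉ T.unitPositive g hK σQ then -1 else 1

theorem radialSign_ne_zero (f : TangentFrame (cotangentModel (m + 1)) (unitConormalBundle g K) m) :
    T.radialSign g hK σQ f ≠ 0 := by
  unfold radialSign
  split_ifs <;> simp

theorem radialSign_of_positive
    {f : TangentFrame (cotangentModel (m + 1)) (unitConormalBundle g K) m}
    (hf : f ∈ T.unitPositive g hK σQ) : T.radialSign g hK σQ f = 1 :=
  if_neg fun h => h.2 hf

theorem radialSign_of_ne_zero (hm : m ≠ 0)
    (f : TangentFrame (cotangentModel (m + 1)) (unitConormalBundle g K) m) :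
    T.radialSign g hK σQ f = 1 := if_neg fun h => hm h.1

/-- Positivity is a clopen condition, so the sign is locally constant. -/
theorem continuous_radialSign : Continuous (T.radialSign g hK σQ) := by
  classical
  by_cases hm : m = 0
  · have h : T.radialSign g hK σQ = fun f => if f ∈ T.unitPositive g hK σQ then 1 else -1 := by
      funext f
      by_cases hf : f ∈ T.unitPositive g hK σQ
      · rw [T.radialSign_of_positive g hK σQ hf, if_pos hf]
      · rw [if_neg hf]
        exact if_pos ⟨hm, hf⟩
    rw [h]
    refine continuous_const.if (fun f hf => ?_) continuous_const
    have h2 := (T.isClopen_unitPositive g hK σQ).frontier_eq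
    exact absurd (h2 ▸ hf : f ∈ (∅ : Set _)) (notMem_empty f)
  · exact continuous_const.congr fun f => (T.radialSign_of_ne_zero g hK σQ hm f).symm

/-- The map of frame bundles that defines the spin structure of the unit conormal bundle. -/
def signedFrame (f : TangentFrame (cotangentModel (m + 1)) (unitConormalBundle g K) m) :
    TangentFrame (𝓡 (m + 1)) (univ : Set Q) (m + 1) :=
  T.unitFrame g hK (T.radialSign_ne_zero g hK σQ f) f

theorem unitFrame_congr {s s' : ℝ} (hs : s ≠ 0) (hs' : s' ≠ 0) (h : s = s')
    (f : TangentFrame (cotangentModel (m + 1)) (unitConormalBundle g K) m) :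
    T.unitFrame g hK hs f = T.unitFrame g hK hs' f := by
  subst h
  rfl

theorem continuous_signedFrame : Continuous (T.signedFrame g hK σQ) :=
  (T.continuous_conormalFrame g hK).comp (T.continuous_radialFrame g hK
    (T.radialSign_ne_zero g hK σQ) (T.continuous_radialSign g hK σQ) continuous_id)

/-- For `m = 0` the frame of `Q` is a single vector, which the sign makes positive; the covering
then lies over all frames, as required in dimension `0`. For `m > 0` the sign is always `1`. -/
theorem signedFrame_mem_positive_iff
    (f : TangentFrame (cotangentModel (m + 1)) (unitConormalBundle g K) m) :
    T.signedFrame g hK σQ f ∈ σQ.positive ↔ m = 0 ∨ f ∈ T.unitPositive g hK σQ := by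
  by_cases hf : f ∈ T.unitPositive g hK σQ
  · rw [signedFrame, T.unitFrame_congr g hK _ one_ne_zero (T.radialSign_of_positive g hK σQ hf)]
    exact ⟨fun _ => Or.inr hf, fun _ => hf⟩
  by_cases hm : m = 0
  · have hs : T.radialSign g hK σQ f = -1 := if_pos ⟨hm, hf⟩
    rw [signedFrame, T.unitFrame_congr g hK _ (by norm_num) hs]
    refine ⟨fun _ => Or.inl hm, fun _ => ?_⟩
    refine (σQ.mem_positive_iff_of_neg hm (f := T.unitFrame g hK one_ne_zero f)
      (f' := T.unitFrame g hK (by norm_num : (-1 : ℝ) ≠ 0) f) ?_ ?_).2 hf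
    · rw [unitFrame_pt, unitFrame_pt]
    · rw [unitFrame_vecE_zero, unitFrame_vecE_zero, one_smul, neg_smul, one_smul]
  · rw [signedFrame, T.unitFrame_congr g hK _ one_ne_zero (T.radialSign_of_ne_zero g hK σQ hm f)]
    exact ⟨fun h => Or.inr h, fun h => h.resolve_left hm⟩

end TangentEmbedding

end UnitConormalSpin

section UnitConormalSpin

variable {m k : ℕ} {Q : Type u} [TopologicalSpace Q] [ChartedSpace (Euc (m + 1)) Q]
  [IsManifold (𝓡 (m + 1)) ∞ Q] {V : Type*} [NormedAddCommGroup V] [NormedSpace ℝ V]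
  (T : TangentEmbedding (m + 1) Q V) (g : RiemMetric (m + 1) Q) {K : Set Q}
  (hK : IsSubmanifold (𝓡 (m + 1)) k K)
  (σQ : SpinStructure (𝓡 (m + 1)) (univ : Set Q) (m + 1))

theorem TangentFrame.eq_of_vecE {E : Type} [NormedAddCommGroup E] [NormedSpace ℝ E]
    {H : Type} [TopologicalSpace H] {I : ModelWithCorners ℝ E H}
    {M : Type u} [TopologicalSpace M] [ChartedSpace H M] {S : Set M} {k : ℕ}
    {f f' : TangentFrame I S k} (hp : f.pt = f'.pt) (h : ∀ i, f.vecE i = f'.vecE i) : f = f' := by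
  obtain ⟨x, hx, v, hv, hi⟩ := f
  obtain ⟨x', hx', v', hv', hi'⟩ := f'
  dsimp only at hp
  subst hp
  obtain rfl : v = v' := funext h
  rfl

namespace TangentEmbedding

/-- The frame of the unit conormal bundle at `ξ` given by `m` vectors. -/
def unitInverseFrame {ξ : Cotangent (m + 1) Q} (hξ : ξ ∈ unitConormalBundle g K)
    {v : Fin m → CotModel (m + 1)} (hv : ∀ i, v i ∈ tanC (m + 1) (unitConormalBundle g K) ξ)
    (hi : LinearIndependent ℝ v) :
    TangentFrame (cotangentModel (m + 1)) (unitConormalBundle g K) m where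
  pt := ξ
  mem := hξ
  vec := v
  tangent := hv
  indep := hi

theorem signedFrame_vecE_zero (hm : m ≠ 0)
    (f : TangentFrame (cotangentModel (m + 1)) (unitConormalBundle g K) m) :
    (T.signedFrame g hK σQ f).vecE 0 = sharp g f.pt.proj (covec f.pt) := by
  rw [signedFrame, unitFrame_vecE_zero, T.radialSign_of_ne_zero g hK σQ hm, one_smul]

theorem signedFrame_vecE_succ
    (f : TangentFrame (cotangentModel (m + 1)) (unitConormalBundle g K) m) (i : Fin m) :
    (T.signedFrame g hK σQ f).vecE i.succ = T.conormalMap g K f.pt (f.vecE i) := rfl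

/-- Under the isomorphism with the tangent space of `Q`, frames of the unit conormal bundle at `ξ`
become frames whose first vector is the dual `e` of `ξ` and whose others lie in the kernel of
`dnormSq g ξ ∘ R`. The factor `1 / 2` in `l` normalizes `l e` to `1`, and `isConnected_adapted`
applies. -/
theorem isConnected_unitConormal_fiber (hm : 2 ≤ m) {ξ : Cotangent (m + 1) Q}
    (hξ : ξ ∈ unitConormalBundle g K) :
    IsConnected {z : {z : TangentFrame (cotangentModel (m + 1)) (unitConormalBundle g K) m ×
      σQ.cover // σQ.proj z.2 = T.signedFrame g hK σQ z.1} | z.1.1.pt = ξ} := by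
  obtain ⟨R, hR1, hR2, hR3⟩ := T.exists_conormalMap_inverse g hK hξ.1
  have hm0 : m ≠ 0 := by omega
  have hRi : Function.Injective R := Function.LeftInverse.injective hR2
  let e : Euc (m + 1) := sharp g ξ.proj (covec ξ)
  let l : Euc (m + 1) →L[ℝ] ℝ := (1 / 2 : ℝ) • (dnormSq g ξ ∘L R)
  have hl : ∀ w, l w = (1 / 2 : ℝ) * dnormSq g ξ (R w) := fun w => rfl
  have hle : l e = 1 := by
    have h1 : R e = vert ξ (covec ξ) := by
      have h2 := hR3 (vert ξ (covec ξ)) ((T.vert_mem_tanC_iff hK hξ.1 (covec ξ)).2 hξ.1.2)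
      rwa [T.conormalMap_vert g ξ (η := covec ξ) hξ.1.2] at h2
    rw [hl, h1, T.dnormSq_vert_self, ((mem_unitConormalBundle_iff g _).1 hξ).2]
    norm_num
  have hcon := isConnected_iff_connectedSpace.1
    (σQ.isConnected_adapted T hm ξ.proj e l hle)
  let X := {c : σQ.cover | (σQ.proj c).pt = ξ.proj ∧ (σQ.proj c).vecE 0 = e ∧
      ∀ i : Fin m, l ((σQ.proj c).vecE i.succ) = 0}
  have hli : ∀ c : X, LinearIndependent ℝ fun i : Fin m => R ((σQ.proj c.1).vecE i.succ) :=
    fun c => (((σQ.proj c.1).linearIndependent_vecE).map' R.toLinearMap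
      (LinearMap.ker_eq_bot.2 hRi)).comp Fin.succ (Fin.succ_injective m)
  have htan : ∀ (c : X) (i : Fin m), R ((σQ.proj c.1).vecE i.succ) ∈
      tanC (m + 1) (unitConormalBundle g K) ξ := fun c i => by
    refine (T.mem_tanC_unitConormalBundle_iff g hK hξ _).2 ⟨hR1 _, ?_⟩
    have := c.2.2.2 i
    rw [hl] at this
    linarith
  have hsf : ∀ c : X, σQ.proj c.1 =
      T.signedFrame g hK σQ (unitInverseFrame g hξ (htan c) (hli c)) := fun c => by
    refine TangentFrame.eq_of_vecE c.2.1 (Fin.cases ?_ fun i => ?_)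
    · rw [signedFrame_vecE_zero _ _ _ _ hm0]
      exact c.2.2.1
    · rw [signedFrame_vecE_succ]
      exact (hR2 _).symm
  let F : X → {z : TangentFrame (cotangentModel (m + 1)) (unitConormalBundle g K) m ×
      σQ.cover // σQ.proj z.2 = T.signedFrame g hK σQ z.1} := fun c =>
    ⟨(unitInverseFrame g hξ (htan c) (hli c), c.1), hsf c⟩
  have hF : Continuous F := by
    refine Continuous.subtype_mk (Continuous.prodMk ?_ continuous_subtype_val) _
    refine TangentFrame.continuous_of continuous_const fun i => ?_
    have hX : Continuous fun c : X => (⟨c.1, c.2.1⟩ : σQ.CoverAt ξ.proj) :=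
      continuous_subtype_val.subtype_mk _
    exact (FiberBundle.continuous_totalSpaceMk (CotModel (m + 1))
      (TangentSpace (cotangentModel (m + 1))) ξ).comp (R.continuous.comp
        ((continuous_apply i.succ).comp ((σQ.continuous_vecs T ξ.proj).comp hX)))
  have himg : {z : {z : TangentFrame (cotangentModel (m + 1)) (unitConormalBundle g K) m ×
      σQ.cover // σQ.proj z.2 = T.signedFrame g hK σQ z.1} | z.1.1.pt = ξ} = range F := by
    ext z
    constructor
    · rintro rfl
      obtain ⟨⟨f, c⟩, hz⟩ := z
      dsimp only at hz hξ R hR1 hR2 hR3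
      have h0 : (σQ.proj c).pt = f.pt.proj := by rw [hz]; rfl
      have h1 : (σQ.proj c).vecE 0 = e := by
        rw [hz]
        exact T.signedFrame_vecE_zero g hK σQ hm0 f
      have ht := fun i => (T.mem_tanC_unitConormalBundle_iff g hK hξ (f.vecE i)).1 (f.tangent i)
      have h2 : ∀ i : Fin m, R ((σQ.proj c).vecE i.succ) = f.vecE i := fun i => by
        rw [hz]
        exact hR3 _ (ht i).1
      have h3 : ∀ i : Fin m, l ((σQ.proj c).vecE i.succ) = 0 := fun i => by
        rw [hl, h2, (ht i).2, mul_zero]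
      exact ⟨⟨c, h0, h1, h3⟩, Subtype.ext (Prod.ext
        (TangentFrame.eq_of_vecE (f := unitInverseFrame g hξ (htan ⟨c, h0, h1, h3⟩)
          (hli ⟨c, h0, h1, h3⟩)) (f' := f) rfl h2) rfl)⟩
    · rintro ⟨c, rfl⟩
      rfl
  rw [himg]
  exact isConnected_range hF

/-- The spin structure of the unit conormal bundle. -/
def unitConormalSpin : SpinStructure (cotangentModel (m + 1)) (unitConormalBundle g K) m :=
  σQ.pullback (T.signedFrame g hK σQ) (T.continuous_signedFrame g hK σQ)
    (T.unitPositive g hK σQ) (T.isClopen_unitPositive g hK σQ)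
    (fun f f' A hp h => by
      have h1 := σQ.positive_iff (T.unitFrame g hK one_ne_zero f) (T.unitFrame g hK one_ne_zero f')
        _ (congrArg Bundle.TotalSpace.proj hp)
        (T.conormalFrame_combination g hK (T.radialFrame_combination g hK one_ne_zero hp h))
      rw [det_cons_one] at h1
      exact h1)
    (fun f => by rw [σQ.mem_range_proj_iff]; exact T.signedFrame_mem_positive_iff g hK σQ f)
    (fun hm ξ hξ => T.isConnected_unitConormal_fiber g hK σQ hm hξ)

end TangentEmbedding

end UnitConormalSpin

/-! ### The spin structure of `Q` induces that of the unit conormal bundle -/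

section Induced

variable {m k : ℕ} {Q : Type u} [TopologicalSpace Q] [ChartedSpace (Euc (m + 1)) Q]
  [IsManifold (𝓡 (m + 1)) ∞ Q] {V : Type*} [NormedAddCommGroup V] [NormedSpace ℝ V]
  (T : TangentEmbedding (m + 1) Q V) (g : RiemMetric (m + 1) Q) {K : Set Q}
  (hK : IsSubmanifold (𝓡 (m + 1)) k K)
  (σQ : SpinStructure (𝓡 (m + 1)) (univ : Set Q) (m + 1))

namespace TangentEmbedding

/-- The horizontal part of a vector at a point of `K`: the component tangent to `K`. -/
def horizontalPart (K : Set Q) (q : Q) : Euc (m + 1) →L[ℝ] Euc (m + 1) :=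
  T.retr q ∘L (T.tangentProj g K q ∘L T.incl q)

theorem incl_horizontalPart (q : Q) (v : Euc (m + 1)) :
    T.incl q (T.horizontalPart g K q v) = T.tangentProj g K q (T.incl q v) :=
  T.proj_tangentProj g q _

theorem horizontalPart_mem (q : Q) (v : Euc (m + 1)) :
    T.horizontalPart g K q v ∈ tanE (m + 1) K q := by
  obtain ⟨w, hw, h⟩ := T.exists_tangentProj_eq g (K := K) q (T.incl q v)
  have : T.horizontalPart g K q v = w := (congrArg (T.retr q) h).trans (T.retr_incl q w)
  rwa [this]

theorem gE_sub_horizontalPart (q : Q) (v : Euc (m + 1)) {b : Euc (m + 1)}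
    (hb : b ∈ tanE (m + 1) K q) : gE g q (v - T.horizontalPart g K q v) b = 0 := by
  have h := T.gE_tangentProj g (T.incl q v) hb
  rw [T.retr_incl] at h
  rw [map_sub, sub_apply, sub_eq_zero]
  exact h.symm

theorem contMDiff_zeroCovector (T : TangentEmbedding (m + 1) Q V) :
    ContMDiff (𝓡 (m + 1)) (cotangentModel (m + 1)) ∞
      (zeroCovector : Q → Cotangent (m + 1) Q) :=
  (T.contMDiff_extend 0).congr fun q => by
    rw [extend, ContinuousLinearMap.zero_comp]; rfl

theorem zeroCovector_mem {q : Q} (hq : q ∈ K) :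
    (zeroCovector q : Cotangent (m + 1) Q) ∈ conormalBundle K := ⟨hq, fun _ _ => rfl⟩

/-- The vector of the conormal bundle, at the zero section, that corresponds to `v`. -/
def zeroVec (K : Set Q) (q : Q) (v : Euc (m + 1)) : CotModel (m + 1) :=
  zeroSectionVector g q (T.horizontalPart g K q v) (v - T.horizontalPart g K q v : Euc (m + 1))

theorem dbase_zeroVec (q : Q) (v : Euc (m + 1)) :
    dbase (zeroCovector q) (T.zeroVec g K q v) = T.horizontalPart g K q v :=
  (dbase_zeroSectionVector g T q _ _).1

theorem dhat_zeroVec (q : Q) (v : Euc (m + 1)) :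
    T.dhat (zeroCovector q) (T.zeroVec g K q v) =
      gE g q (v - T.horizontalPart g K q v) ∘L T.retr q :=
  (dbase_zeroSectionVector g T q _ _).2

theorem zeroVec_mem (hK : IsSubmanifold (𝓡 (m + 1)) k K) {q : Q} (hq : q ∈ K) (v : Euc (m + 1)) :
    T.zeroVec g K q v ∈ tanC (m + 1) (conormalBundle K) (zeroCovector q) := by
  let Z : Euc (m + 1) →L[ℝ] CotModel (m + 1) :=
    mfderiv (𝓡 (m + 1)) (cotangentModel (m + 1)) (zeroCovector : Q → Cotangent (m + 1) Q) q
  have hZ : HasMFDerivAt (𝓡 (m + 1)) (cotangentModel (m + 1))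
      (zeroCovector : Q → Cotangent (m + 1) Q) q Z :=
    ((T.contMDiff_zeroCovector q).mdifferentiableAt (by simp)).hasMFDerivAt
  have e0 : T.zeroVec g K q v = Z (T.horizontalPart g K q v) +
      vert (zeroCovector q) (gE g q (v - T.horizontalPart g K q v)) :=
    congrArg (fun z => Z _ + z) (T.verticalLift_eq_vert (zeroCovector q) _)
  rw [e0]
  refine Submodule.add_mem _ ?_ ((T.vert_mem_tanC_iff hK (zeroCovector_mem hq) _).2
    fun w hw => T.gE_sub_horizontalPart g q v hw)
  exact hZ.hasMFDerivWithinAt.mem_tangentSpaceOf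
    (Filter.Eventually.of_forall fun x hx => zeroCovector_mem hx)
    (T.horizontalPart_mem g q v)

/-- At the zero section the tangential and normal parts of `v` are simply added again, so
`conormalMap` inverts the isomorphism of the statement. -/
theorem conormalMap_zeroVec (q : Q) (v : Euc (m + 1)) :
    T.conormalMap g K (zeroCovector q) (T.zeroVec g K q v) = v := by
  rw [T.conormalMap_of_dhat g (zeroCovector q) (T.dhat_zeroVec g q v)
    (fun w hw => T.gE_sub_horizontalPart g q v hw), dbase_zeroVec]
  change T.horizontalPart g K q v + sharp g q (gE g q (v - T.horizontalPart g K q v)) = v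
  rw [sharp_gE]
  abel

theorem linearIndependent_zeroVec (q : Q) {ι : Type*} {v : ι → Euc (m + 1)}
    (hv : LinearIndependent ℝ v) : LinearIndependent ℝ fun i => T.zeroVec g K q (v i) := by
  refine LinearIndependent.of_comp (T.conormalMap g K (zeroCovector q)).toLinearMap ?_
  have : (T.conormalMap g K (zeroCovector q)).toLinearMap ∘ (fun i => T.zeroVec g K q (v i)) = v :=
    funext fun i => T.conormalMap_zeroVec g q (v i)
  rw [this]
  exact hv

/-- The frame of the conormal bundle, at the zero section, that corresponds to a frame of `Q`. -/
def zeroFrame (f : TangentFrame (𝓡 (m + 1)) (univ : Set Q) (m + 1)) (hf : f.pt ∈ K) :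
    TangentFrame (cotangentModel (m + 1)) (conormalBundle K : Set (Cotangent (m + 1) Q))
      (m + 1) where
  pt := zeroCovector f.pt
  mem := zeroCovector_mem hf
  vec := fun i => T.zeroVec g K f.pt (f.vecE i)
  tangent := fun i => T.zeroVec_mem g hK hf (f.vecE i)
  indep := T.linearIndependent_zeroVec g f.pt f.linearIndependent_vecE

theorem continuous_zeroFrame {Y : Type*} [TopologicalSpace Y]
    {f : Y → TangentFrame (𝓡 (m + 1)) (univ : Set Q) (m + 1)} (hf : Continuous f)
    (hfK : ∀ y, (f y).pt ∈ K) : Continuous fun y => T.zeroFrame g hK (f y) (hfK y) := by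
  have hq : Continuous fun y => (f y).pt := TangentFrame.continuous_pt.comp hf
  have hpt : Continuous fun y => (zeroCovector (f y).pt : Cotangent (m + 1) Q) :=
    T.contMDiff_zeroCovector.continuous.comp hq
  have hP : Continuous fun y => T.tangentProj g K (f y).pt :=
    (T.continuousOn_tangentProj g hK).comp_continuous hq hfK
  refine TangentFrame.continuous_of hpt fun i => ?_
  have hv : Continuous fun y => T.incl (f y).pt ((f y).vecE i) :=
    T.contMDiff_total.continuous.comp ((TangentFrame.continuous_toBundle i).comp hf)
  refine T.continuous_tangentBundle_cotangent ?_ ?_ ?_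
  · refine T.continuous_tangentBundle hq ((hP.clm_apply hv).congr fun y => ?_)
    have h2 : T.incl (f y).pt (dbase (zeroCovector (f y).pt)
        (T.zeroVec g K (f y).pt ((f y).vecE i))) =
        T.tangentProj g K (f y).pt (T.incl (f y).pt ((f y).vecE i)) := by
      rw [dbase_zeroVec, incl_horizontalPart]
    exact h2.symm
  · exact T.contMDiff_hat.continuous.comp hpt
  · have hm : Continuous fun y => T.metric g (f y).pt :=
      (T.contMDiff_metric g).continuous.comp hq
    refine (hm.clm_apply (hv.sub (hP.clm_apply hv))).congr fun y => ?_
    refine Eq.trans ?_ (T.dhat_zeroVec g (f y).pt ((f y).vecE i)).symm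
    ext w
    have h3 : T.retr (f y).pt (T.incl (f y).pt ((f y).vecE i) -
        T.tangentProj g K (f y).pt (T.incl (f y).pt ((f y).vecE i))) =
        (f y).vecE i - T.horizontalPart g K (f y).pt ((f y).vecE i) := by
      rw [map_sub, T.retr_incl]
      rfl
    exact congrArg (fun z => gE g (f y).pt z (T.retr (f y).pt w)) h3

theorem zeroFrame_vec (f : TangentFrame (𝓡 (m + 1)) (univ : Set Q) (m + 1)) (hf : f.pt ∈ K) :
    T.conormalFrame g hK (T.zeroFrame g hK f hf) = f :=
  TangentFrame.eq_of_vecE rfl fun i => T.conormalMap_zeroVec g f.pt (f.vecE i)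

/-- `zeroFrame` is a section of `conormalFrame`, so the lift to the pulled back covering can keep
the point of the covering of `σQ`. -/
theorem liftsToSpin_zeroSection :
    LiftsToSpin σQ (T.conormalSpin g hK σQ) K (ZeroSectionFrames g K) := by
  refine ⟨fun p => ⟨(T.zeroFrame g hK (σQ.proj p.1) p.2, p.1), (T.zeroFrame_vec g hK _ p.2).symm⟩,
    ?_, fun p i => ?_, fun p p' _ h => ?_⟩
  · exact Continuous.subtype_mk (Continuous.prodMk (T.continuous_zeroFrame g hK
      (σQ.isCoveringMap.continuous.comp continuous_subtype_val) fun p => p.2)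
      continuous_subtype_val) _
  · refine ⟨T.horizontalPart g K (σQ.proj p.1).pt ((σQ.proj p.1).vecE i),
      T.horizontalPart_mem g _ _, (σQ.proj p.1).vecE i -
        T.horizontalPart g K (σQ.proj p.1).pt ((σQ.proj p.1).vecE i),
      fun b hb => T.gE_sub_horizontalPart g _ _ hb, ?_, rfl⟩
    exact (add_sub_cancel (T.horizontalPart g K (σQ.proj p.1).pt ((σQ.proj p.1).vecE i))
      ((σQ.proj p.1).vecE i)).symm
  · exact Subtype.ext (congrArg (fun z => z.1.2) h)

theorem continuous_unitConormalSpin_snd :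
    Continuous fun p : (T.unitConormalSpin g hK σQ).cover => (p.1.2 : σQ.cover) :=
  continuous_snd.comp continuous_subtype_val

/-- Both coverings are pulled back from `σQ`, and `signedFrame` factors through the frame of the
conormal bundle with the signed radial vector in front; again the point over `σQ` is kept. -/
theorem liftsToSpin_radial :
    LiftsToSpin (T.unitConormalSpin g hK σQ) (T.conormalSpin g hK σQ) univ fun f f' =>
      (f ∈ (T.unitConormalSpin g hK σQ).positive → f'.toBundle 0 = ⟨f.pt, radialVector f.pt⟩) ∧
      (f ∉ (T.unitConormalSpin g hK σQ).positive → f'.toBundle 0 = ⟨f.pt, -radialVector f.pt⟩) ∧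
      ∀ i, f'.toBundle i.succ = f.toBundle i := by
  refine ⟨fun p => ⟨(T.radialFrame g hK (T.radialSign_ne_zero g hK σQ p.1.1.1) p.1.1.1, p.1.1.2),
    p.1.2⟩, ?_, fun p => ?_, fun p p' hp h => ?_⟩
  · have h1 : Continuous fun p : {p : (T.unitConormalSpin g hK σQ).cover //
        ((T.unitConormalSpin g hK σQ).proj p).pt ∈ univ} =>
        (T.unitConormalSpin g hK σQ).proj p.1 :=
      (T.unitConormalSpin g hK σQ).isCoveringMap.continuous.comp continuous_subtype_val
    have h2 : Continuous fun p : {p : (T.unitConormalSpin g hK σQ).cover //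
        ((T.unitConormalSpin g hK σQ).proj p).pt ∈ univ} =>
        T.radialSign g hK σQ ((T.unitConormalSpin g hK σQ).proj p.1) :=
      (T.continuous_radialSign g hK σQ).comp h1
    refine Continuous.subtype_mk (Continuous.prodMk ?_
      ((T.continuous_unitConormalSpin_snd g hK σQ).comp continuous_subtype_val)) _
    exact T.continuous_radialFrame g hK (fun p => T.radialSign_ne_zero g hK σQ _) h2 h1
  · obtain ⟨⟨⟨f, c⟩, hc⟩, -⟩ := p
    have hrad : radialVector f.pt = vert f.pt (covec f.pt) := T.verticalLift_eq_vert f.pt _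
    have key : ∀ v : CotModel (m + 1), T.radialSign g hK σQ f • vert f.pt (covec f.pt) = v →
        (T.radialFrame g hK (T.radialSign_ne_zero g hK σQ f) f).toBundle 0 =
          (⟨f.pt, v⟩ : TangentBundle (cotangentModel (m + 1)) (Cotangent (m + 1) Q)) :=
      fun v hv => congrArg (Bundle.TotalSpace.mk
        (E := (TangentSpace (cotangentModel (m + 1)) : Cotangent (m + 1) Q → Type)) f.pt) hv
    refine ⟨fun hf => ?_, fun hf => ?_, fun i => rfl⟩
    · refine key (radialVector f.pt) ?_
      have h1 : T.radialSign g hK σQ f = 1 := T.radialSign_of_positive g hK σQ hf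
      rw [h1, one_smul, hrad]
    · refine key (-radialVector f.pt : CotModel (m + 1)) ?_
      -- A frame below the covering that is not positive exists in dimension `0` only, and there the
      -- sign is `-1`.
      have hm : m = 0 := by
        have h1 : T.signedFrame g hK σQ f ∈ σQ.positive :=
          (σQ.mem_range_proj_iff _).1 ⟨c, hc⟩
        exact ((T.signedFrame_mem_positive_iff g hK σQ f).1 h1).resolve_right hf
      have h2 : T.radialSign g hK σQ f = -1 := if_pos ⟨hm, hf⟩
      have h3 : (-1 : ℝ) • vert f.pt (covec f.pt) = -vert f.pt (covec f.pt) :=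
        neg_one_smul ℝ (vert f.pt (covec f.pt) : CotModel (m + 1))
      exact (congrArg (fun s : ℝ => s • vert f.pt (covec f.pt)) h2).trans
        (h3.trans (congrArg (fun v : CotModel (m + 1) => -v) hrad.symm))
  · exact Subtype.ext (Subtype.ext (Prod.ext hp (congrArg (fun z => z.1.2) h)))

theorem isInducedSpin_unitConormalSpin : IsInducedSpin g K σQ (T.unitConormalSpin g hK σQ) :=
  ⟨T.conormalSpin g hK σQ, T.liftsToSpin_zeroSection g hK σQ, T.liftsToSpin_radial g hK σQ⟩

end TangentEmbedding

end Induced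

/-! ### Embeddings from local left inverses; transport of unit covectors -/

section LocalLeftInverse

variable {E E' : Type} [NormedAddCommGroup E] [NormedSpace ℝ E] [NormedAddCommGroup E']
  [NormedSpace ℝ E'] {H H' : Type} [TopologicalSpace H] [TopologicalSpace H']
  {I : ModelWithCorners ℝ E H} {I' : ModelWithCorners ℝ E' H'}
  {M M' : Type u} [TopologicalSpace M] [ChartedSpace H M] [TopologicalSpace M'] [ChartedSpace H' M']

/-- A continuous map with local continuous left inverses, defined near the points of its image, is
an embedding. -/
theorem isEmbedding_of_local_leftInverse {S : Set M} {F : M → M'} (hF : ContinuousOn F S)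
    (h : ∀ x ∈ S, ∃ (L : M' → M) (O : Set M'), O ∈ 𝓝 (F x) ∧ ContinuousAt L (F x) ∧
      ∀ y ∈ S, F y ∈ O → L (F y) = y) : IsEmbedding (S.domRestrict F) := by
  refine ⟨isInducing_iff_nhds.2 fun x => le_antisymm ?_ ?_, fun x y hxy => ?_⟩
  · exact ((continuousOn_iff_continuous_domRestrict.1 hF).tendsto x).le_comap
  · obtain ⟨L, O, hO, hL, hLF⟩ := h x x.2
    rw [nhds_subtype]
    intro W hW
    obtain ⟨W', hW', hW'W⟩ := Filter.mem_comap.1 hW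
    have hx := hLF x x.2 (mem_of_mem_nhds hO)
    have h1 : L ⁻¹' W' ∈ 𝓝 (F x) := hL (by rwa [hx])
    refine Filter.mem_comap.2 ⟨O ∩ L ⁻¹' W', Filter.inter_mem hO h1, fun y hy => hW'W ?_⟩
    have h2 : L (F y) ∈ W' := hy.2
    rwa [hLF y y.2 hy.1] at h2
  · obtain ⟨L, O, hO, -, hLF⟩ := h x x.2
    have hxy' : F x = F y := hxy
    have h1 := hLF x x.2 (mem_of_mem_nhds hO)
    have h2 := hLF y y.2 (hxy' ▸ mem_of_mem_nhds hO)
    exact Subtype.ext (h1.symm.trans (hxy' ▸ h2))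

/-- A map with a local differentiable left inverse is an immersion. -/
theorem injOn_mfderivWithin_of_local_leftInverse {S : Set M} {F : M → M'} {x : M} (hx : x ∈ S)
    (hF : MDifferentiableWithinAt I I' F S x) {L : M' → M} {O : Set M'} (hO : O ∈ 𝓝 (F x))
    (hL : MDifferentiableAt I' I L (F x)) (hLF : ∀ y ∈ S, F y ∈ O → L (F y) = y) :
    InjOn (mfderivWithin I I' F S x) (tangentSpaceOf I S x) := by
  let A : E →L[ℝ] E' := mfderivWithin I I' F S x
  let B : E' →L[ℝ] E := mfderiv I' I L (F x)
  have hA : HasMFDerivWithinAt I I' F S x A := hF.hasMFDerivWithinAt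
  have hB : HasMFDerivAt I' I L (F x) B := hL.hasMFDerivAt
  have hc : HasMFDerivWithinAt I I (L ∘ F) S x (B ∘L A) := hB.comp_hasMFDerivWithinAt x hA
  have hid : HasMFDerivWithinAt I I (L ∘ F) S x (ContinuousLinearMap.id ℝ E) := by
    refine ((hasMFDerivAt_id x).hasMFDerivWithinAt (s := S)).congr_of_eventuallyEq ?_
      (hLF x hx (mem_of_mem_nhds hO))
    filter_upwards [hF.continuousWithinAt hO, self_mem_nhdsWithin] with y hy hyS
    exact hLF y hyS hy
  intro v hv w hw hvw
  have e1 := hc.eq_on_tangentSpaceOf hid hv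
  have e2 := hc.eq_on_tangentSpaceOf hid hw
  have e3 : A v = A w := hvw
  exact e1.symm.trans ((congrArg B e3).trans e2)

end LocalLeftInverse

section Push

variable {n k : ℕ} {Q : Type u} [TopologicalSpace Q] [ChartedSpace (Euc n) Q]
  [IsManifold (𝓡 n) ∞ Q] {V : Type*} [NormedAddCommGroup V] [NormedSpace ℝ V]
  (T : TangentEmbedding n Q V) (g : RiemMetric n Q)

/-- The unit covector with the direction of `ξ`. -/
def normalizeCov (ξ : Cotangent n Q) : Cotangent n Q :=
  mkCov ξ.proj ((Real.sqrt (normSq g ξ))⁻¹ • covec ξ)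

theorem normSq_normalizeCov {ξ : Cotangent n Q} (h : covec ξ ≠ 0) :
    normSq g (normalizeCov g ξ) = 1 := by
  have h1 := normSq_pos g h
  rw [normalizeCov, normSq_mkCov_smul, inv_pow, Real.sq_sqrt h1.le]
  exact inv_mul_cancel₀ h1.ne'

theorem normalizeCov_mkCov_smul {q : Q} {c : ℝ} (hc : 0 < c) {p : Euc n →L[ℝ] ℝ}
    (hp : normSq g (mkCov q p) = 1) : normalizeCov g (mkCov q (c • p)) = mkCov q p := by
  change mkCov q ((Real.sqrt (normSq g (mkCov q (c • p))))⁻¹ • (c • p)) = mkCov q p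
  rw [normSq_mkCov_smul, hp, mul_one, Real.sqrt_sq hc.le, smul_smul, inv_mul_cancel₀ hc.ne',
    one_smul]

namespace TangentEmbedding

/-- The unit covector at `y` given by the covector `ξ` and by a linear map `A`. -/
def push (A : V →L[ℝ] V) (y : Q) (ξ : Cotangent n Q) : Cotangent n Q :=
  normalizeCov g (mkCov y (T.hat ξ ∘L (A ∘L T.incl y)))

theorem exists_covec_push {A : V →L[ℝ] V} {y : Q} {ξ : Cotangent n Q}
    (h : T.hat ξ ∘L (A ∘L T.incl y) ≠ 0) :
    ∃ c : ℝ, 0 < c ∧ covec (T.push g A y ξ) = c • (T.hat ξ ∘L (A ∘L T.incl y)) :=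
  ⟨_, inv_pos.2 (Real.sqrt_pos.2 (normSq_pos g
    (ξ := mkCov y (T.hat ξ ∘L (A ∘L T.incl y))) h)), rfl⟩

theorem normSq_push {A : V →L[ℝ] V} {y : Q} {ξ : Cotangent n Q}
    (h : T.hat ξ ∘L (A ∘L T.incl y) ≠ 0) : normSq g (T.push g A y ξ) = 1 :=
  normSq_normalizeCov g (ξ := mkCov y (T.hat ξ ∘L (A ∘L T.incl y))) h

/-- Since `A` intertwines the projections to the tangent spaces and `hat ξ` absorbs the projection
at `x`, the projection at `y` between `A` and `B` has no effect. The two maps then cancel up to a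
positive factor, which the normalization removes. The same identity shows that the pushed covector
is nonzero. -/
theorem push_push {A B : V →L[ℝ] V} {x y : Q} {ξ : Cotangent n Q} (hx : ξ.proj = x)
    (hξ : normSq g ξ = 1) (hBA : A * B = 1) (hA : A * T.proj y = T.proj x * A) :
    T.hat ξ ∘L (A ∘L T.incl y) ≠ 0 ∧ T.push g B x (T.push g A y ξ) = ξ := by
  subst hx
  have hN : T.hat ξ ∘L T.proj ξ.proj = T.hat ξ := by
    ext w
    change covec ξ (T.retr _ (T.incl _ (T.retr _ w))) = _
    rw [T.retr_incl]
    rfl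
  have key : ((T.hat ξ ∘L (A ∘L T.incl y)) ∘L T.retr y) ∘L (B ∘L T.incl ξ.proj) = covec ξ := by
    ext w
    have h1 := congrArg (fun Z : V →L[ℝ] V => T.hat ξ (Z (B (T.incl ξ.proj w)))) hA
    have h2 := congrArg (fun Z : V →L[ℝ] V => T.hat ξ (Z (T.incl ξ.proj w))) hBA
    have h3 := congrArg (fun Z : V →L[ℝ] ℝ => Z (A (B (T.incl ξ.proj w)))) hN
    exact h1.trans (h3.trans (h2.trans (T.hat_incl ξ w)))
  have h0 : T.hat ξ ∘L (A ∘L T.incl y) ≠ 0 := by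
    intro h
    rw [h, ContinuousLinearMap.zero_comp, ContinuousLinearMap.zero_comp] at key
    have : normSq g ξ = 0 := by rw [normSq, ← key]; rfl
    rw [hξ] at this
    exact one_ne_zero this
  refine ⟨h0, ?_⟩
  obtain ⟨c, hc, hcov⟩ := T.exists_covec_push g h0
  have e1 : T.hat (T.push g A y ξ) ∘L (B ∘L T.incl ξ.proj) = c • covec ξ := by
    rw [← key]
    ext w
    have := congrArg (fun Z : Euc n →L[ℝ] ℝ => Z (T.retr y (B (T.incl ξ.proj w)))) hcov
    exact this
  rw [push, e1]
  exact normalizeCov_mkCov_smul g hc hξ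

variable {E' : Type*} [NormedAddCommGroup E'] [NormedSpace ℝ E'] {H' : Type*} [TopologicalSpace H']
  {J : ModelWithCorners ℝ E' H'} {X : Type*} [TopologicalSpace X] [ChartedSpace H' X]

theorem contMDiffWithinAt_push {A : X → V →L[ℝ] V} {y : X → Q} {ξ : X → Cotangent n Q}
    {D : Set X} {z : X} (hA : ContMDiffWithinAt J 𝓘(ℝ, V →L[ℝ] V) ∞ A D z)
    (hy : ContMDiffWithinAt J (𝓡 n) ∞ y D z)
    (hξ : ContMDiffWithinAt J (cotangentModel n) ∞ ξ D z)
    (h0 : T.hat (ξ z) ∘L (A z ∘L T.incl (y z)) ≠ 0) :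
    ContMDiffWithinAt J (cotangentModel n) ∞ (fun w => T.push g (A w) (y w) (ξ w)) D z := by
  have hN : ContMDiffWithinAt J 𝓘(ℝ, V →L[ℝ] V) ∞ (fun w => T.proj (y w)) D z :=
    T.contMDiff_proj.contMDiffAt.comp_contMDiffWithinAt z hy
  have hh : ContMDiffWithinAt J 𝓘(ℝ, V →L[ℝ] ℝ) ∞ (fun w => T.hat (ξ w)) D z :=
    T.contMDiff_hat.contMDiffAt.comp_contMDiffWithinAt z hξ
  have hG1 : ContMDiffWithinAt J 𝓘(ℝ, V →L[ℝ] ℝ) ∞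
      (fun w => T.hat (ξ w) ∘L (A w ∘L T.proj (y w))) D z := hh.clm_comp (hA.clm_comp hN)
  have hG : ContMDiffWithinAt J (cotangentModel n) ∞
      (fun w => (mkCov (y w) (T.hat (ξ w) ∘L (A w ∘L T.incl (y w))) : Cotangent n Q)) D z :=
    T.contMDiffWithinAt_cotangent_iff.2 ⟨hy, hG1⟩
  have hn : ContMDiffWithinAt J 𝓘(ℝ, ℝ) ∞
      (fun w => normSq g (mkCov (y w) (T.hat (ξ w) ∘L (A w ∘L T.incl (y w))))) D z :=
    (T.contMDiff_normSq g).contMDiffAt.comp_contMDiffWithinAt z hG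
  have hpos := normSq_pos g (ξ := mkCov (y z) (T.hat (ξ z) ∘L (A z ∘L T.incl (y z)))) h0
  have hs : ContMDiffWithinAt J 𝓘(ℝ, ℝ) ∞
      (fun w => (Real.sqrt (normSq g (mkCov (y w) (T.hat (ξ w) ∘L (A w ∘L T.incl (y w))))))⁻¹)
      D z := by
    have h1 : ContDiffAt ℝ ∞ (fun r : ℝ => (Real.sqrt r)⁻¹)
        (normSq g (mkCov (y z) (T.hat (ξ z) ∘L (A z ∘L T.incl (y z))))) :=
      (Real.contDiffAt_sqrt hpos.ne').inv (Real.sqrt_pos.2 hpos).ne'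
    exact ContMDiffAt.comp_contMDiffWithinAt (g := fun r : ℝ => (Real.sqrt r)⁻¹) z h1.contMDiffAt hn
  refine T.contMDiffWithinAt_cotangent_iff.2 ⟨hy, (hs.smul hG1).congr (fun w _ => ?_) ?_⟩
  · exact ContinuousLinearMap.smul_comp _ _ _
  · exact ContinuousLinearMap.smul_comp _ _ _

end TangentEmbedding

end Push

/-! ### Products of steps of small, variable size -/

section Steps

variable {n : ℕ} {Q : Type u} [TopologicalSpace Q] [ChartedSpace (Euc n) Q]
  [IsManifold (𝓡 n) ∞ Q] {A : Type*} [NormedRing A] [NormedAlgebra ℝ A] [CompleteSpace A]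
  {U : ℝ → ℝ → Q → A} {K : Set Q}

theorem mul_smoothTransition_mem {t : ℝ} (ht : t ∈ Icc (0 : ℝ) 1) (a : ℝ) :
    t * Real.smoothTransition a ∈ Icc (0 : ℝ) 1 :=
  ⟨mul_nonneg ht.1 (Real.smoothTransition.nonneg a),
    mul_le_one₀ ht.2 (Real.smoothTransition.nonneg a) (Real.smoothTransition.le_one a)⟩

/-- At step size `0` each step is `1`, and units form an open set. Compactness of the square of
pairs `q` makes the neighbourhood uniform in `q`. -/
theorem eventually_isUnit_step
    (hU : ContinuousOn (fun z : (ℝ × ℝ) × Q => U z.1.1 z.1.2 z.2) ((Icc 0 1 ×ˢ Icc 0 1) ×ˢ K))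
    (hU1 : ∀ t ∈ Icc (0 : ℝ) 1, ∀ x ∈ K, U t t x = 1) {x : Q} (hx : x ∈ K) :
    ∀ᶠ p : ℝ × Q in 𝓝 (0, x), ∀ q ∈ Icc (0 : ℝ) 1 ×ˢ Icc (0 : ℝ) 1,
      p.2 ∈ K → IsUnit (U (q.1 * Real.smoothTransition q.2)
        (q.1 * Real.smoothTransition (q.2 + p.1)) p.2) := by
  have hcpt : IsCompact (Icc (0 : ℝ) 1 ×ˢ Icc (0 : ℝ) 1) := isCompact_Icc.prod isCompact_Icc
  have key : ∀ᶠ p : ℝ × Q in 𝓝 (0, x), ∀ q ∈ Icc (0 : ℝ) 1 ×ˢ Icc (0 : ℝ) 1,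
      q.1 ∈ Icc (0 : ℝ) 1 → p.2 ∈ K → IsUnit (U (q.1 * Real.smoothTransition q.2)
        (q.1 * Real.smoothTransition (q.2 + p.1)) p.2) := by
    refine hcpt.eventually_forall_of_forall_eventually fun q hq => ?_
    let D : Set ((ℝ × Q) × ℝ × ℝ) := {z | z.2.1 ∈ Icc (0 : ℝ) 1 ∧ z.1.2 ∈ K}
    have hc : ContinuousOn (fun z : (ℝ × Q) × ℝ × ℝ => U (z.2.1 * Real.smoothTransition z.2.2)
        (z.2.1 * Real.smoothTransition (z.2.2 + z.1.1)) z.1.2) D := by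
      have h1 : Continuous fun z : (ℝ × Q) × ℝ × ℝ => (((z.2.1 * Real.smoothTransition z.2.2,
          z.2.1 * Real.smoothTransition (z.2.2 + z.1.1)), z.1.2) : (ℝ × ℝ) × Q) := by
        have := Real.smoothTransition.continuous
        fun_prop
      exact hU.comp h1.continuousOn fun z hz =>
        ⟨⟨mul_smoothTransition_mem hz.1 _, mul_smoothTransition_mem hz.1 _⟩, hz.2⟩
    have hz : ((0, x), q) ∈ D := ⟨hq.1, hx⟩
    have h1 := (hc _ hz).eventually (Units.isOpen.mem_nhds (show IsUnit _ by
      dsimp only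
      rw [add_zero, hU1 _ (mul_smoothTransition_mem hq.1 _) x hx]
      exact isUnit_one))
    rw [eventually_nhdsWithin_iff] at h1
    filter_upwards [h1] with z hz h2 h3 using hz ⟨h2, h3⟩
  filter_upwards [key] with p hp q hq using hp q hq hq.1

/-- A smooth step size for which all the steps are invertible. -/
theorem exists_smooth_step [T2Space Q] [SecondCountableTopology Q]
    (hU : ContinuousOn (fun z : (ℝ × ℝ) × Q => U z.1.1 z.1.2 z.2) ((Icc 0 1 ×ˢ Icc 0 1) ×ˢ K))
    (hU1 : ∀ t ∈ Icc (0 : ℝ) 1, ∀ x ∈ K, U t t x = 1) :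
    ∃ ε : Q → ℝ, ContMDiffOn (𝓡 n) 𝓘(ℝ, ℝ) ∞ ε K ∧ ∀ x ∈ K, 0 < ε x ∧
      ∀ t ∈ Icc (0 : ℝ) 1, ∀ a, 0 ≤ a → IsUnit (U (t * Real.smoothTransition a)
        (t * Real.smoothTransition (a + ε x)) x) := by
  -- The condition is imposed on all smaller step sizes as well. The admissible sizes then form an
  -- interval, so constant local choices can be averaged by a partition of unity.
  let P : Q → Set ℝ := fun y => {e | 0 < e ∧ (y ∈ K → ∀ e', 0 < e' → e' ≤ e →
    ∀ t ∈ Icc (0 : ℝ) 1, ∀ a, 0 ≤ a → IsUnit (U (t * Real.smoothTransition a)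
        (t * Real.smoothTransition (a + e')) y))}
  have hP : ∀ x ∈ K, ∃ W : Set Q, IsOpen W ∧ x ∈ W ∧ ∃ c, ∀ y ∈ W, c ∈ P y := by
    intro x hx
    obtain ⟨p, hp, q, hq, h⟩ := Filter.mem_prod_iff.1
      ((nhds_prod_eq (x := (0 : ℝ)) (y := x)) ▸ eventually_isUnit_step hU hU1 hx)
    obtain ⟨δ, hδ, hδp⟩ := Metric.mem_nhds_iff.1 hp
    obtain ⟨W, hWq, hW, hxW⟩ := mem_nhds_iff.1 hq
    refine ⟨W, hW, hxW, δ / 2, fun y hy => ⟨half_pos hδ, fun hyK e he0 he t ht a ha => ?_⟩⟩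
    -- Beyond `a = 1` both times equal `t` and the step is `1`, so the compact range of `a`
    -- suffices.
    rcases le_total a 1 with ha1 | ha1
    · have hmem : (e, y) ∈ p ×ˢ q := ⟨hδp (by
        rw [Metric.mem_ball, Real.dist_eq, sub_zero, abs_of_pos he0]; linarith), hWq hy⟩
      exact h hmem (t, a) ⟨ht, ha, ha1⟩ hyK
    · rw [Real.smoothTransition.one_of_one_le ha1,
        Real.smoothTransition.one_of_one_le (by linarith), mul_one, hU1 t ht y hyK]
      exact isUnit_one
  choose! W hWo hWx c hc using hP
  -- As `K` need not be closed, the partition of unity lives on an open neighbourhood of it; the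
  -- values of `ε` elsewhere do not matter.
  let Ω : TopologicalSpace.Opens Q := ⟨⋃ x ∈ K, W x, isOpen_biUnion hWo⟩
  have hKΩ : ∀ x ∈ K, x ∈ Ω := fun x hx => mem_biUnion hx (hWx x hx)
  have : LocallyCompactSpace Q := Manifold.locallyCompact_of_finiteDimensional (𝓡 n)
  have : LocallyCompactSpace Ω := Ω.isOpen.locallyCompactSpace
  obtain ⟨e, he⟩ := exists_contMDiffMap_forall_mem_convex_of_local_const (I := 𝓡 n) (n := ⊤)
    (M := Ω) (t := fun y => P y) (fun y => (OrdConnected.convex ⟨fun a ha b hb r hr =>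
      ⟨ha.1.trans_le hr.1, fun hy e' h0 h1 => hb.2 hy e' h0 (h1.trans hr.2)⟩⟩))
    (fun y => by
      obtain ⟨x, hx, hy⟩ := mem_iUnion₂.1 y.2
      refine ⟨c x, ?_⟩
      filter_upwards [continuous_subtype_val.continuousAt.preimage_mem_nhds ((hWo x hx).mem_nhds hy)]
        with z hz using hc x hx z hz)
  classical
  let ε : Q → ℝ := fun y => if h : y ∈ Ω then e ⟨y, h⟩ else 0
  have hεe : ∀ z : Ω, ε z = e z := fun z => dif_pos z.2
  refine ⟨ε, fun x hx => ?_, fun x hx => ?_⟩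
  · have h1 : ContMDiffAt (𝓡 n) 𝓘(ℝ, ℝ) ∞ (fun z : Ω => ε z) ⟨x, hKΩ x hx⟩ :=
      (e.contMDiff _).congr_of_eventuallyEq (Filter.Eventually.of_forall hεe)
    exact ((contMDiffAt_subtype_iff (x := (⟨x, hKΩ x hx⟩ : Ω))).1 h1).contMDiffWithinAt
  · have h2 := he ⟨x, hKΩ x hx⟩
    rw [← hεe] at h2
    exact ⟨h2.1, fun t ht a ha => h2.2 hx _ h2.1 le_rfl t ht a ha⟩

/-- The ordered product of the steps. -/
def stepProduct (U : ℝ → ℝ → Q → A) (τ : ℕ → ℝ) (x : Q) : ℕ → A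
  | 0 => 1
  | j + 1 => U (τ j) (τ (j + 1)) x * stepProduct U τ x j

/-- The times of the steps. -/
def stepTime (ε : Q → ℝ) (t : ℝ) (x : Q) (j : ℕ) : ℝ := t * Real.smoothTransition (j * ε x)

/-- The product of all the steps. -/
def transport (U : ℝ → ℝ → Q → A) (ε : Q → ℝ) (t : ℝ) (x : Q) : A :=
  stepProduct U (stepTime ε t x) x ⌈(ε x)⁻¹⌉₊

theorem stepTime_mem {ε : Q → ℝ} {t : ℝ} (ht : t ∈ Icc (0 : ℝ) 1) (x : Q) (j : ℕ) :
    stepTime ε t x j ∈ Icc (0 : ℝ) 1 := mul_smoothTransition_mem ht _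

theorem stepTime_zero (ε : Q → ℝ) (t : ℝ) (x : Q) : stepTime ε t x 0 = 0 := by
  rw [stepTime, Nat.cast_zero, zero_mul, Real.smoothTransition.zero, mul_zero]

theorem stepTime_of_le {ε : Q → ℝ} {x : Q} (hε : 0 < ε x) (t : ℝ) {j : ℕ} (hj : (ε x)⁻¹ ≤ j) :
    stepTime ε t x j = t := by
  rw [stepTime, Real.smoothTransition.one_of_one_le, mul_one]
  rwa [inv_le_iff_one_le_mul₀ hε] at hj

theorem stepProduct_induction {τ : ℕ → ℝ} {x : Q} {p : ℝ → A → Prop} (h0 : p (τ 0) 1)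
    (hs : ∀ j a, p (τ j) a → p (τ (j + 1)) (U (τ j) (τ (j + 1)) x * a)) (j : ℕ) :
    p (τ j) (stepProduct U τ x j) := by
  induction j with
  | zero => exact h0
  | succ j ih => exact hs j _ ih

/-- After `⌈(ε x)⁻¹⌉₊` steps the time stays at `t`, and further steps are `1`. So any larger number
of steps gives the same product. -/
theorem stepProduct_eq_transport (hU1 : ∀ t ∈ Icc (0 : ℝ) 1, ∀ x ∈ K, U t t x = 1) {ε : Q → ℝ}
    {x : Q} (hx : x ∈ K) (hε : 0 < ε x) {t : ℝ} (ht : t ∈ Icc (0 : ℝ) 1) {j : ℕ}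
    (hj : ⌈(ε x)⁻¹⌉₊ ≤ j) : stepProduct U (stepTime ε t x) x j = transport U ε t x := by
  induction j, hj using Nat.le_induction with
  | base => rfl
  | succ j hj ih =>
    have h1 : (ε x)⁻¹ ≤ j := (Nat.le_ceil _).trans (by exact_mod_cast hj)
    have h2 : (ε x)⁻¹ ≤ (j + 1 : ℕ) := h1.trans (by push_cast; linarith)
    rw [stepProduct, stepTime_of_le hε t h1, stepTime_of_le hε t h2, hU1 t ht x hx, one_mul, ih]

/-- The property depends on the time reached as well as on the product; compatibility with the
moving tangent spaces has this form. -/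
theorem transport_induction {ε : Q → ℝ} {x : Q} (hε : 0 < ε x) {t : ℝ} (ht : t ∈ Icc (0 : ℝ) 1)
    {p : ℝ → A → Prop} (h0 : p 0 1)
    (hs : ∀ s ∈ Icc (0 : ℝ) 1, ∀ s' ∈ Icc (0 : ℝ) 1, ∀ a, p s a → p s' (U s s' x * a)) :
    p t (transport U ε t x) := by
  have h := stepProduct_induction (U := U) (τ := stepTime ε t x) (x := x) (p := p)
    (by rwa [stepTime_zero]) (fun j a ha => hs _ (stepTime_mem ht x j) _ (stepTime_mem ht x _) a ha)
    ⌈(ε x)⁻¹⌉₊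
  rwa [stepTime_of_le hε t (Nat.le_ceil _)] at h

theorem transport_zero (hU1 : ∀ t ∈ Icc (0 : ℝ) 1, ∀ x ∈ K, U t t x = 1) (ε : Q → ℝ)
    {x : Q} (hx : x ∈ K) : transport U ε 0 x = 1 := by
  have h0 : ∀ j, stepTime ε 0 x j = 0 := fun j => zero_mul _
  refine stepProduct_induction (U := U) (τ := stepTime ε 0 x) (x := x) (p := fun _ a => a = 1) rfl
    (fun j a ha => ?_) _
  rw [ha, h0, h0, hU1 0 ⟨le_rfl, zero_le_one⟩ x hx, one_mul]

theorem isUnit_transport {ε : Q → ℝ} {x : Q} (hε : 0 < ε x) {t : ℝ} (ht : t ∈ Icc (0 : ℝ) 1)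
    (h : ∀ t ∈ Icc (0 : ℝ) 1, ∀ a, 0 ≤ a → IsUnit (U (t * Real.smoothTransition a)
        (t * Real.smoothTransition (a + ε x)) x)) : IsUnit (transport U ε t x) := by
  refine stepProduct_induction (U := U) (τ := stepTime ε t x) (x := x) (p := fun _ a => IsUnit a)
    isUnit_one (fun j a ha => IsUnit.mul ?_ ha) _
  have h1 := h t ht (j * ε x) (by positivity)
  rwa [← add_one_mul, ← Nat.cast_add_one] at h1

/-- The number of steps in the definition jumps with `x`, but near a point a single `N` suffices for
all neighbours, and there the transport is a product of `N` smooth factors. -/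
theorem contMDiffOn_transport
    (hU : ContMDiffOn ((𝓘(ℝ, ℝ).prod 𝓘(ℝ, ℝ)).prod (𝓡 n)) 𝓘(ℝ, A) ∞
      (fun z : (ℝ × ℝ) × Q => U z.1.1 z.1.2 z.2) ((Icc 0 1 ×ˢ Icc 0 1) ×ˢ K))
    (hU1 : ∀ t ∈ Icc (0 : ℝ) 1, ∀ x ∈ K, U t t x = 1) {ε : Q → ℝ}
    (hε : ContMDiffOn (𝓡 n) 𝓘(ℝ, ℝ) ∞ ε K) (hε0 : ∀ x ∈ K, 0 < ε x) :
    ContMDiffOn (𝓘(ℝ, ℝ).prod (𝓡 n)) 𝓘(ℝ, A) ∞ (fun z : ℝ × Q => transport U ε z.1 z.2)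
      (Icc 0 1 ×ˢ K) := by
  have hτ : ∀ j : ℕ, ContMDiffOn (𝓘(ℝ, ℝ).prod (𝓡 n)) 𝓘(ℝ, ℝ) ∞
      (fun z : ℝ × Q => stepTime ε z.1 z.2 j) (Icc 0 1 ×ˢ K) := fun j => by
    have h1 : ContMDiffOn (𝓘(ℝ, ℝ).prod (𝓡 n)) 𝓘(ℝ, ℝ) ∞ (fun z : ℝ × Q => ε z.2)
      (Icc 0 1 ×ˢ K) := hε.comp contMDiff_snd.contMDiffOn fun z hz => hz.2
    have h2 : ContMDiff 𝓘(ℝ, ℝ) 𝓘(ℝ, ℝ) ∞ (fun r : ℝ => Real.smoothTransition (j * r)) :=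
      (Real.smoothTransition.contDiff.comp (contDiff_const.mul contDiff_id)).contMDiff
    exact contMDiff_fst.contMDiffOn.smul (h2.comp_contMDiffOn h1)
  have hprod : ∀ j : ℕ, ContMDiffOn (𝓘(ℝ, ℝ).prod (𝓡 n)) 𝓘(ℝ, A) ∞
      (fun z : ℝ × Q => stepProduct U (stepTime ε z.1 z.2) z.2 j) (Icc 0 1 ×ˢ K) := fun j => by
    induction j with
    | zero => exact contMDiffOn_const
    | succ j ih =>
      have h1 : ContMDiffOn (𝓘(ℝ, ℝ).prod (𝓡 n)) 𝓘(ℝ, A) ∞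
          (fun z : ℝ × Q => U (stepTime ε z.1 z.2 j) (stepTime ε z.1 z.2 (j + 1)) z.2)
          (Icc 0 1 ×ˢ K) :=
        hU.comp (((hτ j).prodMk (hτ (j + 1))).prodMk contMDiff_snd.contMDiffOn)
          fun z hz => ⟨⟨stepTime_mem hz.1 _ _, stepTime_mem hz.1 _ _⟩, hz.2⟩
      have hm : ContDiff ℝ ∞ fun p : A × A => p.1 * p.2 := contDiff_mul
      exact hm.contMDiff.comp_contMDiffOn (h1.prodMk_space ih)
  rintro ⟨t, x⟩ ⟨ht, hx⟩
  obtain ⟨N, hN⟩ := exists_nat_gt (ε x)⁻¹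
  have hev : ∀ᶠ y in 𝓝[K] x, (ε y)⁻¹ < N :=
    ((hε.continuousOn x hx).inv₀ (hε0 x hx).ne').eventually (Iio_mem_nhds hN)
  have hsnd : Filter.Tendsto (fun z : ℝ × Q => z.2) (𝓝[Icc 0 1 ×ˢ K] (t, x)) (𝓝[K] x) :=
    tendsto_nhdsWithin_of_tendsto_nhds_of_eventually_within _
      (continuous_snd.continuousAt.tendsto.mono_left nhdsWithin_le_nhds)
      (eventually_nhdsWithin_of_forall fun z hz => hz.2)
  have heq : (fun z : ℝ × Q => transport U ε z.1 z.2) =ᶠ[𝓝[Icc 0 1 ×ˢ K] (t, x)]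
      fun z => stepProduct U (stepTime ε z.1 z.2) z.2 N := by
    filter_upwards [hsnd.eventually hev, self_mem_nhdsWithin] with z hz hzK
    exact (stepProduct_eq_transport hU1 hzK.2 (hε0 _ hzK.2) hzK.1 (Nat.ceil_le.2 hz.le)).symm
  exact (hprod N _ ⟨ht, hx⟩).congr_of_eventuallyEq heq (heq.self_of_nhdsWithin ⟨ht, hx⟩)

end Steps

/-! ### Lifting an isotopy to the unit conormal bundles -/

section IsotopyTransport

variable {n k : ℕ} {Q : Type u} [TopologicalSpace Q] [ChartedSpace (Euc n) Q]
  [IsManifold (𝓡 n) ∞ Q] {V : Type*} [NormedAddCommGroup V] [NormedSpace ℝ V]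
  (T : TangentEmbedding n Q V) (g : RiemMetric n Q) {K K' : Set Q} {f : ℝ → Q → Q}

namespace TangentEmbedding

/-- A linear map from the tangent space of `Q` at `f s x` to that at `f t x` that extends the
differentials of the isotopy `f`, extended to `V`; it is invertible for `s` near `t`. -/
def stepMap (K : Set Q) (f : ℝ → Q → Q) (s t : ℝ) (x : Q) : V →L[ℝ] V :=
  T.imageTransfer g K (f s) (f t) x +
    T.proj (f t x) * (T.proj (f s x) - T.imageTransfer g K (f s) (f s) x) +
    (1 - T.proj (f t x)) * (1 - T.proj (f s x))

theorem proj_mul_proj (q : Q) : T.proj q * T.proj q = T.proj q :=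
  ContinuousLinearMap.ext fun w => T.proj_incl q (T.retr q w)

theorem imageTransfer_mul_proj (f f' : Q → Q) (x : Q) :
    T.imageTransfer g K f f' x * T.proj (f x) = T.imageTransfer g K f f' x :=
  ContinuousLinearMap.ext fun w => T.imageTransfer_proj g f f' x w

theorem proj_mul_imageTransfer (f f' : Q → Q) (x : Q) :
    T.proj (f' x) * T.imageTransfer g K f f' x = T.imageTransfer g K f f' x :=
  ContinuousLinearMap.ext fun w => T.proj_imageTransfer g f f' x w

/-- For equal times the three terms are `C`, `N - C` and `1 - N`, where `C` is the transfer and `N`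
the projection at `f t x`; this needs `N * C = C` and `N * N = N` only. -/
theorem stepMap_self (t : ℝ) (x : Q) : T.stepMap g K f t t x = 1 := by
  have h1 := T.proj_mul_proj (f t x)
  have h2 := T.proj_mul_imageTransfer g (K := K) (f t) (f t) x
  rw [stepMap]
  simp only [mul_sub, sub_mul, mul_one, one_mul, h1, h2]
  abel

/-- Intertwining the projections means that tangent spaces of `Q` go to tangent spaces, and the
chosen complements in `V` to complements. Products and inverses inherit it. -/
theorem stepMap_mul_proj (s t : ℝ) (x : Q) :
    T.stepMap g K f s t x * T.proj (f s x) = T.proj (f t x) * T.stepMap g K f s t x := by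
  have h1 := T.proj_mul_proj (f s x)
  have h1' := T.proj_mul_proj (f t x)
  have h2 := T.proj_mul_imageTransfer g (K := K) (f s) (f t) x
  have h3 := T.imageTransfer_mul_proj g (K := K) (f s) (f t) x
  have h4 := T.imageTransfer_mul_proj g (K := K) (f s) (f s) x
  rw [stepMap]
  simp only [mul_sub, sub_mul, mul_add, add_mul, mul_one, one_mul, mul_assoc, h1, h2, h3, h4]
  simp only [← mul_assoc, h1']
  abel

theorem stepMap_apply {s t : ℝ} {x : Q}
    (hi : InjOn (mfderivWithin (𝓡 n) (𝓡 n) (f s) K x) (tangentSpaceOf (𝓡 n) K x)) {v : Euc n}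
    (hv : v ∈ tanE n K x) :
    T.stepMap g K f s t x
      (T.incl (f s x) ((mfderivWithin (𝓡 n) (𝓡 n) (f s) K x : Euc n →L[ℝ] Euc n) v)) =
      T.incl (f t x) ((mfderivWithin (𝓡 n) (𝓡 n) (f t) K x : Euc n →L[ℝ] Euc n) v) := by
  have h1 := T.imageTransfer_apply g hi (f t) hv
  have h2 := T.imageTransfer_apply g hi (f s) hv
  set w := T.incl (f s x) ((mfderivWithin (𝓡 n) (𝓡 n) (f s) K x : Euc n →L[ℝ] Euc n) v) with hw
  have h3 : T.proj (f s x) w = w := T.proj_incl _ _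
  change T.imageTransfer g K (f s) (f t) x w + T.proj (f t x) (T.proj (f s x) w -
    T.imageTransfer g K (f s) (f s) x w) + ((w - T.proj (f s x) w) -
      T.proj (f t x) (w - T.proj (f s x) w)) = _
  rw [h1, h2, h3, sub_self, map_zero, add_zero, sub_zero, add_zero]

theorem contMDiffOn_stepMap (hK : IsSubmanifold (𝓡 n) k K)
    (hf : IsSmoothIsotopy (𝓡 n) K K' f) :
    ContMDiffOn ((𝓘(ℝ, ℝ).prod 𝓘(ℝ, ℝ)).prod (𝓡 n)) 𝓘(ℝ, V →L[ℝ] V) ∞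
      (fun z : (ℝ × ℝ) × Q => T.stepMap g K f z.1.1 z.1.2 z.2) ((Icc 0 1 ×ˢ Icc 0 1) ×ˢ K) := by
  have hC := T.contMDiffOn_imageTransfer g hK hf
  have hf1 : ContMDiff ((𝓘(ℝ, ℝ).prod 𝓘(ℝ, ℝ)).prod (𝓡 n)) 𝓘(ℝ, ℝ) ∞
      (fun z : (ℝ × ℝ) × Q => z.1.1) := contMDiff_fst.comp contMDiff_fst
  have hf2 : ContMDiff ((𝓘(ℝ, ℝ).prod 𝓘(ℝ, ℝ)).prod (𝓡 n)) 𝓘(ℝ, ℝ) ∞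
      (fun z : (ℝ × ℝ) × Q => z.1.2) := contMDiff_snd.comp contMDiff_fst
  have hCs : ContMDiffOn ((𝓘(ℝ, ℝ).prod 𝓘(ℝ, ℝ)).prod (𝓡 n)) 𝓘(ℝ, V →L[ℝ] V) ∞
      (fun z : (ℝ × ℝ) × Q => T.imageTransfer g K (f z.1.1) (f z.1.1) z.2)
      ((Icc 0 1 ×ˢ Icc 0 1) ×ˢ K) :=
    hC.comp (f := fun z : (ℝ × ℝ) × Q => ((z.1.1, z.1.1), z.2))
      ((hf1.prodMk hf1).prodMk contMDiff_snd).contMDiffOn fun z hz => ⟨⟨hz.1.1, hz.1.1⟩, hz.2⟩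
  have hNs : ContMDiffOn ((𝓘(ℝ, ℝ).prod 𝓘(ℝ, ℝ)).prod (𝓡 n)) 𝓘(ℝ, V →L[ℝ] V) ∞
      (fun z : (ℝ × ℝ) × Q => T.proj (f z.1.1 z.2)) ((Icc 0 1 ×ˢ Icc 0 1) ×ˢ K) :=
    T.contMDiff_proj.comp_contMDiffOn (hf.contMDiffOn.comp
      (hf1.prodMk contMDiff_snd).contMDiffOn fun z hz => ⟨hz.1.1, hz.2⟩)
  have hNt : ContMDiffOn ((𝓘(ℝ, ℝ).prod 𝓘(ℝ, ℝ)).prod (𝓡 n)) 𝓘(ℝ, V →L[ℝ] V) ∞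
      (fun z : (ℝ × ℝ) × Q => T.proj (f z.1.2 z.2)) ((Icc 0 1 ×ˢ Icc 0 1) ×ˢ K) :=
    T.contMDiff_proj.comp_contMDiffOn (hf.contMDiffOn.comp
      (hf2.prodMk contMDiff_snd).contMDiffOn fun z hz => ⟨hz.1.2, hz.2⟩)
  have h1 : ContMDiffOn ((𝓘(ℝ, ℝ).prod 𝓘(ℝ, ℝ)).prod (𝓡 n)) 𝓘(ℝ, V →L[ℝ] V) ∞
      (fun _ : (ℝ × ℝ) × Q => (1 : V →L[ℝ] V)) ((Icc 0 1 ×ˢ Icc 0 1) ×ˢ K) := contMDiffOn_const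
  exact (hC.add (hNt.clm_comp (hNs.sub hCs))).add ((h1.sub hNt).clm_comp (h1.sub hNs))

/-- The tangent spaces of `Q` along an isotopy are identified, compatibly with the differentials of
the isotopy, by a smooth family of invertible maps. -/
theorem exists_transport [CompleteSpace V] [T2Space Q] [SecondCountableTopology Q]
    (g : RiemMetric n Q)
    (hK : IsSubmanifold (𝓡 n) k K) (hf : IsSmoothIsotopy (𝓡 n) K K' f) :
    ∃ 𝓔 : ℝ → Q → V →L[ℝ] V,
      ContMDiffOn (𝓘(ℝ, ℝ).prod (𝓡 n)) 𝓘(ℝ, V →L[ℝ] V) ∞ (fun z : ℝ × Q => 𝓔 z.1 z.2)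
        (Icc 0 1 ×ˢ K) ∧
      (∀ x ∈ K, 𝓔 0 x = 1) ∧
      ∀ t ∈ Icc (0 : ℝ) 1, ∀ x ∈ K, IsUnit (𝓔 t x) ∧
        𝓔 t x * T.proj x = T.proj (f t x) * 𝓔 t x ∧
        ∀ v ∈ tanE n K x, 𝓔 t x (T.incl x v) =
          T.incl (f t x) ((mfderivWithin (𝓡 n) (𝓡 n) (f t) K x : Euc n →L[ℝ] Euc n) v) := by
  have hU := T.contMDiffOn_stepMap g hK hf
  have hU1 : ∀ t ∈ Icc (0 : ℝ) 1, ∀ x ∈ K, T.stepMap g K f t t x = 1 :=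
    fun t _ x _ => T.stepMap_self g t x
  obtain ⟨ε, hε, hε1⟩ := exists_smooth_step (n := n) hU.continuousOn hU1
  refine ⟨transport (T.stepMap g K f) ε, contMDiffOn_transport hU hU1 hε fun x hx => (hε1 x hx).1,
    fun x hx => transport_zero hU1 ε hx, fun t ht x hx =>
    ⟨isUnit_transport (hε1 x hx).1 ht (hε1 x hx).2, ?_, fun v hv => ?_⟩⟩
  · refine transport_induction (U := T.stepMap g K f) (hε1 x hx).1 ht
      (p := fun s a => a * T.proj x = T.proj (f s x) * a) ?_ fun s _ s' _ a ha => ?_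
    · rw [hf.map_zero x hx, one_mul, mul_one]
    · rw [mul_assoc, ha, ← mul_assoc, T.stepMap_mul_proj, mul_assoc]
  · refine transport_induction (U := T.stepMap g K f) (hε1 x hx).1 ht
      (p := fun s a => a (T.incl x v) = T.incl (f s x)
        ((mfderivWithin (𝓡 n) (𝓡 n) (f s) K x : Euc n →L[ℝ] Euc n) v)) ?_ fun s hs s' _ a ha => ?_
    · have hid : HasMFDerivWithinAt (𝓡 n) (𝓡 n) (f 0) K x (ContinuousLinearMap.id ℝ (Euc n)) :=
        (hasMFDerivWithinAt_id K x).congr_mono (fun y hy => hf.map_zero y hy) (hf.map_zero x hx)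
          subset_rfl
      have hd : HasMFDerivWithinAt (𝓡 n) (𝓡 n) (f 0) K x
          (mfderivWithin (𝓡 n) (𝓡 n) (f 0) K x : Euc n →L[ℝ] Euc n) :=
        (ContMDiffOn.mdifferentiableWithinAt_family hf.contMDiffOn
          (⟨le_rfl, zero_le_one⟩ : (0 : ℝ) ∈ Icc (0 : ℝ) 1) hx).hasMFDerivWithinAt
      have h2 : (mfderivWithin (𝓡 n) (𝓡 n) (f 0) K x : Euc n →L[ℝ] Euc n) v = v :=
        hd.eq_on_tangentSpaceOf hid hv
      rw [h2, hf.map_zero x hx]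
      rfl
    · change T.stepMap g K f s s' x (a (T.incl x v)) = _
      rw [ha]
      exact T.stepMap_apply g (hf.immersion s hs x hx) hv

end TangentEmbedding

end IsotopyTransport

section ConormalIsotopy

variable {n k : ℕ} {Q : Type u} [TopologicalSpace Q] [ChartedSpace (Euc n) Q]
  [IsManifold (𝓡 n) ∞ Q] {V : Type*} [NormedAddCommGroup V] [NormedSpace ℝ V]
  (T : TangentEmbedding n Q V) (g : RiemMetric n Q) {K K' : Set Q} {f : ℝ → Q → Q}

theorem IsSmoothIsotopy.contMDiffOn_apply {E : Type} [NormedAddCommGroup E] [NormedSpace ℝ E]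
    {H : Type} [TopologicalSpace H] {I : ModelWithCorners ℝ E H} {M : Type u} [TopologicalSpace M]
    [ChartedSpace H M] {S S' : Set M} {F : ℝ → M → M} (hF : IsSmoothIsotopy I S S' F) {t : ℝ}
    (ht : t ∈ Icc (0 : ℝ) 1) : ContMDiffOn I I ∞ (F t) S :=
  hF.contMDiffOn.comp (f := fun y : M => (t, y)) (contMDiffOn_const.prodMk contMDiffOn_id)
    fun _ hy => ⟨ht, hy⟩

namespace TangentEmbedding

theorem push_one {ξ : Cotangent n Q} (hξ : normSq g ξ = 1) : T.push g 1 ξ.proj ξ = ξ := by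
  have h : T.hat ξ ∘L ((1 : V →L[ℝ] V) ∘L T.incl ξ.proj) = (1 : ℝ) • covec ξ := by
    rw [one_smul]
    exact ContinuousLinearMap.ext fun v => T.hat_incl ξ v
  rw [push, h]
  exact normalizeCov_mkCov_smul g one_pos hξ

theorem push_mem_unitConormalBundle {A : V →L[ℝ] V} {y : Q} {ξ : Cotangent n Q}
    {K : Set Q} (hy : y ∈ K) (h0 : T.hat ξ ∘L (A ∘L T.incl y) ≠ 0)
    (h : ∀ v ∈ tanE n K y, T.hat ξ (A (T.incl y v)) = 0) :
    T.push g A y ξ ∈ unitConormalBundle g K := by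
  refine (mem_unitConormalBundle_iff g _).2 ⟨⟨hy, fun v hv => ?_⟩, T.normSq_push g h0⟩
  obtain ⟨c, -, hc⟩ := T.exists_covec_push g h0
  have h1 : covec (T.push g A y ξ) v = c * T.hat ξ (A (T.incl y v)) := by rw [hc]; rfl
  exact h1.trans (by rw [h v hv, mul_zero])

/-- The maps of covectors that lift an isotopy of submanifolds. -/
theorem exists_unitConormal_isotopy [CompleteSpace V] [T2Space Q] [SecondCountableTopology Q]
    (T : TangentEmbedding n Q V) (g : RiemMetric n Q)
    (hK : IsSubmanifold (𝓡 n) k K) (hf : IsSmoothIsotopy (𝓡 n) K K' f) :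
    ∃ F : ℝ → Cotangent n Q → Cotangent n Q,
      IsSmoothIsotopy (cotangentModel n) (unitConormalBundle g K) (unitConormalBundle g K') F ∧
      ∀ t ∈ Icc (0 : ℝ) 1, F t '' unitConormalBundle g K = unitConormalBundle g (f t '' K) ∧
        ∀ ξ, (F t ξ).proj = f t ξ.proj := by
  obtain ⟨𝓔, h𝓔, h𝓔0, h𝓔1⟩ := T.exists_transport g hK hf
  -- Covectors move forward by composition with the inverse of the transport, so that they stay zero
  -- on the images of the tangent spaces of `K`.
  let A : ℝ → Q → V →L[ℝ] V := fun t x => Ring.inverse (𝓔 t x)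
  let F : ℝ → Cotangent n Q → Cotangent n Q := fun t ξ => T.push g (A t ξ.proj) (f t ξ.proj) ξ
  have hA1 : ∀ t ∈ Icc (0 : ℝ) 1, ∀ x ∈ K, A t x * 𝓔 t x = 1 := fun t ht x hx =>
    Ring.inverse_mul_cancel _ (h𝓔1 t ht x hx).1
  have hA2 : ∀ t ∈ Icc (0 : ℝ) 1, ∀ x ∈ K, 𝓔 t x * A t x = 1 := fun t ht x hx =>
    Ring.mul_inverse_cancel _ (h𝓔1 t ht x hx).1
  have hAN : ∀ t ∈ Icc (0 : ℝ) 1, ∀ x ∈ K, A t x * T.proj (f t x) = T.proj x * A t x :=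
    fun t ht x hx => by
      calc A t x * T.proj (f t x) = A t x * (T.proj (f t x) * 𝓔 t x) * A t x := by
            rw [mul_assoc, mul_assoc, hA2 t ht x hx, mul_one]
        _ = T.proj x * A t x := by
            rw [← (h𝓔1 t ht x hx).2.1, ← mul_assoc, hA1 t ht x hx, one_mul]
  have hpp : ∀ t ∈ Icc (0 : ℝ) 1, ∀ ξ ∈ unitConormalBundle g K,
      T.hat ξ ∘L (A t ξ.proj ∘L T.incl (f t ξ.proj)) ≠ 0 ∧
      T.push g (𝓔 t ξ.proj) ξ.proj (F t ξ) = ξ := fun t ht ξ hξ =>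
    T.push_push g rfl ((mem_unitConormalBundle_iff g ξ).1 hξ).2 (hA1 t ht _ hξ.1.1)
      (hAN t ht _ hξ.1.1)
  have hsm : ContMDiffOn (𝓘(ℝ, ℝ).prod (cotangentModel n)) (cotangentModel n) ∞
      (fun p : ℝ × Cotangent n Q => F p.1 p.2) (Icc 0 1 ×ˢ unitConormalBundle g K) := by
    rintro ⟨t, ξ⟩ ⟨ht, hξ⟩
    have hb : ContMDiffOn (𝓘(ℝ, ℝ).prod (cotangentModel n)) (𝓘(ℝ, ℝ).prod (𝓡 n)) ∞
        (fun p : ℝ × Cotangent n Q => (p.1, p.2.proj)) (Icc 0 1 ×ˢ unitConormalBundle g K) :=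
      (contMDiff_fst.prodMk (contMDiff_base.comp contMDiff_snd)).contMDiffOn
    have hmaps : MapsTo (fun p : ℝ × Cotangent n Q => (p.1, p.2.proj))
        (Icc 0 1 ×ˢ unitConormalBundle g K) (Icc 0 1 ×ˢ K) := fun p hp => ⟨hp.1, hp.2.1.1⟩
    refine T.contMDiffWithinAt_push g ?_ ((hf.contMDiffOn.comp hb hmaps) (t, ξ) ⟨ht, hξ⟩)
      contMDiff_snd.contMDiffAt.contMDiffWithinAt (hpp t ht ξ hξ).1
    have h1 := (h𝓔.comp hb hmaps) (t, ξ) ⟨ht, hξ⟩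
    have h2 : ContDiffAt ℝ ∞ (Ring.inverse : (V →L[ℝ] V) → V →L[ℝ] V) (𝓔 t ξ.proj) :=
      contDiffAt_ringInverse ℝ (h𝓔1 t ht ξ.proj hξ.1.1).1.unit
    exact ContMDiffAt.comp_contMDiffWithinAt (g := Ring.inverse) (t, ξ) h2.contMDiffAt h1
  -- The local left inverse `l` of `f t` recovers the base point, and pushing by `𝓔` there recovers
  -- the covector. These smooth left inverses give both the embedding and the immersion property of
  -- `F t`.
  have hloc : ∀ t ∈ Icc (0 : ℝ) 1, ∀ ξ ∈ unitConormalBundle g K,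
      ∃ (L : Cotangent n Q → Cotangent n Q) (O : Set (Cotangent n Q)), O ∈ 𝓝 (F t ξ) ∧
        ContMDiffAt (cotangentModel n) (cotangentModel n) ∞ L (F t ξ) ∧
        ∀ η ∈ unitConormalBundle g K, F t η ∈ O → L (F t η) = η := by
    intro t ht ξ hξ
    obtain ⟨-, O, -, l, -, hO, hfO, -, -, -, hl, hlK, hlf⟩ := hK.exists_levelSet_image
      (hf.contMDiffOn_apply ht) (hf.isEmbedding t ht) hξ.1.1 (hf.immersion t ht _ hξ.1.1)
    have hO' : IsOpen ((fun η : Cotangent n Q => η.proj) ⁻¹' O) :=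
      hO.preimage contMDiff_base.continuous
    have hleft : ∀ η ∈ unitConormalBundle g K, f t η.proj ∈ O →
        T.push g (𝓔 t (l (F t η).proj)) (l (F t η).proj) (F t η) = η := fun η hη hηO => by
      have h1 : l (F t η).proj = η.proj := hlf _ hη.1.1 hηO
      rw [h1]
      exact (hpp t ht η hη).2
    refine ⟨fun η => T.push g (𝓔 t (l η.proj)) (l η.proj) η, _, hO'.mem_nhds hfO, ?_, hleft⟩
    have hl' : ContMDiffOn (cotangentModel n) (𝓡 n) ∞ (fun η : Cotangent n Q => l η.proj)
        ((fun η : Cotangent n Q => η.proj) ⁻¹' O) :=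
      hl.comp contMDiff_base.contMDiffOn fun η hη => hη
    have h𝓔l : ContMDiffOn (cotangentModel n) 𝓘(ℝ, V →L[ℝ] V) ∞
        (fun η : Cotangent n Q => 𝓔 t (l η.proj)) ((fun η : Cotangent n Q => η.proj) ⁻¹' O) :=
      h𝓔.comp (f := fun η : Cotangent n Q => (t, l η.proj)) (contMDiffOn_const.prodMk hl')
        fun η hη => ⟨ht, hlK _ hη⟩
    refine (T.contMDiffWithinAt_push g (h𝓔l _ hfO) (hl' _ hfO)
      contMDiff_id.contMDiffAt.contMDiffWithinAt ?_).contMDiffAt (hO'.mem_nhds hfO)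
    have hlx : l (F t ξ).proj = ξ.proj := hlf _ hξ.1.1 hfO
    simp only [id]
    rw [hlx]
    exact (T.push_push g (ξ := F t ξ) (x := f t ξ.proj) (y := ξ.proj) rfl
      (T.normSq_push g (hpp t ht ξ hξ).1) (hA2 t ht _ hξ.1.1) (h𝓔1 t ht _ hξ.1.1).2.1).1
  have himg : ∀ t ∈ Icc (0 : ℝ) 1,
      F t '' unitConormalBundle g K = unitConormalBundle g (f t '' K) := by
    intro t ht
    -- The transport identifies the tangent spaces of `K` and of its image; dually, conormal
    -- covectors correspond, which gives both inclusions.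
    have hm : ∀ {x : Q}, x ∈ K → ∀ w, w ∈ tanE n (f t '' K) (f t x) ↔ ∃ v ∈ tanE n K x,
        T.incl (f t x) w = 𝓔 t x (T.incl x v) := fun {x} hx w => by
      refine (hK.mem_tangentSpaceOf_image_iff (hf.contMDiffOn_apply ht) (hf.isEmbedding t ht) hx
        (hf.immersion t ht x hx) w).trans (exists_congr fun v => and_congr_right fun hv => ?_)
      rw [(h𝓔1 t ht x hx).2.2 v hv]
      exact ⟨fun h => congrArg (T.incl (f t x)) h.symm, fun h => (T.incl_injective _ h).symm⟩
    refine Subset.antisymm ?_ ?_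
    · rintro _ ⟨ξ, hξ, rfl⟩
      have hx := hξ.1.1
      refine T.push_mem_unitConormalBundle g (mem_image_of_mem _ hx) (hpp t ht ξ hξ).1
        fun w hw => ?_
      obtain ⟨v, hv, hvw⟩ := (hm hx w).1 hw
      have h1 := congrArg (fun Z : V →L[ℝ] V => Z (T.incl ξ.proj v)) (hA1 t ht _ hx)
      rw [hvw]
      exact (congrArg (T.hat ξ) h1).trans ((T.hat_incl ξ v).trans (hξ.1.2 v hv))
    · rintro ⟨q, p⟩ hη
      obtain ⟨x, hx, rfl⟩ : q ∈ f t '' K := hη.1.1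
      obtain ⟨h0, h1⟩ := T.push_push g (ξ := ⟨f t x, p⟩) (x := f t x) (y := x) rfl
        ((mem_unitConormalBundle_iff g _).1 hη).2 (hA2 t ht x hx) (h𝓔1 t ht x hx).2.1
      refine ⟨T.push g (𝓔 t x) x ⟨f t x, p⟩, T.push_mem_unitConormalBundle g hx h0
        fun v hv => ?_, h1⟩
      have h2 := (h𝓔1 t ht x hx).2.2 v hv
      rw [h2]
      refine (T.hat_incl (⟨f t x, p⟩ : Cotangent n Q) _).trans (hη.1.2 _ ?_)
      exact (hm hx _).2 ⟨v, hv, h2.symm⟩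
  refine ⟨F, ⟨hsm, fun t ht => ?_, fun t ht ξ hξ => ?_, fun ξ hξ => ?_, ?_⟩,
    fun t ht => ⟨himg t ht, fun ξ => rfl⟩⟩
  · refine isEmbedding_of_local_leftInverse ?_ fun ξ hξ => ?_
    · exact hsm.continuousOn.comp (f := fun ξ : Cotangent n Q => (t, ξ)) (by fun_prop)
        fun ξ hξ => ⟨ht, hξ⟩
    · obtain ⟨L, O, hO, hL, hLF⟩ := hloc t ht ξ hξ
      exact ⟨L, O, hO, hL.continuousAt, hLF⟩
  · obtain ⟨L, O, hO, hL, hLF⟩ := hloc t ht ξ hξ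
    exact injOn_mfderivWithin_of_local_leftInverse hξ
      (ContMDiffOn.mdifferentiableWithinAt_family hsm ht hξ) hO (hL.mdifferentiableAt (by simp)) hLF
  · change T.push g (Ring.inverse (𝓔 0 ξ.proj)) (f 0 ξ.proj) ξ = ξ
    rw [h𝓔0 _ hξ.1.1, Ring.inverse_one, hf.map_zero _ hξ.1.1]
    exact T.push_one g ((mem_unitConormalBundle_iff g ξ).1 hξ).2
  · rw [himg 1 ⟨zero_le_one, le_rfl⟩, hf.image_one]

end TangentEmbedding

end ConormalIsotopy

/-! ### Isotopies preserve the spin structures -/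

section MapFrame

variable {E : Type} [NormedAddCommGroup E] [NormedSpace ℝ E] [FiniteDimensional ℝ E]
  {H : Type} [TopologicalSpace H] {I : ModelWithCorners ℝ E H} [I.Boundaryless]
  {M : Type u} [TopologicalSpace M] [ChartedSpace H M] [IsManifold I ∞ M] {S S' : Set M} {k : ℕ}
  {F : ℝ → M → M}

/-- The image of a frame under the differential of an isotopy. -/
def IsSmoothIsotopy.mapFrame (hF : IsSmoothIsotopy I S S' F) {t : ℝ} (ht : t ∈ Icc (0 : ℝ) 1)
    {S₁ : Set M} (h : F t '' S = S₁) (f : TangentFrame I S k) : TangentFrame I S₁ k where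
  pt := F t f.pt
  mem := h ▸ mem_image_of_mem _ f.mem
  vec := fun i => (mfderivWithin I I (F t) S f.pt : E →L[ℝ] E) (f.vecE i)
  tangent := fun i => by
    have hd : HasMFDerivWithinAt I I (F t) S f.pt (mfderivWithin I I (F t) S f.pt : E →L[ℝ] E) :=
      (ContMDiffOn.mdifferentiableWithinAt_family hF.contMDiffOn ht f.mem).hasMFDerivWithinAt
    exact hd.mem_tangentSpaceOf (Filter.Eventually.of_forall fun y hy =>
      h ▸ mem_image_of_mem _ hy) (f.tangent i)
  indep := by
    refine f.linearIndependent_vecE.map_injOn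
      (mfderivWithin I I (F t) S f.pt : E →L[ℝ] E).toLinearMap ?_
    have hle : Submodule.span ℝ (range f.vecE) ≤
        (tangentSpaceOf I S f.pt : Submodule ℝ E) :=
      Submodule.span_le.2 (by rintro _ ⟨i, rfl⟩; exact f.tangent i)
    exact (hF.immersion t ht f.pt f.mem).mono hle

theorem IsSmoothIsotopy.mapFrame_zero_vecE (hF : IsSmoothIsotopy I S S' F)
    (ht : (0 : ℝ) ∈ Icc (0 : ℝ) 1) {S₁ : Set M} (h : F 0 '' S = S₁) (f : TangentFrame I S k)
    (i : Fin k) : (hF.mapFrame ht h f).vecE i = f.vecE i := by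
  have hid : HasMFDerivWithinAt I I (F 0) S f.pt (ContinuousLinearMap.id ℝ E) :=
    (hasMFDerivWithinAt_id S f.pt).congr_mono (fun y hy => hF.map_zero y hy)
      (hF.map_zero f.pt f.mem) subset_rfl
  have hd : HasMFDerivWithinAt I I (F 0) S f.pt (mfderivWithin I I (F 0) S f.pt : E →L[ℝ] E) :=
    (ContMDiffOn.mdifferentiableWithinAt_family hF.contMDiffOn ht f.mem).hasMFDerivWithinAt
  exact hd.eq_on_tangentSpaceOf hid (f.tangent i)

theorem IsSmoothIsotopy.continuous_mapFrame_toBundle {d : ℕ} (hS : IsSubmanifold I d S)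
    (hF : IsSmoothIsotopy I S S' F) (i : Fin k) :
    Continuous fun z : unitInterval × TangentFrame I S k =>
      tangentMapWithin I I (F z.1) S (z.2.toBundle i) := by
  have h := hS.continuousOn_tangentMapWithin_family (uniqueDiffOn_Icc zero_lt_one) hF.contMDiffOn
  refine h.comp_continuous (f := fun z : unitInterval × TangentFrame I S k =>
    ((z.1 : ℝ), z.2.toBundle i)) ?_ fun z => ⟨z.1.2, z.2.mem, z.2.tangent i⟩
  exact (continuous_subtype_val.comp continuous_fst).prodMk
    ((TangentFrame.continuous_toBundle i).comp continuous_snd)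

theorem IsSmoothIsotopy.continuous_mapFrame_pt (hF : IsSmoothIsotopy I S S' F) :
    Continuous fun z : unitInterval × TangentFrame I S k => F z.1 z.2.pt :=
  hF.contMDiffOn.continuousOn.comp_continuous
    ((continuous_subtype_val.comp continuous_fst).prodMk
      (TangentFrame.continuous_pt.comp continuous_snd)) fun z => ⟨z.1.2, z.2.mem⟩

end MapFrame

section Preservation

variable {m k k' : ℕ} {Q : Type u} [TopologicalSpace Q] [ChartedSpace (Euc (m + 1)) Q]
  [IsManifold (𝓡 (m + 1)) ∞ Q] {V : Type*} [NormedAddCommGroup V] [NormedSpace ℝ V]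
  (T : TangentEmbedding (m + 1) Q V) (g : RiemMetric (m + 1) Q) {K K' : Set Q}
  (hK : IsSubmanifold (𝓡 (m + 1)) k K) (hK' : IsSubmanifold (𝓡 (m + 1)) k' K')
  (σQ : SpinStructure (𝓡 (m + 1)) (univ : Set Q) (m + 1))
  {f : ℝ → Q → Q} {F : ℝ → Cotangent (m + 1) Q → Cotangent (m + 1) Q}

theorem IsSmoothIsotopy.isSubmanifold_image (hK : IsSubmanifold (𝓡 (m + 1)) k K)
    (hf : IsSmoothIsotopy (𝓡 (m + 1)) K K' f) {t : ℝ} (ht : t ∈ Icc (0 : ℝ) 1) :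
    IsSubmanifold (𝓡 (m + 1)) k (f t '' K) :=
  hK.image (hf.contMDiffOn_apply ht) (hf.isEmbedding t ht) (hf.immersion t ht)

namespace TangentEmbedding

/-- At the ends of an isotopy the sets `f 0 '' K` and `f 1 '' K` are equal to `K` and `K'`, but not
by definition. Frames over equal sets are therefore compared by points and vectors. -/
theorem unitFrame_eq_unitFrame {s s' : ℝ} (hs : s ≠ 0) (hs' : s' ≠ 0) (h : s = s')
    (hKK : K = K')
    {φ : TangentFrame (cotangentModel (m + 1)) (unitConormalBundle g K) m}
    {φ' : TangentFrame (cotangentModel (m + 1)) (unitConormalBundle g K') m}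
    (hp : φ.pt = φ'.pt) (hv : ∀ i, φ.vecE i = φ'.vecE i) :
    T.unitFrame g hK hs φ = T.unitFrame g hK' hs' φ' := by
  subst h hKK
  obtain rfl : φ = φ' := TangentFrame.eq_of_vecE hp hv
  refine TangentFrame.eq_of_vecE rfl (Fin.cases ?_ fun i => ?_)
  · rw [unitFrame_vecE_zero, unitFrame_vecE_zero]
  · rw [unitFrame_vecE_succ, unitFrame_vecE_succ]

/-- The frames of `Q` given by the images of a frame of the unit conormal bundle along an
isotopy. -/
def frameHomotopy (hf : IsSmoothIsotopy (𝓡 (m + 1)) K K' f)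
    (hF : IsSmoothIsotopy (cotangentModel (m + 1)) (unitConormalBundle g K)
      (unitConormalBundle g K') F)
    (hi : ∀ t ∈ Icc (0 : ℝ) 1, F t '' unitConormalBundle g K = unitConormalBundle g (f t '' K))
    {s : TangentFrame (cotangentModel (m + 1)) (unitConormalBundle g K) m → ℝ}
    (hs : ∀ φ, s φ ≠ 0)
    (z : unitInterval × TangentFrame (cotangentModel (m + 1)) (unitConormalBundle g K) m) :
    TangentFrame (𝓡 (m + 1)) (univ : Set Q) (m + 1) :=
  T.unitFrame g (hf.isSubmanifold_image hK z.1.2) (hs z.2) (hF.mapFrame z.1.2 (hi z.1 z.1.2) z.2)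

variable (hf : IsSmoothIsotopy (𝓡 (m + 1)) K K' f)
  (hF : IsSmoothIsotopy (cotangentModel (m + 1)) (unitConormalBundle g K)
    (unitConormalBundle g K') F)
  (hi : ∀ t ∈ Icc (0 : ℝ) 1, F t '' unitConormalBundle g K = unitConormalBundle g (f t '' K))

/-- The first vector is the scaled dual of the moving covector. The others come from `conormalTotal`
for the moving submanifold, hence the need for tangent projections continuous in the time. -/
theorem continuous_frameHomotopy (hp : ∀ t ∈ Icc (0 : ℝ) 1, ∀ ξ, (F t ξ).proj = f t ξ.proj)
    {s : TangentFrame (cotangentModel (m + 1)) (unitConormalBundle g K) m → ℝ}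
    (hs : ∀ φ, s φ ≠ 0) (hsc : Continuous s) :
    Continuous (T.frameHomotopy g hK hf hF hi hs) := by
  have hpt := hF.continuous_mapFrame_pt (k := m)
  have hq : Continuous fun z : unitInterval × TangentFrame (cotangentModel (m + 1))
      (unitConormalBundle g K) m => (F z.1 z.2.pt).proj := contMDiff_base.continuous.comp hpt
  refine TangentFrame.continuous_of hq (Fin.cases ?_ fun i => ?_)
  · refine T.continuous_tangentBundle hq ?_
    have h1 := ((T.contMDiff_sharpHat g).continuous.comp hq).clm_apply
      (T.contMDiff_hat.continuous.comp hpt)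
    refine ((hsc.comp continuous_snd).smul h1).congr fun z => ?_
    have h2 : T.incl (F z.1 z.2.pt).proj ((T.frameHomotopy g hK hf hF hi hs z).vecE 0) =
        s z.2 • T.sharpHat g (F z.1 z.2.pt).proj (T.hat (F z.1 z.2.pt)) := by
      rw [frameHomotopy, unitFrame_vecE_zero, T.sharpHat_hat, map_smul]
      rfl
    exact h2.symm
  · refine T.continuous_conormalTotal g (L := fun z : unitInterval × TangentFrame
      (cotangentModel (m + 1)) (unitConormalBundle g K) m => f z.1 '' K)
      (hF.continuous_mapFrame_toBundle (T.isSubmanifold_unitConormalBundle g hK) i) ?_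
    have h1 : Continuous fun z : unitInterval × TangentFrame (cotangentModel (m + 1))
        (unitConormalBundle g K) m => ((z.1 : ℝ), z.2.pt.proj) :=
      (continuous_subtype_val.comp continuous_fst).prodMk
        (contMDiff_base.continuous.comp (TangentFrame.continuous_pt.comp continuous_snd))
    refine ((T.continuousOn_tangentProj_family g hK hf).comp_continuous h1
      fun z => ⟨z.1.2, z.2.mem.1.1⟩).congr fun z => ?_
    exact congrArg (T.tangentProj g (f z.1 '' K)) (hp z.1 z.1.2 z.2.pt).symm

theorem frameHomotopy_zero
    {s : TangentFrame (cotangentModel (m + 1)) (unitConormalBundle g K) m → ℝ}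
    (hs : ∀ φ, s φ ≠ 0) (φ : TangentFrame (cotangentModel (m + 1)) (unitConormalBundle g K) m) :
    T.frameHomotopy g hK hf hF hi hs (0, φ) = T.unitFrame g hK (hs φ) φ := by
  have h : f 0 '' K = K := by
    refine Subset.antisymm ?_ fun x hx => ⟨x, hx, hf.map_zero x hx⟩
    rintro _ ⟨x, hx, rfl⟩
    exact (hf.map_zero x hx).symm ▸ hx
  exact T.unitFrame_eq_unitFrame g _ _ _ _ rfl h (hF.map_zero _ φ.mem)
    (hF.mapFrame_zero_vecE _ _ φ)

theorem frameHomotopy_one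
    {s : TangentFrame (cotangentModel (m + 1)) (unitConormalBundle g K) m → ℝ}
    (hs : ∀ φ, s φ ≠ 0) (φ : TangentFrame (cotangentModel (m + 1)) (unitConormalBundle g K) m)
    {s' : ℝ} (hs' : s' ≠ 0) (h : s φ = s') :
    T.frameHomotopy g hK hf hF hi hs (1, φ) =
      T.unitFrame g hK' hs' (hF.mapFrame (right_mem_Icc.2 zero_le_one) hF.image_one φ) :=
  T.unitFrame_eq_unitFrame g _ _ _ _ h hf.image_one rfl fun _ => rfl

/-- Along the path of frames of `Q` positivity is clopen in the time, and the interval is connected.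
-/
theorem mapFrame_mem_unitPositive_iff
    (hp : ∀ t ∈ Icc (0 : ℝ) 1, ∀ ξ, (F t ξ).proj = f t ξ.proj)
    (hf : IsSmoothIsotopy (𝓡 (m + 1)) K K' f)
    (hi : ∀ t ∈ Icc (0 : ℝ) 1, F t '' unitConormalBundle g K = unitConormalBundle g (f t '' K))
    (φ : TangentFrame (cotangentModel (m + 1)) (unitConormalBundle g K) m) :
    hF.mapFrame (right_mem_Icc.2 zero_le_one) hF.image_one φ ∈ T.unitPositive g hK' σQ ↔
      φ ∈ T.unitPositive g hK σQ := by
  have hc := T.continuous_frameHomotopy g hK hf hF hi hp (s := fun _ => 1)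
    (fun _ => one_ne_zero) continuous_const
  have hcl : IsClopen {t : unitInterval | T.frameHomotopy g hK hf hF hi
      (s := fun _ => 1) (fun _ => one_ne_zero) (t, φ) ∈ σQ.positive} :=
    σQ.isClopen_positive.preimage (hc.comp (continuous_id.prodMk continuous_const))
  have h1 : (1 : unitInterval) ∈ {t : unitInterval | T.frameHomotopy g hK hf hF hi
      (s := fun _ => 1) (fun _ => one_ne_zero) (t, φ) ∈ σQ.positive} ↔
      (0 : unitInterval) ∈ {t : unitInterval | T.frameHomotopy g hK hf hF hi
      (s := fun _ => 1) (fun _ => one_ne_zero) (t, φ) ∈ σQ.positive} := by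
    rcases isClopen_iff.1 hcl with h | h <;> rw [h] <;> simp
  rw [mem_ofPred_eq, mem_ofPred_eq, frameHomotopy_zero,
    T.frameHomotopy_one g hK hK' hf hF hi _ φ one_ne_zero rfl] at h1
  exact h1

theorem radialSign_mapFrame
    (hp : ∀ t ∈ Icc (0 : ℝ) 1, ∀ ξ, (F t ξ).proj = f t ξ.proj)
    (hf : IsSmoothIsotopy (𝓡 (m + 1)) K K' f)
    (hi : ∀ t ∈ Icc (0 : ℝ) 1, F t '' unitConormalBundle g K = unitConormalBundle g (f t '' K))
    (φ : TangentFrame (cotangentModel (m + 1)) (unitConormalBundle g K) m) :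
    T.radialSign g hK σQ φ = T.radialSign g hK' σQ
      (hF.mapFrame (right_mem_Icc.2 zero_le_one) hF.image_one φ) := by
  classical
  unfold radialSign
  refine if_congr (and_congr_right fun _ => not_congr
    (T.mapFrame_mem_unitPositive_iff g hK hK' σQ hF hp hf hi φ).symm) rfl rfl

/-- The spin structures of the unit conormal bundles are preserved by isotopies. -/
theorem preservesSpin_of_isotopy
    (hp : ∀ t ∈ Icc (0 : ℝ) 1, ∀ ξ, (F t ξ).proj = f t ξ.proj)
    (hf : IsSmoothIsotopy (𝓡 (m + 1)) K K' f)
    (hF : IsSmoothIsotopy (cotangentModel (m + 1)) (unitConormalBundle g K)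
      (unitConormalBundle g K') F)
    (hi : ∀ t ∈ Icc (0 : ℝ) 1, F t '' unitConormalBundle g K = unitConormalBundle g (f t '' K)) :
    PreservesSpin (F 1) (T.unitConormalSpin g hK σQ) (T.unitConormalSpin g hK' σQ) := by
  have h01 : (1 : ℝ) ∈ Icc (0 : ℝ) 1 := right_mem_Icc.2 zero_le_one
  refine ⟨fun φ φ' hpt hv => ?_, ?_⟩
  · obtain rfl : φ' = hF.mapFrame h01 hF.image_one φ := TangentFrame.ext_toBundle hpt hv
    exact T.mapFrame_mem_unitPositive_iff g hK hK' σQ hF hp hf hi φ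
  have hc := T.continuous_frameHomotopy g hK hf hF hi hp (T.radialSign_ne_zero g hK σQ)
    (T.continuous_radialSign g hK σQ)
  have hσ := (T.unitConormalSpin g hK σQ).isCoveringMap.continuous
  -- A point of the covering of `Λ_K` contains a point of the covering of `σQ` over the initial
  -- frame. Lifting the homotopy of frames from there ends over the frame that defines the spin
  -- structure of `Λ_{K'}`.
  let H : C(unitInterval × (T.unitConormalSpin g hK σQ).cover,
      TangentFrame (𝓡 (m + 1)) (univ : Set Q) (m + 1)) :=
    ⟨fun z => T.frameHomotopy g hK hf hF hi (T.radialSign_ne_zero g hK σQ)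
      (z.1, (T.unitConormalSpin g hK σQ).proj z.2),
      hc.comp (continuous_fst.prodMk (hσ.comp continuous_snd))⟩
  let f₀ : C((T.unitConormalSpin g hK σQ).cover, σQ.cover) :=
    ⟨fun z => z.1.2, T.continuous_unitConormalSpin_snd g hK σQ⟩
  have hH0 : ∀ a, H (0, a) = σQ.proj (f₀ a) := fun a =>
    (T.frameHomotopy_zero g hK hf hF hi (T.radialSign_ne_zero g hK σQ) a.1.1).trans a.2.symm
  let L := σQ.isCoveringMap.liftHomotopy H f₀ hH0
  have hL : ∀ z, σQ.proj (L z) = H z :=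
    congrFun (σQ.isCoveringMap.liftHomotopy_lifts H f₀ hH0)
  have hL0 : ∀ a, L (0, a) = f₀ a := σQ.isCoveringMap.liftHomotopy_zero H f₀ hH0
  have hL1 : ∀ a : (T.unitConormalSpin g hK σQ).cover, σQ.proj (L (1, a)) =
      T.signedFrame g hK' σQ (hF.mapFrame h01 hF.image_one
        ((T.unitConormalSpin g hK σQ).proj a)) := fun a =>
    (hL (1, a)).trans (T.frameHomotopy_one g hK hK' hf hF hi (T.radialSign_ne_zero g hK σQ) _ _
      (T.radialSign_mapFrame g hK hK' σQ hF hp hf hi _))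
  have hmap : Continuous fun φ : TangentFrame (cotangentModel (m + 1)) (unitConormalBundle g K) m =>
      hF.mapFrame h01 hF.image_one φ := by
    have h1 : Continuous fun φ : TangentFrame (cotangentModel (m + 1))
      (unitConormalBundle g K) m => ((1 : unitInterval), φ) := continuous_const.prodMk continuous_id
    exact TangentFrame.continuous_of (hF.continuous_mapFrame_pt.comp h1) fun i =>
      (hF.continuous_mapFrame_toBundle (T.isSubmanifold_unitConormalBundle g hK) i).comp h1
  refine ⟨fun p => ⟨(hF.mapFrame h01 hF.image_one ((T.unitConormalSpin g hK σQ).proj p.1),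
    L (1, p.1)), hL1 p.1⟩, ?_, fun p => ⟨rfl, fun i => rfl⟩, fun p p' hpp h => ?_⟩
  · refine Continuous.subtype_mk (Continuous.prodMk
      (hmap.comp (hσ.comp continuous_subtype_val)) ?_) _
    exact L.continuous.comp (continuous_const.prodMk continuous_subtype_val)
  · have h1 : L (1, p.1) = L (1, p'.1) := congrArg (fun z => z.1.2) h
    -- Two lifts of the same path that agree at time `1` agree at time `0`; this is injectivity on
    -- fibres.
    have h2 := σQ.isCoveringMap.eq_of_comp_eq (A := unitInterval)
      (g₁ := fun t => L (t, p.1)) (g₂ := fun t => L (t, p'.1))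
      (L.continuous.comp (continuous_id.prodMk continuous_const))
      (L.continuous.comp (continuous_id.prodMk continuous_const))
      (funext fun t => (hL (t, p.1)).trans ((congrArg (fun φ => T.frameHomotopy g hK hf hF hi
        (T.radialSign_ne_zero g hK σQ) (t, φ)) hpp).trans (hL (t, p'.1)).symm)) 1 h1
    have h3 : f₀ p.1 = f₀ p'.1 := (hL0 p.1).symm.trans ((congrFun h2 0).trans (hL0 p'.1))
    exact Subtype.ext (Subtype.ext (Prod.ext hpp h3))

end TangentEmbedding

end Preservation

theorem mainTheorem7 {m : ℕ} {Q : Type u} [TopologicalSpace Q] [T2Space Q]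
    [SecondCountableTopology Q] [ChartedSpace (EuclideanSpace ℝ (Fin (m + 1))) Q]
    [IsManifold (𝓡 (m + 1)) ∞ Q] (g : RiemMetric (m + 1) Q)
    (σQ : SpinStructure (𝓡 (m + 1)) (univ : Set Q) (m + 1)) :
    ∃ σ : ∀ K : EmbeddedSubmanifold (𝓡 (m + 1)) Q,
        SpinStructure (cotangentModel (m + 1)) (unitConormalBundle g K.carrier) m,
      (∀ K, IsLegendrian g (unitConormalBundle g K.carrier) ∧
        IsInducedSpin g K.carrier σQ (σ K)) ∧
      ∀ K K', AreIsotopic (𝓡 (m + 1)) K.carrier K'.carrier →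
        AreLegendrianSpinIsotopic g (σ K) (σ K') := by
  obtain ⟨T⟩ := nonempty_tangentEmbedding (n := m + 1) (Q := Q)
  refine ⟨fun K => T.unitConormalSpin g K.isSubmanifold σQ, fun K =>
    ⟨T.isLegendrian_unitConormalBundle g K.isSubmanifold,
      T.isInducedSpin_unitConormalSpin g K.isSubmanifold σQ⟩, ?_⟩
  rintro K K' ⟨f, hf⟩
  obtain ⟨F, hF, hFi⟩ := T.exists_unitConormal_isotopy g K.isSubmanifold hf
  refine ⟨F, hF, fun t ht => ?_, T.preservesSpin_of_isotopy g K.isSubmanifold K'.isSubmanifold σQ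
    (fun t ht => (hFi t ht).2) hf hF fun t ht => (hFi t ht).1⟩
  -- Every stage of the isotopy is itself a unit conormal bundle, hence Legendrian.
  rw [(hFi t ht).1]
  exact T.isLegendrian_unitConormalBundle g (hf.isSubmanifold_image K.isSubmanifold ht)
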